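/- **Setting.** Fix a gate set $G$: a set of unitary gates, each acting on at most $K$ qubits for some fixed $K$, such that the exchange (SWAP) of two qubits is, up to a scalar, a circuit over $G$ (for instance all one- and two-qubit unitaries, or Clifford+$T$). A bipartite operator on $a+b$ qubits is an operator on $(\mathbb C^2)^{\otimes a}\otimes(\mathbb C^2)^{\otimes b}$. An *LOCC channel* is a trace-preserving map of the form $\Gamma=\sum_{y\in Y}\mathcal S^y\otimes\mathcal W^y$ with $Y$ finite and $\mathcal S^y,\mathcal W^y$ completely positive and trace-nonincreasing on Alice's and Bob's side. A *circuit description* of $\Gamma$, from $n_A+n_B$ to $m_A+m_B$ qubits, consists of ancilla registers $A',B'$ of $t_A,t_B$ qubits, a communication register $C$ of $q\ge 1$ qubits, and $r$ pairs of circuits over $G$: $\mathcal C_{A,i}$ acting on $(A,A',C)$ and $\mathcal C_{B,i}$ acting on $(B,B',C)$. The input is held in $(A,B)$ and all other qubits start in $|0\rangle$. In each round $i=1,\dots,r$ Alice applies $\mathcal C_{A,i}$, $C$ is measured in the computational basis, Bob applies $\mathcal C_{B,i}$, and $C$ is measured again. The output is the state of the first $m_A$ qubits of $(A,A')$ and the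 first $m_B$ qubits of $(B,B')$. Its *size* is the total number of gates, ancilla creations ($t_A+t_B+q$) and single-qubit measurements ($2rq$). A family $\{\Gamma^\lambda\}_{\lambda\in\mathbb N^+}$ of LOCC channels is *efficient* if there is a polynomial $c$ such that every $\Gamma^\lambda$ has a circuit description of size at most $c(\lambda)$. Let $F(\rho,\sigma)=\|\sqrt\rho\sqrt\sigma\|_1^2$, and let $\Phi^{\otimes n}$ be the state of $n$ EPR pairs. For $\varepsilon:\mathbb N^+\to[0,1]$, a family $\{\rho^\lambda\}$ of bipartite operators, where $\rho^\lambda$ is on $n_A(\lambda)+n_B(\lambda)$ qubits, and $n:\mathbb N^+\to\mathbb N^+$, write $\hat E_C^\varepsilon(\{\rho^\lambda\})\le n(\lambda)$ if there is an efficient family of LOCC channels $\hat\Gamma^\lambda$, from $n(\lambda)+n(\lambda)$ to $n_A(\lambda)+n_B(\lambda)$ qubits, with $1-F(\hat\Gamma^\lambda(\Phi^{\otimes n(\lambda)}),\rho^\lambda)\le\varepsilon(\lambda)$ for all $\lambda\in\mathbb N^+$. **Theorem.** 1. Let $\varepsilon:\mathbb N^+\to[0,1]$ and $n,n_A,n_B,m_A,m_B:\mathbb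 N^+\to\mathbb N^+$ be functions, let $\{\rho^\lambda\}_{\lambda\in\mathbb N^+}$ be a family of bipartite states on $n_A(\lambda)+n_B(\lambda)$ qubits, and let $\{\Lambda^\lambda\}_{\lambda\in\mathbb N^+}$ be an efficient family of LOCC channels from $n_A(\lambda)+n_B(\lambda)$ to $m_A(\lambda)+m_B(\lambda)$ qubits. Then $$\hat E_C^{\varepsilon}(\{\rho^\lambda\})\le n(\lambda)\implies \hat E_C^{\varepsilon}(\{\Lambda^\lambda(\rho^\lambda)\})\le n(\lambda).$$ 2. This monotonicity fails for general families of LOCC channels, and even for families of local unitary channels: for every $\varepsilon:\mathbb N^+\to[0,1]$ that does not converge to $1$ as $\lambda\to\infty$, there are functions $n,n_A,n_B:\mathbb N^+\to\mathbb N^+$, with $n_A,n_B$ polynomials, a family $\{\rho^\lambda\}$ of bipartite states on $n_A(\lambda)+n_B(\lambda)$ qubits, and a family of LOCC channels of the form $\Lambda^\lambda(X)=(U^\lambda\otimes V^\lambda)X(U^\lambda\otimes V^\lambda)^\dagger$ with $U^\lambda,V^\lambda$ unitary, such that $\hat E_C^{\varepsilon}(\{\rho^\lambda\})\le n(\lambda)$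 holds but $\hat E_C^{\varepsilon}(\{\Lambda^\lambda(\rho^\lambda)\})\le n(\lambda)$ does not. -/

import Mathlib

open scoped Matrix ComplexOrder Kronecker

noncomputable section

namespace CompEnt

/-! ### Qubit registers, states, fidelity -/

/-- Computational basis labels of a register whose qubits are indexed by `W`. -/
abbrev Bits (W : Type) : Type := W → Fin 2

/-- Computational basis labels of `n` qubits. -/
abbrev Q (n : ℕ) : Type := Bits (Fin n)

/-- Operators on `(ℂ²)^{⊗a} ⊗ (ℂ²)^{⊗b}` (Alice holds `a` qubits and Bob holds `b` qubits). -/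
abbrev Op (a b : ℕ) : Type := Matrix (Q a × Q b) (Q a × Q b) ℂ

/-- Density matrices. -/
def IsState {ι : Type} [Fintype ι] (ρ : Matrix ι ι ℂ) : Prop :=
  ρ.PosSemidef ∧ ρ.trace = 1

/-- The positive semidefinite square root of a positive semidefinite matrix (spectral calculus). -/
def msqrt {ι : Type} [Fintype ι] [DecidableEq ι] (A : Matrix ι ι ℂ) : Matrix ι ι ℂ :=
  cfc Real.sqrt A

/-- The Schatten `1`-norm `Tr |A|` with `|A| = √(A† A)`. -/
def traceNorm {ι : Type} [Fintype ι] [DecidableEq ι] (A : Matrix ι ι ℂ) : ℝ :=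
  (msqrt (Aᴴ * A)).trace.re

/-- The fidelity `F(ρ, σ) = ‖√ρ √σ‖₁²`. -/
def fidelity {ι : Type} [Fintype ι] [DecidableEq ι] (ρ σ : Matrix ι ι ℂ) : ℝ :=
  traceNorm (msqrt ρ * msqrt σ) ^ 2

/-- Amplitudes of `n` EPR pairs `(|00⟩ + |11⟩)/√2`; the `i`-th pair consists of the `i`-th qubit
of Alice and the `i`-th qubit of Bob. -/
def eprVec (n : ℕ) (x : Q n × Q n) : ℂ :=
  ∏ i, if x.1 i = x.2 i then ((1 / Real.sqrt 2 : ℝ) : ℂ) else 0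

/-- The density matrix `Φ^{⊗n}` of `n` EPR pairs. -/
def epr (n : ℕ) : Op n n :=
  Matrix.of fun x y => eprVec n x * star (eprVec n y)

/-! ### LOCC channels -/

/-- `id_k ⊗ Φ`, acting on `k × k` block matrices. -/
def ampl {ι κ : Type} (k : ℕ) (Φ : Matrix ι ι ℂ →ₗ[ℂ] Matrix κ κ ℂ)
    (X : Matrix (Fin k × ι) (Fin k × ι) ℂ) : Matrix (Fin k × κ) (Fin k × κ) ℂ :=
  Matrix.of fun x y => Φ (Matrix.of fun i j => X (x.1, i) (y.1, j)) x.2 y.2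

/-- Complete positivity. -/
def IsCP {ι κ : Type} [Fintype ι] [Fintype κ] (Φ : Matrix ι ι ℂ →ₗ[ℂ] Matrix κ κ ℂ) : Prop :=
  ∀ (k : ℕ) (X : Matrix (Fin k × ι) (Fin k × ι) ℂ), X.PosSemidef → (ampl k Φ X).PosSemidef

/-- The trace does not increase on positive semidefinite operators. -/
def IsTraceNonincreasing {ι κ : Type} [Fintype ι] [Fintype κ]
    (Φ : Matrix ι ι ℂ →ₗ[ℂ] Matrix κ κ ℂ) : Prop :=
  ∀ X : Matrix ι ι ℂ, X.PosSemidef → (Φ X).trace.re ≤ X.trace.re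

/-- `Γ = ∑_y S_y ⊗ W_y` is trace preserving, where `y` ranges over a finite alphabet and all `S_y`,
`W_y` are completely positive and trace-nonincreasing. The equation is written on product
operators, which span. -/
def IsLOCC {a b a' b' : ℕ} (Γ : Op a b →ₗ[ℂ] Op a' b') : Prop :=
  (∃ (N : ℕ) (S : Fin N → (Matrix (Q a) (Q a) ℂ →ₗ[ℂ] Matrix (Q a') (Q a') ℂ))
      (W : Fin N → (Matrix (Q b) (Q b) ℂ →ₗ[ℂ] Matrix (Q b') (Q b') ℂ)),
    (∀ y, IsCP (S y) ∧ IsTraceNonincreasing (S y) ∧ IsCP (W y) ∧ IsTraceNonincreasing (W y)) ∧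
    ∀ (X : Matrix (Q a) (Q a) ℂ) (Y : Matrix (Q b) (Q b) ℂ),
      Γ (X ⊗ₖ Y) = ∑ y, S y X ⊗ₖ W y Y) ∧
  ∀ X : Op a b, (Γ X).trace = X.trace

/-! ### Quantum circuits -/

/-- A gate set: for each `k`, a set of unitary gates on `k` qubits. -/
abbrev GateSet : Type := (k : ℕ) → Set (Matrix.unitaryGroup (Q k) ℂ)

open Classical in
/-- The operator on the register `W` that applies `u` to the qubits `e 0, …, e (k-1)` and is the
identity on all other qubits. -/
def gateOp {W : Type} {k : ℕ} (e : Fin k ↪ W) (u : Matrix (Q k) (Q k) ℂ) :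
    Matrix (Bits W) (Bits W) ℂ :=
  Matrix.of fun x y => if ∀ w, w ∉ Set.range e → x w = y w then u (x ∘ e) (y ∘ e) else 0

/-- A gate of `G` together with the qubits of `W` on which it acts. -/
structure PlacedGate (G : GateSet) (W : Type) where
  arity : ℕ
  gate : Matrix.unitaryGroup (Q arity) ℂ
  gate_mem : gate ∈ G arity
  wires : Fin arity ↪ W

/-- A circuit over `G` on the register `W`: its gates in the order in which they are applied. -/
abbrev Circuit (G : GateSet) (W : Type) : Type := List (PlacedGate G W)

/-- The operator of a circuit on `W`, where `W` is a part (via `f`) of the larger register `V`. -/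
def circuitOp {G : GateSet} {W V : Type} [Fintype V] [DecidableEq V] (f : W ↪ V) :
    Circuit G W → Matrix (Bits V) (Bits V) ℂ
  | [] => 1
  | g :: C => circuitOp f C * gateOp (g.wires.trans f) (g.gate : Matrix _ _ ℂ)

/-- The exchange of two qubits. -/
def swapMatrix : Matrix (Q 2) (Q 2) ℂ :=
  Matrix.of fun x y => if x = y ∘ Equiv.swap 0 1 then 1 else 0

/-- The exchange of two qubits is, up to a scalar, the operator of some circuit over `G`. -/
def HasSwap (G : GateSet) : Prop :=
  ∃ (C : Circuit G (Fin 2)) (z : ℂ), circuitOp (Function.Embedding.refl _) C = z • swapMatrix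

/-- All gates of `G` act on at most `K` qubits, for some `K`. -/
def BoundedArity (G : GateSet) : Prop :=
  ∃ K : ℕ, ∀ k, (G k).Nonempty → k ≤ K

/-! ### Circuit descriptions of LOCC channels -/

/-- A circuit description of an LOCC map from `nA + nB` to `mA + mB` qubits: `tA`, `tB` ancilla
qubits, a communication register `C` of `q` qubits, and `r` rounds. -/
structure Protocol (G : GateSet) (nA nB mA mB : ℕ) where
  tA : ℕ
  tB : ℕ
  q : ℕ
  q_pos : 0 < q
  r : ℕ
  alice : Fin r → Circuit G (Fin (nA + tA) ⊕ Fin q)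
  bob : Fin r → Circuit G (Fin (nB + tB) ⊕ Fin q)
  outA : mA ≤ nA + tA
  outB : mB ≤ nB + tB

namespace Protocol

variable {G : GateSet} {nA nB mA mB : ℕ}

/-- The qubits of `(A, A')`, `(B, B')` and `C`. -/
abbrev Wires (P : Protocol G nA nB mA mB) : Type :=
  Fin (nA + P.tA) ⊕ Fin (nB + P.tB) ⊕ Fin P.q

/-- Alice's qubits `(A, A', C)`. -/
def aliceWires (P : Protocol G nA nB mA mB) : Fin (nA + P.tA) ⊕ Fin P.q ↪ P.Wires :=
  Function.Embedding.sumMap (Function.Embedding.refl _) Function.Embedding.inr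

/-- Bob's qubits `(B, B', C)`. -/
def bobWires (P : Protocol G nA nB mA mB) : Fin (nB + P.tB) ⊕ Fin P.q ↪ P.Wires :=
  Function.Embedding.inr

/-- The ancilla and communication qubits all have value `0` in the basis label `x`. -/
def AncillaZero (P : Protocol G nA nB mA mB) (x : Bits P.Wires) : Prop :=
  (∀ j, x (Sum.inl (Fin.natAdd nA j)) = 0) ∧ (∀ j, x (Sum.inr (Sum.inl (Fin.natAdd nB j))) = 0) ∧
    ∀ c, x (Sum.inr (Sum.inr c)) = 0

/-- The part of a basis label that belongs to the input registers `A` and `B`. -/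
def inputBits (P : Protocol G nA nB mA mB) (x : Bits P.Wires) : Q nA × Q nB :=
  (fun i => x (Sum.inl (Fin.castAdd P.tA i)),
    fun i => x (Sum.inr (Sum.inl (Fin.castAdd P.tB i))))

open Classical in
/-- The initial operator: `X` on `(A, B)` and `|0⟩⟨0|` on all other qubits. -/
def initOp (P : Protocol G nA nB mA mB) (X : Op nA nB) : Matrix (Bits P.Wires) (Bits P.Wires) ℂ :=
  Matrix.of fun x y =>
    if P.AncillaZero x ∧ P.AncillaZero y then X (P.inputBits x) (P.inputBits y) else 0

open Classical in
/-- Measurement of `C` in the computational basis, with the result kept in `C`. -/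
def measureC (P : Protocol G nA nB mA mB) (σ : Matrix (Bits P.Wires) (Bits P.Wires) ℂ) :
    Matrix (Bits P.Wires) (Bits P.Wires) ℂ :=
  Matrix.of fun x y =>
    if ∀ c, x (Sum.inr (Sum.inr c)) = y (Sum.inr (Sum.inr c)) then σ x y else 0

/-- Round `i`: Alice applies her circuit, `C` is measured, Bob applies his circuit, `C` is
measured again. -/
def round (P : Protocol G nA nB mA mB) (i : Fin P.r)
    (σ : Matrix (Bits P.Wires) (Bits P.Wires) ℂ) : Matrix (Bits P.Wires) (Bits P.Wires) ℂ :=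
  let U := circuitOp P.aliceWires (P.alice i)
  let V := circuitOp P.bobWires (P.bob i)
  P.measureC (V * P.measureC (U * σ * Uᴴ) * Vᴴ)

/-- The qubits that hold the output: the first `mA` of `(A, A')` and the first `mB` of `(B, B')`. -/
def outWires (P : Protocol G nA nB mA mB) : Fin mA ⊕ Fin mB ↪ P.Wires :=
  Function.Embedding.sumMap (Fin.castLEEmb P.outA)
    ((Fin.castLEEmb P.outB).trans Function.Embedding.inl)

open Classical in
/-- The partial trace over all qubits that do not hold the output. -/
def output (P : Protocol G nA nB mA mB) (σ : Matrix (Bits P.Wires) (Bits P.Wires) ℂ) : Op mA mB :=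
  Matrix.of fun a b => ∑ x, ∑ y,
    if x ∘ P.outWires = Sum.elim a.1 a.2 ∧ y ∘ P.outWires = Sum.elim b.1 b.2 ∧
      (∀ w, w ∉ Set.range P.outWires → x w = y w) then σ x y else 0

/-- The map carried out by the protocol. -/
def run (P : Protocol G nA nB mA mB) (X : Op nA nB) : Op mA mB :=
  P.output ((List.finRange P.r).foldl (fun σ i => P.round i σ) (P.initOp X))

/-- The circuit size: all unitary gates, all ancilla creations (`tA + tB + q` qubits), and all
measurements (the `q` qubits of `C`, twice in each round). -/
def size (P : Protocol G nA nB mA mB) : ℕ :=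
  (∑ i, ((P.alice i).length + (P.bob i).length)) + (P.tA + P.tB + P.q) + 2 * P.r * P.q

end Protocol

/-! ### Efficient families and the computational one-shot entanglement cost -/

/-- A family of LOCC channels with circuit descriptions over `G` of polynomially bounded size. -/
def IsEfficient (G : GateSet) {nA nB mA mB : ℕ+ → ℕ+}
    (Γ : ∀ l : ℕ+, Op (nA l) (nB l) →ₗ[ℂ] Op (mA l) (mB l)) : Prop :=
  (∀ l, IsLOCC (Γ l)) ∧
  ∃ c : Polynomial ℝ, ∀ l : ℕ+, ∃ P : Protocol G (nA l) (nB l) (mA l) (mB l),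
    (∀ X, Γ l X = P.run X) ∧ (P.size : ℝ) ≤ c.eval (l : ℝ)

/-- `n` is a valid upper bound on the computational one-shot entanglement cost with error `ε` of
the family `ρ`. -/
def CostAtMost (G : GateSet) (ε : ℕ+ → ℝ) {nA nB : ℕ+ → ℕ+}
    (ρ : ∀ l : ℕ+, Op (nA l) (nB l)) (n : ℕ+ → ℕ+) : Prop :=
  ∃ Γ : ∀ l : ℕ+, Op (n l) (n l) →ₗ[ℂ] Op (nA l) (nB l), IsEfficient G Γ ∧
    ∀ l, 1 - fidelity (Γ l (epr (n l))) (ρ l) ≤ ε l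

/-- Functions given by a real polynomial. -/
def IsPolynomial (f : ℕ+ → ℕ+) : Prop :=
  ∃ p : Polynomial ℝ, ∀ l : ℕ+, ((f l : ℕ) : ℝ) = p.eval (l : ℝ)

end CompEnt

end

/-!
Monotonicity rests on two facts. First, the fidelity does not decrease under a trace-preserving map
in Kraus form (`IsKraus.fidelity_le`): by Uhlmann's theorem it is the largest overlap of two
purifications, and the map carries purifications to purifications with the same overlap. The map
of a protocol has Kraus form (`Protocol.isKraus_run`). Second, two protocols can be carried out one after the
other with polynomial overhead (`Protocol.exists_comp`). The second protocol gets the output qubits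
of the first and fresh ancilla qubits, and, since its own output has to be made of the *first*
qubits of the two registers, a last round of exchanges moves its ancilla qubits next to its input
qubits; this is where the gate set has to contain exchanges. That the second protocol sees exactly
the output of the first is the commutation of preparing and discarding qubits, `ptrace_ext`. So a
protocol that prepares `ρ` from EPR pairs extends to one that prepares `Λ ρ`, with no larger error.

Monotonicity fails for general local unitaries by a counting argument. The states are EPR pairs,
which cost nothing beyond themselves, and Alice permutes her computational basis. Over a field with
`2 ^ m` elements the permutations `(x, y) ↦ (x, y + f x)`, with `f` a polynomial with `D`
coefficients, send the EPR pairs to `2 ^ (m * D)` states with pairwise overlaps at most `D / 2 ^ m`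
(`exists_perm_family`). A protocol of size `S` is determined, up to a small change of its output,
by finite data: which gates act where and the matrix entries of the gates, rounded
(`Protocol.norm_run_sub_le_of_code_eq`); rounding is needed since the gate set may be infinite.
There are only `2 ^ poly(S)` such data (`card_protocolCode_le`). If every permutation of the family
could be carried out with fidelity `δ` by a protocol of size `S`, then more than `4 / δ` of the
states would have overlap at least `δ / 2` with one and the same output state, which contradicts
Bessel's inequality for almost orthogonal vectors (`sum_overlap_le`). With `S = 2 ^ λ` and `20 λ`
EPR pairs this gives, for every large `λ`, a permutation that no protocol of size `2 ^ λ` carries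
out with fidelity `δ` (`exists_hard_perm`). If `ε` does not converge to `1`, then `ε ≤ 1 - δ` for
some `δ > 0` and arbitrarily large `λ`, and there the size of an efficient family would have to
exceed `2 ^ λ`.
-/

noncomputable section

namespace CompEnt

/-! ### Fidelity -/

section Fidelity

variable {ι κ : Type} [Fintype ι] [DecidableEq ι] [Fintype κ] [DecidableEq κ]

open scoped MatrixOrder Matrix.Norms.L2Operator in
theorem msqrt_eq_sqrt {A : Matrix ι ι ℂ} (hA : A.PosSemidef) : msqrt A = CFC.sqrt A := by
  rw [CFC.sqrt_eq_real_sqrt A hA.nonneg, cfcₙ_eq_cfc]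
  rfl

open scoped MatrixOrder Matrix.Norms.L2Operator in
theorem msqrt_posSemidef {A : Matrix ι ι ℂ} (hA : A.PosSemidef) : (msqrt A).PosSemidef := by
  rw [msqrt_eq_sqrt hA]
  exact Matrix.nonneg_iff_posSemidef.1 (CFC.sqrt_nonneg A)

open scoped MatrixOrder Matrix.Norms.L2Operator in
theorem msqrt_mul_self {A : Matrix ι ι ℂ} (hA : A.PosSemidef) : msqrt A * msqrt A = A := by
  rw [msqrt_eq_sqrt hA]
  exact CFC.sqrt_mul_sqrt_self A hA.nonneg

open scoped MatrixOrder Matrix.Norms.L2Operator in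
theorem msqrt_unique {A B : Matrix ι ι ℂ} (hB : B.PosSemidef) (h : B * B = A) : msqrt A = B := by
  have hA : A.PosSemidef := by
    rw [← h]
    simpa [hB.isHermitian.eq] using Matrix.posSemidef_conjTranspose_mul_self B
  rw [msqrt_eq_sqrt hA]
  exact CFC.sqrt_unique h hB.nonneg

/-- Two matrices with the same Gram matrix differ by a unitary: the isometry that carries the
column space of `N` to that of `M` extends to the whole space. -/
theorem exists_unitary_mul_eq {M N : Matrix κ ι ℂ} (h : Mᴴ * M = Nᴴ * N) :
    ∃ U ∈ Matrix.unitaryGroup κ ℂ, M = U * N := by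
  let f := Matrix.toEuclideanLin M
  let g := Matrix.toEuclideanLin N
  have key : ∀ P : Matrix κ ι ℂ, ∀ x, ‖Matrix.toEuclideanLin P x‖ ^ 2
      = (inner ℂ x (Matrix.toEuclideanLin (Pᴴ * P) x)).re := by
    intro P x
    have : Matrix.toEuclideanLin (Pᴴ * P) x =
        (Matrix.toEuclideanLin P).adjoint (Matrix.toEuclideanLin P x) := by
      rw [← Matrix.toEuclideanLin_conjTranspose_eq_adjoint]
      simp [Matrix.toLpLin_apply, Matrix.mulVec_mulVec]
    rw [this, LinearMap.adjoint_inner_right, inner_self_eq_norm_sq_to_K]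
    norm_cast
  have hn : ∀ x, ‖f x‖ = ‖g x‖ := fun x => by
    have : ‖f x‖ ^ 2 = ‖g x‖ ^ 2 := by rw [key M, key N, h]
    exact (sq_eq_sq₀ (norm_nonneg _) (norm_nonneg _)).1 this
  have hker : LinearMap.ker g ≤ LinearMap.ker f := fun x hx => by
    rw [LinearMap.mem_ker] at hx ⊢
    rw [← norm_eq_zero, hn, hx, norm_zero]
  let L₀ : LinearMap.range g →ₗ[ℂ] EuclideanSpace ℂ κ :=
    ((LinearMap.ker g).liftQ f hker) ∘ₗ g.quotKerEquivRange.symm.toLinearMap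
  have hL₀ : ∀ x, L₀ ⟨g x, x, rfl⟩ = f x := fun x => by
    have : g.quotKerEquivRange.symm ⟨g x, x, rfl⟩ = (LinearMap.ker g).mkQ x :=
      g.quotKerEquivRange_symm_apply_image x _
    simp [L₀, this]
  let L : LinearMap.range g →ₗᵢ[ℂ] EuclideanSpace ℂ κ :=
    ⟨L₀, by rintro ⟨_, x, rfl⟩; rw [hL₀, hn]; rfl⟩
  let E := L.extend
  have hE : ∀ x, E (g x) = f x := fun x =>
    (L.extend_apply ⟨g x, x, rfl⟩).trans (hL₀ x)
  let U := Matrix.toEuclideanLin.symm E.toLinearMap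
  have hU : Matrix.toEuclideanLin U = E.toLinearMap := by simp [U]
  refine ⟨U, ?_, ?_⟩
  · rw [Matrix.mem_unitaryGroup_iff']
    apply Matrix.toEuclideanLin.injective
    ext1 x
    refine ext_inner_left ℂ fun y => ?_
    have : Matrix.toEuclideanLin (star U * U) x =
        (Matrix.toEuclideanLin U).adjoint (Matrix.toEuclideanLin U x) := by
      rw [← Matrix.toEuclideanLin_conjTranspose_eq_adjoint]
      simp [Matrix.toLpLin_apply, Matrix.mulVec_mulVec, Matrix.star_eq_conjTranspose]
    rw [this, LinearMap.adjoint_inner_right, hU]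
    simp
  · apply Matrix.toEuclideanLin.injective
    ext1 x
    have : Matrix.toEuclideanLin (U * N) x =
        Matrix.toEuclideanLin U (Matrix.toEuclideanLin N x) := by
      simp [Matrix.toLpLin_apply, Matrix.mulVec_mulVec]
    rw [this, hU]
    exact (hE x).symm

omit [DecidableEq ι] [DecidableEq κ] in
theorem re_trace_le_half {X Y : Matrix κ ι ℂ} :
    (Xᴴ * Y).trace.re ≤ ((Xᴴ * X).trace.re + (Yᴴ * Y).trace.re) / 2 := by
  have h := (Matrix.posSemidef_conjTranspose_mul_self (X - Y)).trace_nonneg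
  have h2 : (Yᴴ * X).trace.re = (Xᴴ * Y).trace.re := by
    have : Yᴴ * X = (Xᴴ * Y)ᴴ := by simp
    rw [this, Matrix.trace_conjTranspose]; simp
  have h1 := (Complex.le_def.1 h).1
  simp only [Matrix.conjTranspose_sub, Matrix.sub_mul, Matrix.mul_sub, Matrix.trace_sub,
    Complex.sub_re, Complex.zero_re] at h1
  linarith

theorem traceNorm_nonneg (A : Matrix ι ι ℂ) : 0 ≤ traceNorm A :=
  (Complex.le_def.1 (msqrt_posSemidef (Matrix.posSemidef_conjTranspose_mul_self A)).trace_nonneg).1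

/-- The polar decomposition of a square matrix, with a unitary factor. -/
theorem exists_polar (T : Matrix ι ι ℂ) :
    ∃ W ∈ Matrix.unitaryGroup ι ℂ, T = W * msqrt (Tᴴ * T) := by
  apply exists_unitary_mul_eq
  have h := Matrix.posSemidef_conjTranspose_mul_self T
  rw [(msqrt_posSemidef h).isHermitian.eq, msqrt_mul_self h]

/-- The upper bound in Uhlmann's theorem: `A` and `B` are purifications of `ρ` and `σ`, written as
matrices from the purifying system. Padding makes them unitarily equivalent to `√ρ` and `√σ`. -/
theorem re_trace_le_traceNorm {ρ σ : Matrix ι ι ℂ} {A B : Matrix ι κ ℂ}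
    (hA : A * Aᴴ = ρ) (hB : B * Bᴴ = σ) :
    (A * Bᴴ).trace.re ≤ traceNorm (msqrt ρ * msqrt σ) := by
  have hρ : ρ.PosSemidef := hA ▸ Matrix.posSemidef_self_mul_conjTranspose A
  have hσ : σ.PosSemidef := hB ▸ Matrix.posSemidef_self_mul_conjTranspose B
  have hs := (msqrt_posSemidef hρ).isHermitian.eq
  have ht := (msqrt_posSemidef hσ).isHermitian.eq
  -- `J` is the isometry onto the second block of the common purifying system `κ ⊕ ι`.
  let J : Matrix (κ ⊕ ι) ι ℂ := Matrix.fromRows 0 1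
  have hJJ : Jᴴ * J = 1 := by
    simp [J, Matrix.conjTranspose_fromRows_eq_fromCols_conjTranspose, Matrix.fromCols_mul_fromRows]
  have hpad : ∀ {τ : Matrix ι ι ℂ} {C : Matrix ι κ ℂ}, τ.PosSemidef → C * Cᴴ = τ →
      ∃ U ∈ Matrix.unitaryGroup (κ ⊕ ι) ℂ, Matrix.fromRows Cᴴ 0 = U * (J * msqrt τ) := by
    intro τ C hτ hC
    apply exists_unitary_mul_eq
    have : (J * msqrt τ)ᴴ * (J * msqrt τ) = τ := by
      rw [Matrix.conjTranspose_mul, Matrix.mul_assoc, ← Matrix.mul_assoc Jᴴ, hJJ, Matrix.one_mul,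
        (msqrt_posSemidef hτ).isHermitian.eq, msqrt_mul_self hτ]
    rw [this]
    simp [Matrix.conjTranspose_fromRows_eq_fromCols_conjTranspose, Matrix.fromCols_mul_fromRows, hC]
  obtain ⟨U, hU, hUA⟩ := hpad hρ hA
  obtain ⟨V, hV, hVB⟩ := hpad hσ hB
  have hQ : Uᴴ * V ∈ Matrix.unitaryGroup (κ ⊕ ι) ℂ := mul_mem (Unitary.star_mem hU) hV
  set Q := Uᴴ * V with hQdef
  have hQ' : Qᴴ * Q = 1 := by
    rwa [Matrix.mem_unitaryGroup_iff', Matrix.star_eq_conjTranspose] at hQ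
  have hAB : A * Bᴴ = msqrt ρ * Jᴴ * Q * J * msqrt σ := by
    have h1 : A * Bᴴ = (Matrix.fromRows Aᴴ (0 : Matrix ι ι ℂ))ᴴ *
        Matrix.fromRows Bᴴ (0 : Matrix ι ι ℂ) := by
      simp [Matrix.conjTranspose_fromRows_eq_fromCols_conjTranspose, Matrix.fromCols_mul_fromRows]
    rw [h1, hUA, hVB]
    simp only [Matrix.conjTranspose_mul, hs, hQdef, Matrix.mul_assoc]
  obtain ⟨W, hW, h⟩ := exists_polar (msqrt ρ * msqrt σ)
  rw [Matrix.mem_unitaryGroup_iff', Matrix.star_eq_conjTranspose] at hW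
  unfold traceNorm
  set T := msqrt ρ * msqrt σ with hT
  have hTT := Matrix.posSemidef_conjTranspose_mul_self T
  set P := msqrt (Tᴴ * T) with hPdef
  have hP : P.PosSemidef := msqrt_posSemidef hTT
  have h2 : msqrt σ * msqrt ρ = P * Wᴴ := by
    have := congrArg Matrix.conjTranspose h
    rwa [hT, Matrix.conjTranspose_mul, hs, ht, Matrix.conjTranspose_mul, hP.isHermitian.eq] at this
  set S := msqrt P
  have hS : Sᴴ = S := (msqrt_posSemidef hP).isHermitian.eq
  have hSS : S * S = P := msqrt_mul_self hP
  have htr : (A * Bᴴ).trace = ((J * W * S)ᴴ * (Q * J * S)).trace := by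
    calc (A * Bᴴ).trace = (Jᴴ * Q * J * (msqrt σ * msqrt ρ)).trace := by
          rw [hAB]
          simp only [Matrix.mul_assoc]
          rw [Matrix.trace_mul_comm]
          simp only [Matrix.mul_assoc]
      _ = ((Jᴴ * Q * J * S) * (S * Wᴴ)).trace := by
          rw [h2, ← hSS]; simp only [Matrix.mul_assoc]
      _ = _ := by
          rw [Matrix.trace_mul_comm]
          simp only [Matrix.conjTranspose_mul, hS, Matrix.mul_assoc]
  -- By the polar decomposition `√ρ √σ = W P`, the overlap is `Tr (J W √P)† (Q J √P)`, and the
  -- Cauchy–Schwarz inequality bounds it by `Tr P`.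
  rw [htr]
  refine re_trace_le_half.trans (le_of_eq ?_)
  have e1 : (J * W * S)ᴴ * (J * W * S) = P := by
    calc _ = S * (Wᴴ * ((Jᴴ * J) * W)) * S := by
          simp only [Matrix.conjTranspose_mul, hS, Matrix.mul_assoc]
      _ = P := by rw [hJJ, Matrix.one_mul, hW, Matrix.mul_one, hSS]
  have e2 : (Q * J * S)ᴴ * (Q * J * S) = P := by
    calc _ = S * (Jᴴ * ((Qᴴ * Q) * J)) * S := by
          simp only [Matrix.conjTranspose_mul, hS, Matrix.mul_assoc]
      _ = P := by rw [hQ', Matrix.one_mul, hJJ, Matrix.mul_one, hSS]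
  rw [e1, e2]
  ring

/-- The attained case of Uhlmann's theorem: some purifications of `ρ` and `σ`, written as matrices
from the purifying system, have the fidelity as their overlap. -/
theorem exists_trace_eq_traceNorm {ρ σ : Matrix ι ι ℂ} (hρ : ρ.PosSemidef) (hσ : σ.PosSemidef) :
    ∃ A B : Matrix ι ι ℂ, A * Aᴴ = ρ ∧ B * Bᴴ = σ ∧
      (A * Bᴴ).trace.re = traceNorm (msqrt ρ * msqrt σ) := by
  obtain ⟨W, hW, h⟩ := exists_polar (msqrt ρ * msqrt σ)
  have hs := (msqrt_posSemidef hρ).isHermitian.eq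
  have ht := (msqrt_posSemidef hσ).isHermitian.eq
  rw [Matrix.mem_unitaryGroup_iff, Matrix.star_eq_conjTranspose] at hW
  have hW' : Wᴴ * W = 1 := mul_eq_one_comm.1 hW
  refine ⟨msqrt ρ * W, msqrt σ, ?_, ?_, ?_⟩
  · rw [Matrix.conjTranspose_mul, hs, Matrix.mul_assoc, ← Matrix.mul_assoc W, hW, Matrix.one_mul,
      msqrt_mul_self hρ]
  · rw [ht, msqrt_mul_self hσ]
  · set T := msqrt ρ * msqrt σ with hT
    have hP := (msqrt_posSemidef (Matrix.posSemidef_conjTranspose_mul_self T)).isHermitian.eq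
    have h2 : msqrt σ * msqrt ρ = msqrt (Tᴴ * T) * Wᴴ := by
      have h3 : msqrt σ * msqrt ρ = Tᴴ := by rw [hT, Matrix.conjTranspose_mul, hs, ht]
      exact h3.trans ((congrArg Matrix.conjTranspose h).trans
        (by rw [Matrix.conjTranspose_mul W, hP]))
    rw [ht, Matrix.mul_assoc, Matrix.trace_mul_comm, Matrix.mul_assoc, Matrix.trace_mul_comm, h2,
      Matrix.mul_assoc, hW', Matrix.mul_one]
    rfl

/-- `Φ` has an operator-sum (Kraus) form. -/
def IsKraus (Φ : Matrix ι ι ℂ → Matrix κ κ ℂ) : Prop :=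
  ∃ (K : Type) (_ : Fintype K) (E : K → Matrix κ ι ℂ), ∀ X, Φ X = ∑ k, E k * X * (E k)ᴴ

omit [DecidableEq ι] [Fintype κ] [DecidableEq κ] in
theorem IsKraus.conj (E : Matrix κ ι ℂ) : IsKraus fun X : Matrix ι ι ℂ => E * X * Eᴴ :=
  ⟨Unit, inferInstance, fun _ => E, fun X => by simp⟩

omit [DecidableEq ι] [DecidableEq κ] in
theorem IsKraus.comp {μ : Type} {Ψ : Matrix κ κ ℂ → Matrix μ μ ℂ}
    {Φ : Matrix ι ι ℂ → Matrix κ κ ℂ} (hΨ : IsKraus Ψ) (hΦ : IsKraus Φ) :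
    IsKraus fun X => Ψ (Φ X) := by
  obtain ⟨K, _, E, hE⟩ := hΨ
  obtain ⟨L, _, D, hD⟩ := hΦ
  refine ⟨K × L, inferInstance, fun p => E p.1 * D p.2, fun X => ?_⟩
  beta_reduce
  rw [hE, hD, Fintype.sum_prod_type]
  refine Finset.sum_congr rfl fun k _ => ?_
  simp only [Matrix.mul_sum, Matrix.sum_mul, Matrix.conjTranspose_mul, Matrix.mul_assoc]

omit [DecidableEq ι] [Fintype κ] [DecidableEq κ] in
theorem IsKraus.posSemidef [Finite κ] {Φ : Matrix ι ι ℂ → Matrix κ κ ℂ} (hΦ : IsKraus Φ)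
    {X : Matrix ι ι ℂ} (hX : X.PosSemidef) : (Φ X).PosSemidef := by
  obtain ⟨K, _, E, hE⟩ := hΦ
  rw [hE]
  exact Matrix.posSemidef_sum _ fun k _ => hX.mul_mul_conjTranspose_same (E k)

/-- The fidelity does not decrease under a trace-preserving map in Kraus form: the map sends
purifications to purifications and keeps their overlap. -/
theorem IsKraus.fidelity_le {Φ : Matrix ι ι ℂ → Matrix κ κ ℂ} (hΦ : IsKraus Φ)
    (htr : ∀ X, (Φ X).trace = X.trace) {ρ σ : Matrix ι ι ℂ} (hρ : ρ.PosSemidef)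
    (hσ : σ.PosSemidef) : fidelity ρ σ ≤ fidelity (Φ ρ) (Φ σ) := by
  classical
  obtain ⟨K, _, E, hE⟩ := hΦ
  obtain ⟨A, B, hA, hB, hAB⟩ := exists_trace_eq_traceNorm hρ hσ
  -- The purification `(E k C)_k` of `Φ (C C†)`; the purifying system is enlarged by the index `k`.
  let dil : Matrix ι ι ℂ → Matrix κ (K × ι) ℂ := fun C => Matrix.of fun a p => (E p.1 * C) a p.2
  have hdil : ∀ C D : Matrix ι ι ℂ, dil C * (dil D)ᴴ = Φ (C * Dᴴ) := by
    intro C D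
    rw [hE]
    ext a b
    have : ∀ k, E k * (C * Dᴴ) * (E k)ᴴ = (E k * C) * (E k * D)ᴴ := fun k => by
      simp only [Matrix.conjTranspose_mul, Matrix.mul_assoc]
    simp only [this, Matrix.sum_apply]
    simp only [Matrix.mul_apply (M := dil C), Fintype.sum_prod_type, dil,
      Matrix.conjTranspose_apply, Matrix.of_apply]
    refine Finset.sum_congr rfl fun k _ => ?_
    rw [Matrix.mul_apply]
    simp only [Matrix.conjTranspose_apply]
  have h := re_trace_le_traceNorm ((hdil A A).trans (by rw [hA])) ((hdil B B).trans (by rw [hB]))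
  rw [hdil, htr, hAB] at h
  exact pow_le_pow_left₀ (traceNorm_nonneg _) h 2

theorem fidelity_self {ρ : Matrix ι ι ℂ} (hρ : IsState ρ) : fidelity ρ ρ = 1 := by
  have h : msqrt ((msqrt ρ * msqrt ρ)ᴴ * (msqrt ρ * msqrt ρ)) = ρ := by
    apply msqrt_unique hρ.1
    rw [msqrt_mul_self hρ.1, hρ.1.isHermitian.eq]
  rw [fidelity, traceNorm, h, hρ.2]
  simp

/-- The fidelity with a pure state `|v⟩⟨v|` is `⟨v|σ|v⟩`. -/
theorem fidelity_pure {σ : Matrix ι ι ℂ} (hσ : σ.PosSemidef) {v : ι → ℂ} (hv : star v ⬝ᵥ v = 1) :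
    fidelity σ (Matrix.vecMulVec v (star v)) = (star v ⬝ᵥ σ *ᵥ v).re := by
  set R := Matrix.vecMulVec v (star v) with hR
  have hRR : R * R = R := by
    rw [hR, Matrix.vecMulVec_mul_vecMulVec, hv, one_smul]
  have hRp : R.PosSemidef := Matrix.posSemidef_vecMulVec_self_star v
  have hs : msqrt R = R := msqrt_unique hRp hRR
  obtain ⟨hc0, hc1⟩ := Complex.le_def.1 (hσ.dotProduct_mulVec_nonneg v)
  set c := star v ⬝ᵥ σ *ᵥ v with hc
  have hcre : c = (c.re : ℂ) := Complex.ext rfl (by simpa using hc1.symm)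
  have hT : (msqrt σ * R)ᴴ * (msqrt σ * R) = c • R := by
    calc _ = R * σ * R := by
          rw [Matrix.conjTranspose_mul, hRp.isHermitian.eq,
            (msqrt_posSemidef hσ).isHermitian.eq, Matrix.mul_assoc, ← Matrix.mul_assoc (msqrt σ),
            msqrt_mul_self hσ, Matrix.mul_assoc]
      _ = c • R := by
          rw [hR, Matrix.vecMulVec_mul, Matrix.vecMulVec_mul_vecMulVec, ← Matrix.dotProduct_mulVec,
            Matrix.vecMulVec_smul]
  have hq : msqrt (c • R) = ((Real.sqrt c.re : ℝ) : ℂ) • R := by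
    apply msqrt_unique
    · exact hRp.smul (by exact_mod_cast Real.sqrt_nonneg _)
    · rw [Matrix.smul_mul, Matrix.mul_smul, hRR, smul_smul, ← Complex.ofReal_mul,
        Real.mul_self_sqrt hc0, ← hcre]
  have htr : R.trace = 1 := by rw [hR, Matrix.trace_vecMulVec, dotProduct_comm, hv]
  rw [fidelity, traceNorm, hs, hT, hq, Matrix.trace_smul, htr]
  simp [Real.sq_sqrt hc0]

end Fidelity

/-! ### Registers and subregisters -/

section Registers

variable {U W V : Type}

/-- The qubits of `V` outside the subregister `W`. This is a structure and not a subtype, so that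
its finiteness and decidability instances are the ones given below. -/
@[ext]
structure Off (f : W ↪ V) : Type where
  val : V
  property : val ∉ Set.range f

instance instFintypeOff [Fintype V] (f : W ↪ V) : Fintype (Off f) :=
  Fintype.ofInjective Off.val fun _ _ h => Off.ext h

instance instDecidableEqOff (f : W ↪ V) : DecidableEq (Off f) := Classical.decEq _

open Classical in
/-- The basis label of `V` with the values `a` on the subregister `W` and `z` outside of it. -/
def merge (f : W ↪ V) (a : Bits W) (z : Bits (Off f)) : Bits V :=
  fun v => if h : v ∈ Set.range f then a h.choose else z ⟨v, h⟩

@[simp]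
theorem merge_apply (f : W ↪ V) (a : Bits W) (z : Bits (Off f)) (w : W) :
    merge f a z (f w) = a w := by
  have h : f w ∈ Set.range f := ⟨w, rfl⟩
  rw [merge, dif_pos h, f.injective h.choose_spec]

theorem merge_off (f : W ↪ V) (a : Bits W) (z : Bits (Off f)) {v : V} (h : v ∉ Set.range f) :
    merge f a z v = z ⟨v, h⟩ := dif_neg h

@[simp]
theorem merge_comp (f : W ↪ V) (a : Bits W) (z : Bits (Off f)) : merge f a z ∘ f = a :=
  funext fun w => merge_apply f a z w

/-- A basis label of `V` is a pair of labels, one on a subregister and one on the rest. -/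
def splitEquiv (f : W ↪ V) : Bits W × Bits (Off f) ≃ Bits V where
  toFun p := merge f p.1 p.2
  invFun x := (x ∘ f, fun v => x v.val)
  left_inv p := by
    ext v
    · simp
    · exact congrArg Fin.val (merge_off f p.1 p.2 v.property)
  right_inv x := by
    funext v
    by_cases h : v ∈ Set.range f
    · obtain ⟨w, rfl⟩ := h
      simp
    · exact merge_off f _ _ h

theorem exists_merge (f : W ↪ V) (x : Bits V) : ∃ a z, x = merge f a z :=
  ⟨_, _, ((splitEquiv f).right_inv x).symm⟩

theorem merge_agree_iff (f : W ↪ V) (a b : Bits W) (z t : Bits (Off f)) :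
    (∀ w, w ∉ Set.range f → merge f a z w = merge f b t w) ↔ z = t := by
  constructor
  · intro h
    funext v
    simpa only [merge_off f _ _ v.property] using h v.val v.property
  · rintro rfl w hw
    rw [merge_off f _ _ hw, merge_off f _ _ hw]

theorem merge_zero_iff (f : W ↪ V) (a : Bits W) (z : Bits (Off f)) :
    (∀ w, w ∉ Set.range f → merge f a z w = 0) ↔ z = 0 := by
  constructor
  · intro h
    funext v
    exact (merge_off f a z v.property).symm.trans (h v.val v.property)
  · rintro rfl w hw
    exact merge_off f a 0 hw

open Classical in
/-- The operator `A` on the subregister `W`, tensored with the identity on the rest of `V`. -/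
def lift (f : W ↪ V) (A : Matrix (Bits W) (Bits W) ℂ) : Matrix (Bits V) (Bits V) ℂ :=
  Matrix.of fun x y => if ∀ w, w ∉ Set.range f → x w = y w then A (x ∘ f) (y ∘ f) else 0

open Classical in
/-- The operator `σ` on the subregister `W`, tensored with `|0⟩⟨0|` on the rest of `V`. -/
def ext (f : W ↪ V) (σ : Matrix (Bits W) (Bits W) ℂ) : Matrix (Bits V) (Bits V) ℂ :=
  Matrix.of fun x y =>
    if (∀ w, w ∉ Set.range f → x w = 0) ∧ ∀ w, w ∉ Set.range f → y w = 0
    then σ (x ∘ f) (y ∘ f) else 0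

/-- The partial trace over the qubits outside the subregister `W`. -/
def ptrace [Fintype V] (f : W ↪ V) (σ : Matrix (Bits V) (Bits V) ℂ) :
    Matrix (Bits W) (Bits W) ℂ :=
  Matrix.of fun a b => ∑ z : Bits (Off f), σ (merge f a z) (merge f b z)

open Classical in
theorem lift_merge (f : W ↪ V) (A : Matrix (Bits W) (Bits W) ℂ) (a b : Bits W)
    (z t : Bits (Off f)) :
    lift f A (merge f a z) (merge f b t) = if z = t then A a b else 0 := by
  simp only [lift, Matrix.of_apply, merge_agree_iff, merge_comp]

open Classical in
theorem ext_merge (f : W ↪ V) (σ : Matrix (Bits W) (Bits W) ℂ) (a b : Bits W)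
    (z t : Bits (Off f)) :
    ext f σ (merge f a z) (merge f b t) = if z = 0 ∧ t = 0 then σ a b else 0 := by
  simp only [ext, Matrix.of_apply, merge_zero_iff, merge_comp]

theorem conjTranspose_lift (f : W ↪ V) (A : Matrix (Bits W) (Bits W) ℂ) :
    (lift f A)ᴴ = lift f Aᴴ := by
  ext x y
  have h : (∀ w, w ∉ Set.range f → y w = x w) ↔ ∀ w, w ∉ Set.range f → x w = y w :=
    forall₂_congr fun _ _ => eq_comm
  simp only [lift, Matrix.conjTranspose_apply, Matrix.of_apply]
  by_cases hx : ∀ w, w ∉ Set.range f → x w = y w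
  · rw [if_pos hx, if_pos (h.2 hx)]
  · rw [if_neg hx, if_neg fun hy => hx (h.1 hy), star_zero]

theorem lift_smul (f : W ↪ V) (c : ℂ) (A : Matrix (Bits W) (Bits W) ℂ) :
    lift f (c • A) = c • lift f A := by
  ext x y
  simp [lift]

theorem lift_trans (g : U ↪ W) (f : W ↪ V) (A : Matrix (Bits U) (Bits U) ℂ) :
    lift (g.trans f) A = lift f (lift g A) := by
  ext x y
  have h : (∀ v, v ∉ Set.range (g.trans f) → x v = y v) ↔
      (∀ v, v ∉ Set.range f → x v = y v) ∧ ∀ w, w ∉ Set.range g → (x ∘ f) w = (y ∘ f) w := by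
    constructor
    · refine fun h => ⟨fun v hv => h v ?_, fun w hw => h (f w) ?_⟩
      · rintro ⟨u, rfl⟩
        exact hv ⟨g u, rfl⟩
      · rintro ⟨u, hu⟩
        exact hw ⟨u, f.injective hu⟩
    · rintro ⟨h1, h2⟩ v hv
      by_cases hf : v ∈ Set.range f
      · obtain ⟨w, rfl⟩ := hf
        refine h2 w ?_
        rintro ⟨u, rfl⟩
        exact hv ⟨u, rfl⟩
      · exact h1 v hf
  simp only [lift, Matrix.of_apply]
  by_cases hx : ∀ v, v ∉ Set.range (g.trans f) → x v = y v
  · rw [if_pos hx, if_pos (h.1 hx).1, if_pos (h.1 hx).2]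
    rfl
  · rw [if_neg hx]
    split_ifs with h1 h2
    · exact absurd (h.2 ⟨h1, h2⟩) hx
    · rfl
    · rfl

section Finite

variable [Fintype V] [DecidableEq V] [Fintype W] [DecidableEq W]

theorem sum_merge {M : Type} [AddCommMonoid M] (f : W ↪ V) (g : Bits V → M) :
    ∑ x, g x = ∑ a, ∑ z, g (merge f a z) := by
  rw [← (splitEquiv f).sum_comp, Fintype.sum_prod_type]
  rfl

theorem lift_mul_apply {X : Type} (f : W ↪ V) (A : Matrix (Bits W) (Bits W) ℂ)
    (M : Matrix (Bits V) X ℂ) (a : Bits W) (z : Bits (Off f)) (y : X) :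
    (lift f A * M) (merge f a z) y = ∑ b, A a b * M (merge f b z) y := by
  classical
  rw [Matrix.mul_apply, sum_merge f]
  refine Finset.sum_congr rfl fun b _ => ?_
  simp [lift_merge]

theorem mul_lift_apply {X : Type} (f : W ↪ V) (A : Matrix (Bits W) (Bits W) ℂ)
    (M : Matrix X (Bits V) ℂ) (a : Bits W) (z : Bits (Off f)) (x : X) :
    (M * lift f A) x (merge f a z) = ∑ b, M x (merge f b z) * A b a := by
  classical
  rw [Matrix.mul_apply, sum_merge f]
  refine Finset.sum_congr rfl fun b _ => ?_
  simp [lift_merge]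

omit [DecidableEq W] [DecidableEq V] in
theorem lift_one (f : W ↪ V) : lift f (1 : Matrix (Bits W) (Bits W) ℂ) = 1 := by
  classical
  ext x y
  obtain ⟨a, z, rfl⟩ := exists_merge f x
  obtain ⟨b, t, rfl⟩ := exists_merge f y
  have h : merge f a z = merge f b t ↔ z = t ∧ a = b := by
    rw [show merge f a z = splitEquiv f (a, z) from rfl,
      show merge f b t = splitEquiv f (b, t) from rfl, (splitEquiv f).injective.eq_iff,
      Prod.mk.injEq, and_comm]
  rw [lift_merge, Matrix.one_apply, Matrix.one_apply]
  simp only [h]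
  split_ifs <;> simp_all

theorem lift_mul (f : W ↪ V) (A B : Matrix (Bits W) (Bits W) ℂ) :
    lift f (A * B) = lift f A * lift f B := by
  classical
  ext x y
  obtain ⟨a, z, rfl⟩ := exists_merge f x
  obtain ⟨b, t, rfl⟩ := exists_merge f y
  rw [lift_mul_apply, lift_merge, Matrix.mul_apply]
  simp only [lift_merge]
  split_ifs <;> simp

theorem lift_mul_ext (f : W ↪ V) (A σ : Matrix (Bits W) (Bits W) ℂ) :
    lift f A * ext f σ = ext f (A * σ) := by
  classical
  ext x y
  obtain ⟨a, z, rfl⟩ := exists_merge f x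
  obtain ⟨b, t, rfl⟩ := exists_merge f y
  rw [lift_mul_apply, ext_merge, Matrix.mul_apply]
  simp only [ext_merge]
  split_ifs <;> simp

theorem ext_mul_lift (f : W ↪ V) (A σ : Matrix (Bits W) (Bits W) ℂ) :
    ext f σ * lift f A = ext f (σ * A) := by
  classical
  ext x y
  obtain ⟨a, z, rfl⟩ := exists_merge f x
  obtain ⟨b, t, rfl⟩ := exists_merge f y
  rw [mul_lift_apply, ext_merge, Matrix.mul_apply]
  simp only [ext_merge]
  split_ifs <;> simp

theorem ptrace_lift_mul (f : W ↪ V) (A : Matrix (Bits W) (Bits W) ℂ)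
    (σ : Matrix (Bits V) (Bits V) ℂ) : ptrace f (lift f A * σ) = A * ptrace f σ := by
  ext a b
  simp only [ptrace, Matrix.of_apply, lift_mul_apply, Matrix.mul_apply (M := A), Finset.mul_sum]
  exact Finset.sum_comm

theorem ptrace_mul_lift (f : W ↪ V) (A : Matrix (Bits W) (Bits W) ℂ)
    (σ : Matrix (Bits V) (Bits V) ℂ) : ptrace f (σ * lift f A) = ptrace f σ * A := by
  ext a b
  simp only [ptrace, Matrix.of_apply, mul_lift_apply, Matrix.mul_apply (N := A), Finset.sum_mul]
  exact Finset.sum_comm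

theorem lift_conj_ext (f : W ↪ V) (A σ : Matrix (Bits W) (Bits W) ℂ) :
    lift f A * ext f σ * (lift f A)ᴴ = ext f (A * σ * Aᴴ) := by
  rw [conjTranspose_lift, lift_mul_ext, ext_mul_lift]

theorem ptrace_lift_conj (f : W ↪ V) (A : Matrix (Bits W) (Bits W) ℂ)
    (σ : Matrix (Bits V) (Bits V) ℂ) :
    ptrace f (lift f A * σ * (lift f A)ᴴ) = A * ptrace f σ * Aᴴ := by
  rw [conjTranspose_lift, ptrace_mul_lift, ptrace_lift_mul]

omit [DecidableEq W] in
theorem ptrace_trans (g : U ↪ W) (f : W ↪ V) (σ : Matrix (Bits V) (Bits V) ℂ) :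
    ptrace (g.trans f) σ = ptrace g (ptrace f σ) := by
  classical
  have hoff : ∀ {v : V}, v ∉ Set.range f → v ∉ Set.range (g.trans f) := by
    rintro v hv ⟨u, rfl⟩
    exact hv ⟨g u, rfl⟩
  have hoff' : ∀ {w : W}, w ∉ Set.range g → f w ∉ Set.range (g.trans f) := by
    rintro w hw ⟨u, hu⟩
    exact hw ⟨u, f.injective hu⟩
  -- The qubits outside of `U` are those of `W` outside of `U` and those outside of `W`.
  let e : Bits (Off g) × Bits (Off f) ≃ Bits (Off (g.trans f)) :=
    { toFun := fun p v => merge f (merge g 0 p.1) p.2 v.val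
      invFun := fun z =>
        (fun w => z ⟨f w.val, hoff' w.property⟩, fun v => z ⟨v.val, hoff v.property⟩)
      left_inv := fun p => by
        refine Prod.ext (funext fun w => ?_) (funext fun v => ?_)
        · simp only [merge_apply]
          exact merge_off g _ _ w.property
        · exact merge_off f _ _ v.property
      right_inv := fun z => by
        funext ⟨v, hv⟩
        by_cases hf : v ∈ Set.range f
        · obtain ⟨w, rfl⟩ := hf
          have hw : w ∉ Set.range g := fun ⟨u, hu⟩ => hv ⟨u, by simp [hu]⟩
          simp only [merge_apply, merge_off g _ _ hw]
        · simp only [merge_off f _ _ hf] }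
  have he : ∀ a p, merge (g.trans f) a (e p) = merge f (merge g a p.1) p.2 := by
    intro a p
    funext v
    by_cases hv : v ∈ Set.range (g.trans f)
    · obtain ⟨u, rfl⟩ := hv
      rw [merge_apply]
      simp
    · rw [merge_off _ _ _ hv]
      change merge f (merge g 0 p.1) p.2 v = _
      by_cases hf : v ∈ Set.range f
      · obtain ⟨w, rfl⟩ := hf
        have hw : w ∉ Set.range g := fun ⟨u, hu⟩ => hv ⟨u, by simp [hu]⟩
        simp only [merge_apply, merge_off g _ _ hw]
      · simp only [merge_off f _ _ hf]
  ext a b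
  simp only [ptrace, Matrix.of_apply]
  rw [← e.sum_comp, Fintype.sum_prod_type]
  simp only [he]

omit [DecidableEq V] in
/-- Preparing qubits and discarding qubits commute: if two subregisters `W₁` and `W₂` of `V` meet
in `U`, then `ext` from `W₁` followed by `ptrace` to `W₂` is `ptrace` to `U` followed by `ext`. -/
theorem ptrace_ext {W₁ W₂ : Type} [Fintype W₁] [DecidableEq W₁] {j₁ : W₁ ↪ V} {j₂ : W₂ ↪ V}
    {o₁ : U ↪ W₁} {o₂ : U ↪ W₂} (hcomm : ∀ u, j₁ (o₁ u) = j₂ (o₂ u))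
    (hmeet : ∀ w₁ w₂, j₁ w₁ = j₂ w₂ → w₁ ∈ Set.range o₁) (σ : Matrix (Bits W₁) (Bits W₁) ℂ) :
    ptrace j₂ (ext j₁ σ) = ext o₂ (ptrace o₁ σ) := by
  classical
  have hoff : ∀ w : Off o₁, j₁ w.val ∉ Set.range j₂ := fun w ⟨w₂, h⟩ =>
    w.property (hmeet _ _ h.symm)
  -- The qubits outside of `W₂` are those of `W₁` outside of `U`, which are traced out, and those
  -- outside of both subregisters, which are `0` on the left-hand side.
  let k : Off o₁ ↪ Off j₂ :=
    ⟨fun w => ⟨j₁ w.val, hoff w⟩, fun w w' h => Off.ext (j₁.injective (congrArg Off.val h))⟩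
  have hk : ∀ v : Off j₂, v ∉ Set.range k → v.val ∉ Set.range j₁ := by
    rintro ⟨v, hv⟩ h ⟨w, rfl⟩
    refine h ⟨⟨w, ?_⟩, rfl⟩
    rintro ⟨u, rfl⟩
    exact hv ⟨o₂ u, (hcomm u).symm⟩
  have hzero : ∀ (a : Bits W₂) (z : Bits (Off j₂)),
      (∀ v, v ∉ Set.range j₁ → merge j₂ a z v = 0) ↔
        (∀ w, w ∉ Set.range o₂ → a w = 0) ∧ ∀ v, v ∉ Set.range k → z v = 0 := by
    intro a z
    constructor
    · refine fun h => ⟨fun w hw => ?_, fun v hv => ?_⟩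
      · rw [← merge_apply j₂ a z w]
        refine h _ ?_
        rintro ⟨w₁, h₁⟩
        obtain ⟨u, rfl⟩ := hmeet _ _ h₁
        rw [hcomm] at h₁
        exact hw ⟨u, j₂.injective h₁⟩
      · rw [← h v.val (hk v hv), merge_off j₂ _ _ v.property]
    · rintro ⟨h1, h2⟩ v hv
      by_cases h : v ∈ Set.range j₂
      · obtain ⟨w, rfl⟩ := h
        rw [merge_apply]
        refine h1 w ?_
        rintro ⟨u, rfl⟩
        exact hv ⟨o₁ u, hcomm u⟩
      · rw [merge_off j₂ _ _ h]
        refine h2 _ ?_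
        rintro ⟨w, hw⟩
        exact hv ⟨w.val, congrArg Off.val hw⟩
  have hmerge : ∀ (a : Bits W₂) (t : Bits (Off o₁)),
      merge j₂ a (merge k t 0) ∘ j₁ = merge o₁ (a ∘ o₂) t := by
    intro a t
    funext w
    by_cases h : w ∈ Set.range o₁
    · obtain ⟨u, rfl⟩ := h
      simp [hcomm]
    · rw [merge_off _ _ _ h, Function.comp_apply, merge_off _ _ _ (hoff ⟨w, h⟩)]
      exact merge_apply k t 0 ⟨w, h⟩
  ext a b
  simp only [ptrace, ext, Matrix.of_apply, hzero]
  rw [sum_merge k]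
  simp only [merge_zero_iff]
  by_cases ha : ∀ w, w ∉ Set.range o₂ → a w = 0
  · by_cases hb : ∀ w, w ∉ Set.range o₂ → b w = 0
    · rw [if_pos ⟨ha, hb⟩]
      refine Finset.sum_congr rfl fun t _ => ?_
      rw [Finset.sum_eq_single 0]
      · rw [if_pos ⟨⟨ha, rfl⟩, hb, rfl⟩, hmerge, hmerge]
      · intro s _ hs
        exact if_neg fun h => hs h.1.2
      · simp
    · rw [if_neg fun h => hb h.2]
      exact Finset.sum_eq_zero fun t _ => Finset.sum_eq_zero fun s _ => if_neg fun h => hb h.2.1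
  · rw [if_neg fun h => ha h.1]
    exact Finset.sum_eq_zero fun t _ => Finset.sum_eq_zero fun s _ => if_neg fun h => ha h.1.1

end Finite

end Registers

/-! ### Circuits on subregisters -/

section Circuits

variable {G : GateSet} {U W V : Type}

/-- The circuit `C` carried over to a larger register. -/
def relabel (f : U ↪ W) (C : Circuit G U) : Circuit G W :=
  C.map fun g => ⟨g.arity, g.gate, g.gate_mem, g.wires.trans f⟩

@[simp]
theorem length_relabel (f : U ↪ W) (C : Circuit G U) : (relabel f C).length = C.length :=
  List.length_map _

variable [Fintype V] [DecidableEq V]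

theorem circuitOp_relabel (f : U ↪ W) (h : W ↪ V) (C : Circuit G U) :
    circuitOp h (relabel f C) = circuitOp (f.trans h) C := by
  induction C with
  | nil => rfl
  | cons g C ih =>
    change circuitOp h (relabel f C) * _ = circuitOp (f.trans h) C * _
    rw [ih]
    rfl

theorem circuitOp_trans [Fintype W] [DecidableEq W] (f : U ↪ W) (h : W ↪ V) (C : Circuit G U) :
    circuitOp (f.trans h) C = lift h (circuitOp f C) := by
  induction C with
  | nil => exact (lift_one h).symm
  | cons g C ih =>
    change circuitOp (f.trans h) C * gateOp ((g.wires.trans f).trans h) _ =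
      lift h (circuitOp f C * gateOp (g.wires.trans f) _)
    rw [ih, lift_mul]
    exact congrArg _ (lift_trans (g.wires.trans f) h _)

theorem circuitOp_append (f : W ↪ V) (C D : Circuit G W) :
    circuitOp f (C ++ D) = circuitOp f D * circuitOp f C := by
  induction C with
  | nil => exact (mul_one _).symm
  | cons g C ih =>
    change circuitOp f (C ++ D) * _ = circuitOp f D * (circuitOp f C * _)
    rw [ih, mul_assoc]

theorem circuitOp_mem_unitaryGroup (f : W ↪ V) (C : Circuit G W) :
    circuitOp f C ∈ Matrix.unitaryGroup (Bits V) ℂ := by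
  induction C with
  | nil => exact one_mem _
  | cons g C ih =>
    refine mul_mem ih ?_
    rw [Matrix.mem_unitaryGroup_iff, Matrix.star_eq_conjTranspose]
    change lift (g.wires.trans f) _ * (lift (g.wires.trans f) _)ᴴ = 1
    rw [conjTranspose_lift, ← lift_mul, ← Matrix.star_eq_conjTranspose,
      Matrix.mem_unitaryGroup_iff.1 g.gate.2, lift_one]

end Circuits

/-! ### Rounds of local circuits and measurements -/

section Rounds

variable {G : GateSet} {A B C A' B' C' : Type}

/-- One round of a protocol: the circuits of Alice and Bob. -/
abbrev Round (G : GateSet) (A B C : Type) : Type := Circuit G (A ⊕ C) × Circuit G (B ⊕ C)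

/-- Alice's part of the register `A ⊕ B ⊕ C`. -/
def aliceEmb (A B C : Type) : A ⊕ C ↪ A ⊕ B ⊕ C :=
  Function.Embedding.sumMap (Function.Embedding.refl _) Function.Embedding.inr

/-- Bob's part of the register `A ⊕ B ⊕ C`. -/
def bobEmb (A B C : Type) : B ⊕ C ↪ A ⊕ B ⊕ C := Function.Embedding.inr

/-- The embedding of `A ⊕ B ⊕ C` that acts on each of the three parts. -/
def tripleEmb (fA : A ↪ A') (fB : B ↪ B') (fC : C ↪ C') : A ⊕ B ⊕ C ↪ A' ⊕ B' ⊕ C' :=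
  Function.Embedding.sumMap fA (Function.Embedding.sumMap fB fC)

open Classical in
/-- Measurement of the register `C` in the computational basis. -/
def measure (σ : Matrix (Bits (A ⊕ B ⊕ C)) (Bits (A ⊕ B ⊕ C)) ℂ) :
    Matrix (Bits (A ⊕ B ⊕ C)) (Bits (A ⊕ B ⊕ C)) ℂ :=
  Matrix.of fun x y =>
    if ∀ c, x (Sum.inr (Sum.inr c)) = y (Sum.inr (Sum.inr c)) then σ x y else 0

/-- Qubits in state `|0⟩` that are added to the registers, also to the one that is measured, do not
affect the measurement. -/
theorem measure_ext (fA : A ↪ A') (fB : B ↪ B') (fC : C ↪ C')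
    (σ : Matrix (Bits (A ⊕ B ⊕ C)) (Bits (A ⊕ B ⊕ C)) ℂ) :
    measure (ext (tripleEmb fA fB fC) σ) = ext (tripleEmb fA fB fC) (measure σ) := by
  classical
  ext x y
  simp only [measure, ext, Matrix.of_apply]
  by_cases h : (∀ w, w ∉ Set.range (tripleEmb fA fB fC) → x w = 0) ∧
      ∀ w, w ∉ Set.range (tripleEmb fA fB fC) → y w = 0
  · rw [if_pos h, if_pos h]
    refine if_congr ⟨fun hc c => hc (fC c), fun hc c' => ?_⟩ rfl rfl
    by_cases hr : c' ∈ Set.range fC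
    · obtain ⟨c, rfl⟩ := hr
      exact hc c
    · have : (Sum.inr (Sum.inr c') : A' ⊕ B' ⊕ C') ∉ Set.range (tripleEmb fA fB fC) := by
        rintro ⟨a | b | c, hw⟩
        · exact Sum.inl_ne_inr hw
        · exact Sum.inl_ne_inr (Sum.inr_injective hw)
        · exact hr ⟨c, Sum.inr_injective (Sum.inr_injective hw)⟩
      rw [h.1 _ this, h.2 _ this]
  · rw [if_neg h, if_neg h, ite_self]

theorem ptrace_measure [Fintype (A' ⊕ B' ⊕ C')] (fA : A ↪ A') (fB : B ↪ B') (fC : C ↪ C')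
    (σ : Matrix (Bits (A' ⊕ B' ⊕ C')) (Bits (A' ⊕ B' ⊕ C')) ℂ) :
    ptrace (tripleEmb fA fB fC) (measure σ) = measure (ptrace (tripleEmb fA fB fC) σ) := by
  ext a b
  have h : ∀ z : Bits (Off (tripleEmb fA fB fC)),
      (∀ c, merge (tripleEmb fA fB fC) a z (Sum.inr (Sum.inr c)) =
        merge (tripleEmb fA fB fC) b z (Sum.inr (Sum.inr c))) ↔
      ∀ c, a (Sum.inr (Sum.inr c)) = b (Sum.inr (Sum.inr c)) := by
    intro z
    constructor
    · intro hc c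
      have := hc (fC c)
      rwa [show (Sum.inr (Sum.inr (fC c)) : A' ⊕ B' ⊕ C') =
        tripleEmb fA fB fC (Sum.inr (Sum.inr c)) from rfl, merge_apply, merge_apply] at this
    · intro hc c'
      by_cases hr : (Sum.inr (Sum.inr c') : A' ⊕ B' ⊕ C') ∈ Set.range (tripleEmb fA fB fC)
      · obtain ⟨a | b | c, hw⟩ := hr
        · exact (Sum.inl_ne_inr hw).elim
        · exact (Sum.inl_ne_inr (Sum.inr_injective hw)).elim
        · rw [← hw, merge_apply, merge_apply, hc]
      · rw [merge_off _ _ _ hr, merge_off _ _ _ hr]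
  simp only [ptrace, measure, Matrix.of_apply]
  by_cases hc : ∀ c, a (Sum.inr (Sum.inr c)) = b (Sum.inr (Sum.inr c))
  · rw [if_pos hc]
    exact Finset.sum_congr rfl fun z _ => if_pos ((h z).2 hc)
  · rw [if_neg hc]
    exact Finset.sum_eq_zero fun z _ => if_neg fun h' => hc ((h z).1 h')

/-- A measurement of qubits that are then discarded has no effect. -/
theorem ptrace_measure_of_off {W : Type} [Fintype (A ⊕ B ⊕ C)] (f : W ↪ A ⊕ B ⊕ C)
    (hf : ∀ c, Sum.inr (Sum.inr c) ∉ Set.range f)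
    (σ : Matrix (Bits (A ⊕ B ⊕ C)) (Bits (A ⊕ B ⊕ C)) ℂ) :
    ptrace f (measure σ) = ptrace f σ := by
  ext a b
  simp only [ptrace, measure, Matrix.of_apply]
  refine Finset.sum_congr rfl fun z _ => if_pos fun c => ?_
  rw [merge_off _ _ _ (hf c), merge_off _ _ _ (hf c)]

variable [Fintype A] [DecidableEq A] [Fintype B] [DecidableEq B] [Fintype C] [DecidableEq C]
  [Fintype A'] [DecidableEq A'] [Fintype B'] [DecidableEq B'] [Fintype C'] [DecidableEq C']

/-- The effect of one round. -/
def roundOp (p : Round G A B C) (σ : Matrix (Bits (A ⊕ B ⊕ C)) (Bits (A ⊕ B ⊕ C)) ℂ) :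
    Matrix (Bits (A ⊕ B ⊕ C)) (Bits (A ⊕ B ⊕ C)) ℂ :=
  measure (circuitOp (bobEmb A B C) p.2 *
    measure (circuitOp (aliceEmb A B C) p.1 * σ * (circuitOp (aliceEmb A B C) p.1)ᴴ) *
      (circuitOp (bobEmb A B C) p.2)ᴴ)

/-- The effect of a sequence of rounds. -/
def exec (L : List (Round G A B C)) (σ : Matrix (Bits (A ⊕ B ⊕ C)) (Bits (A ⊕ B ⊕ C)) ℂ) :
    Matrix (Bits (A ⊕ B ⊕ C)) (Bits (A ⊕ B ⊕ C)) ℂ :=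
  L.foldl (fun σ p => roundOp p σ) σ

/-- The round `p` carried over to larger registers. -/
def relabelRound (fA : A ↪ A') (fB : B ↪ B') (fC : C ↪ C') (p : Round G A B C) :
    Round G A' B' C' :=
  (relabel (Function.Embedding.sumMap fA fC) p.1, relabel (Function.Embedding.sumMap fB fC) p.2)

theorem circuitOp_alice_relabel (fA : A ↪ A') (fB : B ↪ B') (fC : C ↪ C') (D : Circuit G (A ⊕ C)) :
    circuitOp (aliceEmb A' B' C') (relabel (Function.Embedding.sumMap fA fC) D) =
      lift (tripleEmb fA fB fC) (circuitOp (aliceEmb A B C) D) := by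
  rw [circuitOp_relabel, ← circuitOp_trans]
  congr 1
  ext (a | c) <;> rfl

theorem circuitOp_bob_relabel (fA : A ↪ A') (fB : B ↪ B') (fC : C ↪ C') (D : Circuit G (B ⊕ C)) :
    circuitOp (bobEmb A' B' C') (relabel (Function.Embedding.sumMap fB fC) D) =
      lift (tripleEmb fA fB fC) (circuitOp (bobEmb A B C) D) := by
  rw [circuitOp_relabel, ← circuitOp_trans]
  congr 1

/-- Rounds that act on a subregister, applied while the other qubits are in state `|0⟩`. -/
theorem exec_relabel_ext (fA : A ↪ A') (fB : B ↪ B') (fC : C ↪ C') (L : List (Round G A B C))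
    (σ : Matrix (Bits (A ⊕ B ⊕ C)) (Bits (A ⊕ B ⊕ C)) ℂ) :
    exec (L.map (relabelRound fA fB fC)) (ext (tripleEmb fA fB fC) σ) =
      ext (tripleEmb fA fB fC) (exec L σ) := by
  induction L generalizing σ with
  | nil => rfl
  | cons p L ih =>
    change exec (L.map (relabelRound fA fB fC)) (roundOp (relabelRound fA fB fC p) _) =
      ext _ (exec L (roundOp p σ))
    rw [← ih]
    congr 1
    simp only [roundOp, relabelRound]
    rw [circuitOp_alice_relabel fA fB fC, circuitOp_bob_relabel fA fB fC, lift_conj_ext,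
      measure_ext, lift_conj_ext, measure_ext]

/-- Rounds that act on a subregister, seen from this subregister, whatever the state of the other
qubits. -/
theorem ptrace_exec_relabel (fA : A ↪ A') (fB : B ↪ B') (fC : C ↪ C') (L : List (Round G A B C))
    (σ : Matrix (Bits (A' ⊕ B' ⊕ C')) (Bits (A' ⊕ B' ⊕ C')) ℂ) :
    ptrace (tripleEmb fA fB fC) (exec (L.map (relabelRound fA fB fC)) σ) =
      exec L (ptrace (tripleEmb fA fB fC) σ) := by
  induction L generalizing σ with
  | nil => rfl
  | cons p L ih =>
    change ptrace _ (exec (L.map (relabelRound fA fB fC)) (roundOp (relabelRound fA fB fC p) _)) =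
      exec L (roundOp p _)
    rw [ih]
    congr 1
    simp only [roundOp, relabelRound]
    rw [circuitOp_alice_relabel fA fB fC, circuitOp_bob_relabel fA fB fC, ptrace_measure,
      ptrace_lift_conj, ptrace_measure, ptrace_lift_conj]

end Rounds

/-! ### Protocols as maps of registers -/

/-- An operator on `(ℂ²)^{⊗a} ⊗ (ℂ²)^{⊗b}` as an operator on a single register of `a + b` qubits. -/
def flat {a b : ℕ} (X : Op a b) : Matrix (Bits (Fin a ⊕ Fin b)) (Bits (Fin a ⊕ Fin b)) ℂ :=
  Matrix.of fun x y => X (x ∘ Sum.inl, x ∘ Sum.inr) (y ∘ Sum.inl, y ∘ Sum.inr)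

/-- The inverse of `flat`. -/
def unflat {a b : ℕ} (σ : Matrix (Bits (Fin a ⊕ Fin b)) (Bits (Fin a ⊕ Fin b)) ℂ) : Op a b :=
  Matrix.of fun p q => σ (Sum.elim p.1 p.2) (Sum.elim q.1 q.2)

@[simp]
theorem flat_unflat {a b : ℕ} (σ : Matrix (Bits (Fin a ⊕ Fin b)) (Bits (Fin a ⊕ Fin b)) ℂ) :
    flat (unflat σ) = σ := by
  ext x y
  simp [flat, unflat]

@[simp]
theorem unflat_flat {a b : ℕ} (X : Op a b) : unflat (flat X) = X := by
  ext x y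
  simp [flat, unflat, Function.comp_def]

namespace Protocol

variable {G : GateSet} {nA nB mA mB : ℕ}

/-- The qubits that hold the input. -/
def inWires (P : Protocol G nA nB mA mB) : Fin nA ⊕ Fin nB ↪ P.Wires :=
  Function.Embedding.sumMap (Fin.castAddEmb P.tA)
    ((Fin.castAddEmb P.tB).trans Function.Embedding.inl)

/-- The rounds of a protocol as a list. -/
def rounds (P : Protocol G nA nB mA mB) :
    List (Round G (Fin (nA + P.tA)) (Fin (nB + P.tB)) (Fin P.q)) :=
  (List.finRange P.r).map fun i => (P.alice i, P.bob i)

theorem ancillaZero_iff (P : Protocol G nA nB mA mB) (x : Bits P.Wires) :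
    P.AncillaZero x ↔ ∀ w, w ∉ Set.range P.inWires → x w = 0 := by
  constructor
  · rintro ⟨hA, hB, hC⟩ (a | b | c) hw
    · induction a using Fin.addCases with
      | left i => exact (hw ⟨Sum.inl i, rfl⟩).elim
      | right j => exact hA j
    · induction b using Fin.addCases with
      | left i => exact (hw ⟨Sum.inr i, rfl⟩).elim
      | right j => exact hB j
    · exact hC c
  · refine fun h => ⟨fun j => h _ ?_, fun j => h _ ?_, fun c => h _ ?_⟩
    · rintro ⟨a | b, hw⟩
      · have := congrArg Fin.val (Sum.inl_injective hw)
        have ha := a.2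
        simp at this
        omega
      · exact Sum.inr_ne_inl hw
    · rintro ⟨a | b, hw⟩
      · exact Sum.inl_ne_inr hw
      · have := congrArg Fin.val (Sum.inl_injective (Sum.inr_injective hw))
        have hb := b.2
        simp at this
        omega
    · rintro ⟨a | b, hw⟩
      · exact Sum.inl_ne_inr hw
      · exact Sum.inl_ne_inr (Sum.inr_injective hw)

theorem initOp_eq (P : Protocol G nA nB mA mB) (X : Op nA nB) :
    P.initOp X = ext P.inWires (flat X) := by
  classical
  ext x y
  simp only [initOp, ext, Matrix.of_apply]
  have h := and_congr (P.ancillaZero_iff x) (P.ancillaZero_iff y)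
  by_cases hx : P.AncillaZero x ∧ P.AncillaZero y
  · rw [if_pos hx, if_pos (h.1 hx)]
    rfl
  · rw [if_neg hx, if_neg fun hy => hx (h.2 hy)]

theorem output_eq (P : Protocol G nA nB mA mB) (σ : Matrix (Bits P.Wires) (Bits P.Wires) ℂ) :
    P.output σ = unflat (ptrace P.outWires σ) := by
  classical
  ext a b
  simp only [output, unflat, ptrace, Matrix.of_apply]
  rw [sum_merge P.outWires, Finset.sum_eq_single (Sum.elim a.1 a.2)]
  · refine Finset.sum_congr rfl fun z _ => ?_
    rw [sum_merge P.outWires, Finset.sum_eq_single (Sum.elim b.1 b.2), Finset.sum_eq_single z]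
    · exact if_pos ⟨merge_comp _ _ _, merge_comp _ _ _, (merge_agree_iff _ _ _ _ _).2 rfl⟩
    · exact fun t _ ht => if_neg fun h => ht ((merge_agree_iff _ _ _ _ _).1 h.2.2).symm
    · simp
    · intro b' _ hb'
      exact Finset.sum_eq_zero fun t _ => if_neg fun h => hb' ((merge_comp _ _ _).symm.trans h.2.1)
    · simp
  · intro a' _ ha'
    exact Finset.sum_eq_zero fun z _ => Finset.sum_eq_zero fun y _ =>
      if_neg fun h => ha' ((merge_comp _ _ _).symm.trans h.1)
  · simp

theorem measureC_eq (P : Protocol G nA nB mA mB) (σ : Matrix (Bits P.Wires) (Bits P.Wires) ℂ) :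
    P.measureC σ = measure σ := by
  ext x y
  simp only [measureC, measure, Matrix.of_apply]
  congr

/-- A protocol prepares its ancilla qubits, executes its rounds and discards all qubits but the
output. -/
theorem run_eq (P : Protocol G nA nB mA mB) (X : Op nA nB) :
    P.run X = unflat (ptrace P.outWires (exec P.rounds (ext P.inWires (flat X)))) := by
  rw [run, output_eq, initOp_eq, exec, rounds, List.foldl_map]
  congr 3
  ext σ i x y
  simp only [round, roundOp, measureC_eq]
  rfl

end Protocol

/-! ### Protocols have Kraus form -/

section Kraus

theorem IsKraus.sum {ι κ K : Type} [Fintype ι] [Fintype κ] [Fintype K]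
    {Φ : K → Matrix ι ι ℂ → Matrix κ κ ℂ} (h : ∀ k, IsKraus (Φ k)) :
    IsKraus fun X => ∑ k, Φ k X := by
  choose L hL E hE using h
  refine ⟨Σ k, L k, inferInstance, fun p => E p.1 p.2, fun X => ?_⟩
  simp only [hE]
  rw [Fintype.sum_sigma]

open Classical in
/-- Restricting to basis labels with the property `p` and relabelling by `f` is a Kraus map. -/
theorem isKraus_restrict {ι κ : Type} [Fintype ι] [Fintype κ] (p : κ → Prop) (f : κ → ι) :
    IsKraus fun X : Matrix ι ι ℂ =>
      (Matrix.of fun x y => if p x ∧ p y then X (f x) (f y) else 0 : Matrix κ κ ℂ) := by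
  refine ⟨Unit, inferInstance,
    fun _ => Matrix.of fun x i => if p x ∧ f x = i then 1 else 0, fun X => ?_⟩
  ext x y
  by_cases hx : p x <;> by_cases hy : p y <;> simp [Matrix.mul_apply, hx, hy]

theorem isKraus_measure {A B C : Type} [Fintype A] [DecidableEq A] [Fintype B] [DecidableEq B]
    [Fintype C] [DecidableEq C] : IsKraus (measure (A := A) (B := B) (C := C)) := by
  classical
  have h := IsKraus.sum fun c : Bits C => isKraus_restrict
    (fun x : Bits (A ⊕ B ⊕ C) => (fun i => x (Sum.inr (Sum.inr i))) = c) id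
  convert h using 1
  funext σ
  ext x y
  simp only [measure, Matrix.of_apply, Matrix.sum_apply, id]
  by_cases hc : ∀ c, x (Sum.inr (Sum.inr c)) = y (Sum.inr (Sum.inr c))
  · rw [if_pos hc, Finset.sum_eq_single fun i => x (Sum.inr (Sum.inr i))]
    · exact (if_pos ⟨rfl, funext fun c => (hc c).symm⟩).symm
    · exact fun c _ hcx => if_neg fun h => hcx h.1.symm
    · simp
  · rw [if_neg hc]
    refine (Finset.sum_eq_zero fun c _ => if_neg fun h => hc fun i => ?_).symm
    exact congrFun (h.1.trans h.2.symm) i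

theorem isKraus_exec {G : GateSet} {A B C : Type} [Fintype A] [DecidableEq A] [Fintype B]
    [DecidableEq B] [Fintype C] [DecidableEq C] (L : List (Round G A B C)) :
    IsKraus (exec L) := by
  induction L with
  | nil =>
    convert IsKraus.conj (1 : Matrix (Bits (A ⊕ B ⊕ C)) (Bits (A ⊕ B ⊕ C)) ℂ) using 1
    funext X
    simp [exec]
  | cons p L ih =>
    exact ih.comp (isKraus_measure.comp ((IsKraus.conj _).comp
      (isKraus_measure.comp (IsKraus.conj _))))

theorem Protocol.isKraus_run {G : GateSet} {nA nB mA mB : ℕ} (P : Protocol G nA nB mA mB) :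
    IsKraus P.run := by
  classical
  have h1 : IsKraus P.initOp := isKraus_restrict P.AncillaZero P.inputBits
  have h2 : IsKraus P.output := by
    convert IsKraus.sum fun z : Bits (Off P.outWires) => isKraus_restrict
      (fun _ : Q mA × Q mB => True) (fun p => merge P.outWires (Sum.elim p.1 p.2) z) using 1
    funext σ
    rw [P.output_eq]
    ext a b
    simp [unflat, ptrace, Matrix.sum_apply]
  have h3 := h2.comp ((isKraus_exec P.rounds).comp h1)
  convert h3 using 1
  funext X
  rw [P.run_eq, P.output_eq, P.initOp_eq]

end Kraus

/-! ### Circuits for exchanges of qubits -/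

section Swaps

variable {G : GateSet} {U W V : Type} [Fintype V] [DecidableEq V]

open Classical in
/-- The operator that permutes the qubits of a register: the qubit `v` gets the value that the
qubit `π v` had, so that `permOp` reverses products. -/
def permOp (π : Equiv.Perm V) : Matrix (Bits V) (Bits V) ℂ :=
  Matrix.of fun x y => if x = y ∘ π then 1 else 0

omit [DecidableEq V] in
theorem permOp_one : permOp (1 : Equiv.Perm V) = 1 := by
  ext x y
  simp [permOp, Matrix.one_apply]

theorem permOp_mul_apply {X : Type} (π : Equiv.Perm V) (M : Matrix (Bits V) X ℂ) (x : Bits V)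
    (y : X) : (permOp π * M) x y = M (x ∘ π.symm) y := by
  classical
  rw [Matrix.mul_apply, Finset.sum_eq_single (x ∘ π.symm)]
  · simp [permOp, Function.comp_assoc]
  · intro z _ hz
    have : x ≠ z ∘ π := by
      rintro rfl
      exact hz (by simp [Function.comp_assoc])
    simp [permOp, this]
  · simp

theorem permOp_mul (π τ : Equiv.Perm V) : permOp π * permOp τ = permOp (τ * π) := by
  ext x y
  rw [permOp_mul_apply]
  simp only [permOp, Matrix.of_apply]
  refine if_congr ⟨fun h => ?_, fun h => ?_⟩ rfl rfl
  · rw [Equiv.Perm.coe_mul, ← Function.comp_assoc, ← h]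
    simp [Function.comp_assoc]
  · rw [h]
    funext i
    simp

/-- Conjugation with a permutation of the qubits, seen from a subregister. -/
theorem ptrace_permOp_conj [Fintype W] [DecidableEq W] (f : W ↪ V) (π : Equiv.Perm V)
    (σ : Matrix (Bits V) (Bits V) ℂ) :
    ptrace f (permOp π * σ * (permOp π)ᴴ) = ptrace (f.trans π.toEmbedding) σ := by
  have h : permOp π * σ * (permOp π)ᴴ = Matrix.of fun x y => σ (x ∘ π.symm) (y ∘ π.symm) := by
    ext x y
    have h1 : permOp π * σ * (permOp π)ᴴ = (permOp π * (permOp π * σ)ᴴ)ᴴ := by simp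
    rw [h1, Matrix.conjTranspose_apply, permOp_mul_apply, Matrix.conjTranspose_apply, star_star,
      permOp_mul_apply]
    rfl
  rw [h, ptrace_trans]
  have h2 : ptrace π.toEmbedding σ = Matrix.of fun x y => σ (x ∘ π.symm) (y ∘ π.symm) := by
    have hE : IsEmpty (Off π.toEmbedding) := ⟨fun v => v.property (π.surjective v.val)⟩
    ext x y
    have hm : ∀ (x : Bits V) z, merge π.toEmbedding x z = x ∘ π.symm := by
      intro x z
      funext v
      obtain ⟨w, rfl⟩ := π.surjective v
      exact (merge_apply π.toEmbedding x z w).trans (by simp)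
    simp only [ptrace, Matrix.of_apply, hm]
    simp
  rw [h2]

theorem lift_swapMatrix (e : Fin 2 ↪ V) :
    lift e swapMatrix = permOp (Equiv.swap (e 0) (e 1)) := by
  classical
  ext x y
  have key : ((∀ w, w ∉ Set.range e → x w = y w) ∧ x ∘ e = (y ∘ e) ∘ Equiv.swap 0 1) ↔
      x = y ∘ Equiv.swap (e 0) (e 1) := by
    refine ⟨?_, ?_⟩
    · rintro ⟨h1, h2⟩
      funext v
      by_cases hv : v ∈ Set.range e
      · obtain ⟨i, rfl⟩ := hv
        have := congrFun h2 i
        fin_cases i <;> simpa using this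
      · rw [h1 v hv, Function.comp_apply, Equiv.swap_apply_of_ne_of_ne]
        · rintro rfl
          exact hv ⟨0, rfl⟩
        · rintro rfl
          exact hv ⟨1, rfl⟩
    · rintro rfl
      refine ⟨fun v hv => ?_, ?_⟩
      · rw [Function.comp_apply, Equiv.swap_apply_of_ne_of_ne]
        · rintro rfl
          exact hv ⟨0, rfl⟩
        · rintro rfl
          exact hv ⟨1, rfl⟩
      · funext i
        fin_cases i <;> simp
  simp only [lift, swapMatrix, permOp, Matrix.of_apply]
  by_cases h1 : ∀ w, w ∉ Set.range e → x w = y w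
  · rw [if_pos h1]
    exact if_congr ⟨fun h => key.1 ⟨h1, h⟩, fun h => (key.2 h).2⟩ rfl rfl
  · rw [if_neg h1, if_neg fun h => h1 (key.2 h).1]

/-- Disjoint exchanges `a j ↔ b j` are carried out, up to a phase, by a circuit whose length is
proportional to their number. -/
theorem exists_swapCircuit {S : Circuit G (Fin 2)} {z : ℂ}
    (hS : circuitOp (Function.Embedding.refl _) S = z • swapMatrix) {t : ℕ}
    (a b : Fin t → W) (ha : Function.Injective a) (hb : Function.Injective b)
    (hab : ∀ i j, a i ≠ b j) :
    ∃ C : Circuit G W, C.length = t * S.length ∧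
      ∀ {V : Type} [Fintype V] [DecidableEq V] (f : W ↪ V), ∃ (π : Equiv.Perm V) (c : ℂ),
        circuitOp f C = c • permOp π ∧ (∀ j, π (f (a j)) = f (b j)) ∧
        ∀ v, (∀ j, v ≠ f (a j)) → (∀ j, v ≠ f (b j)) → π v = v := by
  induction t with
  | zero =>
    exact ⟨[], by simp, fun f => ⟨1, 1, by rw [permOp_one, one_smul]; rfl, fun j => j.elim0,
      fun v _ _ => rfl⟩⟩
  | succ t ih =>
    obtain ⟨C, hC, hop⟩ := ih (a ∘ Fin.castSucc) (b ∘ Fin.castSucc)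
      (ha.comp (Fin.castSucc_injective t)) (hb.comp (Fin.castSucc_injective t))
      (fun i j => hab _ _)
    let e : Fin 2 ↪ W := ⟨![a (Fin.last t), b (Fin.last t)], fun i j h => by
      have hne := hab (Fin.last t) (Fin.last t)
      fin_cases i <;> fin_cases j
      · rfl
      · exact (hne h).elim
      · exact (hne h.symm).elim
      · rfl⟩
    refine ⟨C ++ relabel e S, by simp [hC]; ring, fun f => ?_⟩
    obtain ⟨π, c, h1, h2, h3⟩ := hop f
    have hfe : circuitOp f (relabel e S) =
        z • permOp (Equiv.swap (f (a (Fin.last t))) (f (b (Fin.last t)))) := by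
      have h := circuitOp_trans (Function.Embedding.refl (Fin 2)) (e.trans f) S
      rw [circuitOp_relabel]
      refine h.trans ?_
      rw [hS, lift_smul, lift_swapMatrix]
      rfl
    have hfix : ∀ v, (v = f (a (Fin.last t)) ∨ v = f (b (Fin.last t))) → π v = v := by
      rintro v (rfl | rfl)
      · refine h3 _ (fun j h => ?_) fun j h => hab _ _ (f.injective h)
        exact (Fin.castSucc_lt_last j).ne' (ha (f.injective h))
      · refine h3 _ (fun j h => hab _ _ (f.injective h).symm) fun j h => ?_
        exact (Fin.castSucc_lt_last j).ne' (hb (f.injective h))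
    refine ⟨π * Equiv.swap (f (a (Fin.last t))) (f (b (Fin.last t))), z * c, ?_, ?_, ?_⟩
    · rw [circuitOp_append, hfe, h1, Matrix.smul_mul, Matrix.mul_smul, permOp_mul, smul_smul]
    · intro j
      induction j using Fin.lastCases with
      | last =>
        rw [Equiv.Perm.mul_apply, Equiv.swap_apply_left]
        exact hfix _ (Or.inr rfl)
      | cast j =>
        rw [Equiv.Perm.mul_apply, Equiv.swap_apply_of_ne_of_ne]
        · exact h2 j
        · exact fun h => (Fin.castSucc_lt_last j).ne (ha (f.injective h))
        · exact fun h => hab _ _ (f.injective h)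
    · intro v hva hvb
      rw [Equiv.Perm.mul_apply, Equiv.swap_apply_of_ne_of_ne (hva _) (hvb _)]
      exact h3 v (fun j => hva _) fun j => hvb _

/-- A unitary that is a multiple of a permutation acts on operators as the permutation. -/
theorem conj_eq_permOp_conj {M : Matrix (Bits V) (Bits V) ℂ} {c : ℂ} {π : Equiv.Perm V}
    (hM : M ∈ Matrix.unitaryGroup (Bits V) ℂ) (h : M = c • permOp π)
    (σ : Matrix (Bits V) (Bits V) ℂ) : M * σ * Mᴴ = permOp π * σ * (permOp π)ᴴ := by
  -- Since `permOp π` fixes the basis label `0`, unitarity at this entry says that `c` is a phase.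
  have hc : c * star c = 1 := by
    have h1 := Matrix.mem_unitaryGroup_iff.1 hM
    rw [Matrix.star_eq_conjTranspose, h] at h1
    have h2 := congrFun (congrFun h1 (0 : Bits V)) 0
    rw [Matrix.conjTranspose_smul, Matrix.smul_mul, Matrix.smul_apply, permOp_mul_apply] at h2
    have h3 : (0 : Bits V) = (0 : Bits V) ∘ π := rfl
    have h4 : (0 : Bits V) ∘ π.symm = 0 := rfl
    simpa [permOp, h4, ← h3] using h2
  rw [h, Matrix.conjTranspose_smul, Matrix.smul_mul, Matrix.smul_mul, Matrix.mul_smul, smul_smul,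
    hc, one_smul]

end Swaps

/-! ### Composition of protocols -/

section ExtTrans

variable {U W V : Type}

theorem ext_trans (g : U ↪ W) (f : W ↪ V) (σ : Matrix (Bits U) (Bits U) ℂ) :
    ext (g.trans f) σ = ext f (ext g σ) := by
  classical
  have h : ∀ x : Bits V, (∀ v, v ∉ Set.range (g.trans f) → x v = 0) ↔
      (∀ v, v ∉ Set.range f → x v = 0) ∧ ∀ w, w ∉ Set.range g → (x ∘ f) w = 0 := by
    intro x
    constructor
    · refine fun h => ⟨fun v hv => h v ?_, fun w hw => h (f w) ?_⟩
      · rintro ⟨u, rfl⟩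
        exact hv ⟨g u, rfl⟩
      · rintro ⟨u, hu⟩
        exact hw ⟨u, f.injective hu⟩
    · rintro ⟨h1, h2⟩ v hv
      by_cases hf : v ∈ Set.range f
      · obtain ⟨w, rfl⟩ := hf
        refine h2 w ?_
        rintro ⟨u, rfl⟩
        exact hv ⟨u, rfl⟩
      · exact h1 v hf
  ext x y
  simp only [ext, Matrix.of_apply]
  by_cases hx : (∀ v, v ∉ Set.range (g.trans f) → x v = 0) ∧
      ∀ v, v ∉ Set.range (g.trans f) → y v = 0
  · rw [if_pos hx, if_pos ⟨((h x).1 hx.1).1, ((h y).1 hx.2).1⟩,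
      if_pos ⟨((h x).1 hx.1).2, ((h y).1 hx.2).2⟩]
    rfl
  · rw [if_neg hx]
    split_ifs with h1 h2
    · exact absurd ⟨(h x).2 ⟨h1.1, h2.1⟩, (h y).2 ⟨h1.2, h2.2⟩⟩ hx
    · rfl
    · rfl

end ExtTrans

/-- Places a register of `k + t` qubits in one of `M` qubits: the first `k` qubits stay, and the
others are moved behind the first `N + t` qubits. -/
def shiftEmb {k t N M : ℕ} (hk : k ≤ N) (hM : N + 2 * t ≤ M) : Fin (k + t) ↪ Fin M :=
  ⟨fun i => ⟨if i.1 < k then i.1 else i.1 - k + (N + t), by split_ifs <;> omega⟩, fun i j h => by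
    have h1 := congrArg Fin.val h
    simp only at h1
    ext
    split_ifs at h1 <;> omega⟩

namespace Protocol

variable {G : GateSet} {nA nB kA kB mA mB : ℕ}

theorem size_eq (P : Protocol G nA nB mA mB) :
    P.size = (P.rounds.map fun p => p.1.length + p.2.length).sum + (P.tA + P.tB + P.q) +
      2 * P.r * P.q := by
  rw [size, Fin.sum_univ_def, rounds, List.map_map]
  rfl

/-- The protocol with a given list of rounds. -/
def ofRounds {tA tB q : ℕ} (hq : 0 < q) (hA : mA ≤ nA + tA) (hB : mB ≤ nB + tB)
    (L : List (Round G (Fin (nA + tA)) (Fin (nB + tB)) (Fin q))) : Protocol G nA nB mA mB where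
  tA := tA
  tB := tB
  q := q
  q_pos := hq
  r := L.length
  alice i := (L.get i).1
  bob i := (L.get i).2
  outA := hA
  outB := hB

theorem rounds_ofRounds {tA tB q : ℕ} (hq : 0 < q) (hA : mA ≤ nA + tA) (hB : mB ≤ nB + tB)
    (L : List (Round G (Fin (nA + tA)) (Fin (nB + tB)) (Fin q))) :
    (ofRounds hq hA hB L).rounds = L :=
  List.map_get_finRange L

/-- The input qubits of a register with `tA + tB` ancilla qubits and `q` communication qubits. -/
def inEmb (nA nB tA tB q : ℕ) : Fin nA ⊕ Fin nB ↪ Fin (nA + tA) ⊕ Fin (nB + tB) ⊕ Fin q :=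
  Function.Embedding.sumMap (Fin.castAddEmb tA)
    ((Fin.castAddEmb tB).trans Function.Embedding.inl)

/-- The output qubits of a register with `q` communication qubits. -/
def outEmb {NA NB : ℕ} (hA : mA ≤ NA) (hB : mB ≤ NB) (q : ℕ) :
    Fin mA ⊕ Fin mB ↪ Fin NA ⊕ Fin NB ⊕ Fin q :=
  Function.Embedding.sumMap (Fin.castLEEmb hA) ((Fin.castLEEmb hB).trans Function.Embedding.inl)

theorem run_ofRounds {tA tB q : ℕ} (hq : 0 < q) (hA : mA ≤ nA + tA) (hB : mB ≤ nB + tB)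
    (L : List (Round G (Fin (nA + tA)) (Fin (nB + tB)) (Fin q))) (X : Op nA nB) :
    (ofRounds hq hA hB L).run X =
      unflat (ptrace (outEmb hA hB q) (exec L (ext (inEmb nA nB tA tB q) (flat X)))) := by
  rw [run_eq, rounds_ofRounds]
  rfl

theorem size_ofRounds {tA tB q : ℕ} (hq : 0 < q) (hA : mA ≤ nA + tA) (hB : mB ≤ nB + tB)
    (L : List (Round G (Fin (nA + tA)) (Fin (nB + tB)) (Fin q))) :
    (ofRounds hq hA hB L).size =
      (L.map fun p => p.1.length + p.2.length).sum + (tA + tB + q) + 2 * L.length * q := by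
  rw [size_eq, rounds_ofRounds]
  rfl

/-- Two protocols can be carried out one after the other. The second protocol is run on the output
qubits of the first and on fresh ancilla qubits; a last round of exchanges moves its output to the
front of the registers. -/
theorem exists_comp {S : Circuit G (Fin 2)} {z : ℂ}
    (hS : circuitOp (Function.Embedding.refl _) S = z • swapMatrix)
    (P : Protocol G nA nB kA kB) (P' : Protocol G kA kB mA mB) :
    ∃ R : Protocol G nA nB mA mB, (∀ X, R.run X = P'.run (P.run X)) ∧
      R.size ≤ (P.size + P'.size) * (2 * (P.size + P'.size) + 5 + S.length) := by
  have hkA := P.outA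
  have hkB := P.outB
  have hmA := P'.outA
  have hmB := P'.outB
  -- Of the two blocks of `t` ancilla qubits that are added for `P'`, the second one serves as the
  -- ancilla register of `P'`; the first one only keeps the exchanged blocks disjoint.
  have hMA : nA + P.tA + 2 * P'.tA ≤ nA + (P.tA + 2 * P'.tA) := by omega
  have hMB : nB + P.tB + 2 * P'.tB ≤ nB + (P.tB + 2 * P'.tB) := by omega
  let fA : Fin (nA + P.tA) ↪ Fin (nA + (P.tA + 2 * P'.tA)) := Fin.castLEEmb (by omega)
  let fB : Fin (nB + P.tB) ↪ Fin (nB + (P.tB + 2 * P'.tB)) := Fin.castLEEmb (by omega)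
  let fC : Fin P.q ↪ Fin (P.q + P'.q) := Fin.castAddEmb P'.q
  let gA : Fin (kA + P'.tA) ↪ Fin (nA + (P.tA + 2 * P'.tA)) := shiftEmb hkA hMA
  let gB : Fin (kB + P'.tB) ↪ Fin (nB + (P.tB + 2 * P'.tB)) := shiftEmb hkB hMB
  let gC : Fin P'.q ↪ Fin (P.q + P'.q) := Fin.natAddEmb P.q
  let aA : Fin P'.tA → Fin (nA + (P.tA + 2 * P'.tA)) := fun j => ⟨kA + j, by omega⟩
  let bA : Fin P'.tA → Fin (nA + (P.tA + 2 * P'.tA)) :=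
    fun j => ⟨nA + P.tA + P'.tA + j, by omega⟩
  let aB : Fin P'.tB → Fin (nB + (P.tB + 2 * P'.tB)) := fun j => ⟨kB + j, by omega⟩
  let bB : Fin P'.tB → Fin (nB + (P.tB + 2 * P'.tB)) :=
    fun j => ⟨nB + P.tB + P'.tB + j, by omega⟩
  obtain ⟨CA, hCA, hCAop⟩ := exists_swapCircuit hS
    (W := Fin (nA + (P.tA + 2 * P'.tA)) ⊕ Fin (P.q + P'.q))
    (fun j => Sum.inl (aA j)) (fun j => Sum.inl (bA j))
    (fun i j h => by simpa [aA, Fin.ext_iff] using h)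
    (fun i j h => by simpa [bA, Fin.ext_iff] using h)
    (fun i j h => by simp [aA, bA] at h; omega)
  obtain ⟨CB, hCB, hCBop⟩ := exists_swapCircuit hS
    (W := Fin (nB + (P.tB + 2 * P'.tB)) ⊕ Fin (P.q + P'.q))
    (fun j => Sum.inl (aB j)) (fun j => Sum.inl (bB j))
    (fun i j h => by simpa [aB, Fin.ext_iff] using h)
    (fun i j h => by simpa [bB, Fin.ext_iff] using h)
    (fun i j h => by simp [aB, bB] at h; omega)
  let L := P.rounds.map (relabelRound fA fB fC) ++
    (P'.rounds.map (relabelRound gA gB gC) ++ [(CA, CB)])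
  have houtA : mA ≤ nA + (P.tA + 2 * P'.tA) := by omega
  have houtB : mB ≤ nB + (P.tB + 2 * P'.tB) := by omega
  refine ⟨ofRounds (Nat.add_pos_left P.q_pos P'.q) houtA houtB L, fun X => ?_, ?_⟩
  · let oV := outEmb houtA houtB (P.q + P'.q)
    let j₁ := tripleEmb fA fB fC
    let j₂ := tripleEmb gA gB gC
    have hin : inEmb nA nB (P.tA + 2 * P'.tA) (P.tB + 2 * P'.tB) (P.q + P'.q) =
        P.inWires.trans j₁ := by
      ext (i | i) <;> rfl
    set σ := exec P.rounds (ext P.inWires (flat X)) with hσ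
    -- The second protocol finds the output of the first, with its ancilla qubits in state `|0⟩`.
    have hhandover : ptrace j₂ (ext j₁ σ) = ext P'.inWires (ptrace P.outWires σ) := by
      refine ptrace_ext ?_ ?_ σ
      · rintro (i | i)
        · refine congrArg Sum.inl (Fin.ext ?_)
          change i.1 = if i.1 < kA then i.1 else _
          rw [if_pos i.2]
        · refine congrArg (Sum.inr ∘ Sum.inl) (Fin.ext ?_)
          change i.1 = if i.1 < kB then i.1 else _
          rw [if_pos i.2]
      · rintro (i | i | i) (j | j | j) h
        · have h1 : i.1 = if j.1 < kA then j.1 else j.1 - kA + (nA + P.tA + P'.tA) :=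
            congrArg Fin.val (Sum.inl_injective h)
          have hi := i.2
          have : i.1 < kA := by split_ifs at h1 <;> omega
          exact ⟨Sum.inl ⟨i.1, this⟩, rfl⟩
        · exact (Sum.inl_ne_inr h).elim
        · exact (Sum.inl_ne_inr h).elim
        · exact (Sum.inr_ne_inl h).elim
        · have h1 : i.1 = if j.1 < kB then j.1 else j.1 - kB + (nB + P.tB + P'.tB) :=
            congrArg Fin.val (Sum.inl_injective (Sum.inr_injective h))
          have hi := i.2
          have : i.1 < kB := by split_ifs at h1 <;> omega
          exact ⟨Sum.inr ⟨i.1, this⟩, rfl⟩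
        · exact (Sum.inl_ne_inr (Sum.inr_injective h)).elim
        · exact (Sum.inr_ne_inl h).elim
        · exact (Sum.inr_ne_inl (Sum.inr_injective h)).elim
        · have h1 : i.1 = P.q + j.1 :=
            congrArg Fin.val (Sum.inr_injective (Sum.inr_injective h))
          have hi := i.2
          omega
    obtain ⟨πA, cA, hA1, hA2, hA3⟩ := hCAop (aliceEmb _ (Fin (nB + (P.tB + 2 * P'.tB))) _)
    obtain ⟨πB, cB, hB1, hB2, hB3⟩ := hCBop (bobEmb (Fin (nA + (P.tA + 2 * P'.tA))) _ _)
    have hA2' : ∀ j, πA (Sum.inl (aA j)) = Sum.inl (bA j) := hA2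
    have hB2' : ∀ j, πB (Sum.inr (Sum.inl (aB j))) = Sum.inr (Sum.inl (bB j)) := hB2
    have hAr : ∀ v, πA (Sum.inr v) = Sum.inr v := fun v =>
      hA3 _ (fun j h => Sum.inr_ne_inl h) fun j h => Sum.inr_ne_inl h
    have hBl : ∀ v, πB (Sum.inl v) = Sum.inl v := fun v =>
      hB3 _ (fun j h => Sum.inl_ne_inr h) fun j h => Sum.inl_ne_inr h
    have hAl : ∀ (i : ℕ) (hi : i < kA + P'.tA) (hi' : i < nA + (P.tA + 2 * P'.tA)),
        πA (Sum.inl ⟨i, hi'⟩) = Sum.inl (gA ⟨i, hi⟩) := by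
      intro i hi hi'
      by_cases h : i < kA
      · rw [hA3]
        · refine congrArg Sum.inl (Fin.ext ?_)
          change i = if i < kA then i else _
          rw [if_pos h]
        · intro j hj
          have : i = kA + j := congrArg Fin.val (Sum.inl_injective hj)
          omega
        · intro j hj
          have : i = nA + P.tA + P'.tA + j := congrArg Fin.val (Sum.inl_injective hj)
          omega
      · have := hA2' ⟨i - kA, by omega⟩
        convert this using 3
        · exact Fin.ext (by simp [aA]; omega)
        · refine Fin.ext ?_
          change (if i < kA then i else i - kA + (nA + P.tA + P'.tA)) =
            nA + P.tA + P'.tA + (i - kA)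
          rw [if_neg h]
          omega
    have hBr : ∀ (i : ℕ) (hi : i < kB + P'.tB) (hi' : i < nB + (P.tB + 2 * P'.tB)),
        πB (Sum.inr (Sum.inl ⟨i, hi'⟩)) = Sum.inr (Sum.inl (gB ⟨i, hi⟩)) := by
      intro i hi hi'
      by_cases h : i < kB
      · rw [hB3]
        · refine congrArg (Sum.inr ∘ Sum.inl) (Fin.ext ?_)
          change i = if i < kB then i else _
          rw [if_pos h]
        · intro j hj
          have : i = kB + j := congrArg Fin.val (Sum.inl_injective (Sum.inr_injective hj))
          omega
        · intro j hj
          have : i = nB + P.tB + P'.tB + j :=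
            congrArg Fin.val (Sum.inl_injective (Sum.inr_injective hj))
          omega
      · have := hB2' ⟨i - kB, by omega⟩
        convert this using 4
        · exact Fin.ext (by simp [aB]; omega)
        · refine Fin.ext ?_
          change (if i < kB then i else i - kB + (nB + P.tB + P'.tB)) =
            nB + P.tB + P'.tB + (i - kB)
          rw [if_neg h]
          omega
    -- Pulled back through the exchanges, the output qubits are those of the second protocol.
    have hout1 : ∀ i, oV.trans πB.toEmbedding (Sum.inl i) =
        Sum.inl ⟨i.1, by omega⟩ :=
      fun i => hBl _
    have hout2 : ∀ i : Fin mB, oV.trans πB.toEmbedding (Sum.inr i) =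
        Sum.inr (Sum.inl (gB ⟨i.1, by omega⟩)) :=
      fun i => hBr _ _ _
    have hout : (oV.trans πB.toEmbedding).trans πA.toEmbedding =
        P'.outWires.trans j₂ := by
      ext1 (i | i)
      · change πA (oV.trans πB.toEmbedding (Sum.inl i)) = _
        rw [hout1]
        exact hAl _ _ _
      · change πA (oV.trans πB.toEmbedding (Sum.inr i)) = _
        rw [hout2]
        exact hAr _
    have hlast : ∀ τ, ptrace oV (roundOp (CA, CB) τ) =
        ptrace P'.outWires (ptrace j₂ τ) := by
      intro τ
      rw [← ptrace_trans, ← hout, roundOp, ptrace_measure_of_off,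
        conj_eq_permOp_conj (circuitOp_mem_unitaryGroup _ _) hB1, ptrace_permOp_conj,
        ptrace_measure_of_off, conj_eq_permOp_conj (circuitOp_mem_unitaryGroup _ _) hA1,
        ptrace_permOp_conj]
      · rintro c ⟨i | i, h⟩
        · rw [hout1] at h
          exact Sum.inl_ne_inr h
        · rw [hout2] at h
          exact Sum.inl_ne_inr (Sum.inr_injective h)
      · rintro c ⟨i | i, h⟩
        · exact Sum.inl_ne_inr h
        · exact Sum.inl_ne_inr (Sum.inr_injective h)
    have hexec : exec L (ext (inEmb nA nB _ _ _) (flat X)) =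
        roundOp (CA, CB) (exec (P'.rounds.map (relabelRound gA gB gC)) (ext j₁ σ)) := by
      rw [hin, ext_trans, hσ,
        ← exec_relabel_ext]
      simp only [L, exec, List.foldl_append]
      rfl
    rw [run_ofRounds, hexec, hlast, ptrace_exec_relabel, hhandover, P'.run_eq, P.run_eq,
      flat_unflat]
  · have hlen : L.length = P.r + (P'.r + 1) := by simp [L, rounds]
    have hsum : (L.map fun p => p.1.length + p.2.length).sum =
        (P.rounds.map fun p => p.1.length + p.2.length).sum +
        ((P'.rounds.map fun p => p.1.length + p.2.length).sum +
          (P'.tA + P'.tB) * S.length) := by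
      simp only [L, List.map_append, List.sum_append, List.map_map, Function.comp_def,
        relabelRound, length_relabel, List.map_cons, List.map_nil, List.sum_cons, List.sum_nil,
        hCA, hCB]
      ring
    rw [size_ofRounds, hsum, hlen]
    clear_value L
    clear hsum hlen hCAop hCBop
    have hP := P.size_eq
    have hP' := P'.size_eq
    have hq := P.q_pos
    have hq' := P'.q_pos
    have hr1 : P.r ≤ 2 * P.r * P.q := by nlinarith
    have hr2 : P'.r ≤ 2 * P'.r * P'.q := by nlinarith
    generalize (P.rounds.map fun p => p.1.length + p.2.length).sum = g at *
    generalize (P'.rounds.map fun p => p.1.length + p.2.length).sum = g' at *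
    have h1 : (P'.tA + P'.tB) * S.length ≤ (P.size + P'.size) * S.length :=
      Nat.mul_le_mul_right _ (by omega)
    have h2 : (P.r + (P'.r + 1)) * (P.q + P'.q) ≤ (P.size + P'.size + 1) * (P.size + P'.size) :=
      Nat.mul_le_mul (by omega) (by omega)
    calc _ ≤ (P.size + P'.size) + (P.size + P'.size) * S.length + 2 * (P.size + P'.size) +
          2 * ((P.r + (P'.r + 1)) * (P.q + P'.q)) := by
          rw [← mul_assoc 2]
          omega
      _ ≤ (P.size + P'.size) + (P.size + P'.size) * S.length + 2 * (P.size + P'.size) +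
          2 * ((P.size + P'.size + 1) * (P.size + P'.size)) := by omega
      _ = _ := by ring

end Protocol

/-! ### LOCC maps -/

section Locc

variable {ι κ μ : Type} [Fintype ι] [Fintype κ] [Fintype μ]

theorem IsCP.comp {Ψ : Matrix κ κ ℂ →ₗ[ℂ] Matrix μ μ ℂ} {Φ : Matrix ι ι ℂ →ₗ[ℂ] Matrix κ κ ℂ}
    (hΨ : IsCP Ψ) (hΦ : IsCP Φ) : IsCP (Ψ ∘ₗ Φ) :=
  fun k X hX => hΨ k (ampl k Φ X) (hΦ k X hX)

theorem IsCP.posSemidef {Φ : Matrix ι ι ℂ →ₗ[ℂ] Matrix κ κ ℂ} (hΦ : IsCP Φ) {X : Matrix ι ι ℂ}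
    (hX : X.PosSemidef) : (Φ X).PosSemidef :=
  (hΦ 1 _ (hX.submatrix (Prod.snd : Fin 1 × ι → ι))).submatrix fun i : κ => ((0 : Fin 1), i)

theorem IsTraceNonincreasing.comp {Ψ : Matrix κ κ ℂ →ₗ[ℂ] Matrix μ μ ℂ}
    {Φ : Matrix ι ι ℂ →ₗ[ℂ] Matrix κ κ ℂ} (hΨ : IsTraceNonincreasing Ψ)
    (hΦ : IsTraceNonincreasing Φ) (hcp : IsCP Φ) : IsTraceNonincreasing (Ψ ∘ₗ Φ) :=
  fun X hX => (hΨ _ (hcp.posSemidef hX)).trans (hΦ X hX)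

theorem IsLOCC.comp {a b a' b' a'' b'' : ℕ} {Λ : Op a' b' →ₗ[ℂ] Op a'' b''}
    {Γ : Op a b →ₗ[ℂ] Op a' b'} (hΛ : IsLOCC Λ) (hΓ : IsLOCC Γ) : IsLOCC (Λ ∘ₗ Γ) := by
  obtain ⟨⟨M, S', W', h', e'⟩, t'⟩ := hΛ
  obtain ⟨⟨N, S, W, h, e⟩, t⟩ := hΓ
  refine ⟨⟨N * M, fun y => S' (finProdFinEquiv.symm y).2 ∘ₗ S (finProdFinEquiv.symm y).1,
    fun y => W' (finProdFinEquiv.symm y).2 ∘ₗ W (finProdFinEquiv.symm y).1,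
    fun y => ?_, fun X Y => ?_⟩, fun X => (t' _).trans (t X)⟩
  · obtain ⟨c1, n1, c2, n2⟩ := h (finProdFinEquiv.symm y).1
    obtain ⟨c1', n1', c2', n2'⟩ := h' (finProdFinEquiv.symm y).2
    exact ⟨c1'.comp c1, n1'.comp n1 c1, c2'.comp c2, n2'.comp n2 c2⟩
  · rw [LinearMap.comp_apply, e, map_sum,
      finProdFinEquiv.symm.sum_comp fun p : Fin N × Fin M =>
        (S' p.2 ∘ₗ S p.1) X ⊗ₖ (W' p.2 ∘ₗ W p.1) Y, Fintype.sum_prod_type]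
    exact Finset.sum_congr rfl fun y _ => e' _ _

/-- `X ↦ A X A†` as a linear map. -/
def conjMap (A : Matrix κ ι ℂ) : Matrix ι ι ℂ →ₗ[ℂ] Matrix κ κ ℂ where
  toFun X := A * X * Aᴴ
  map_add' X Y := by rw [Matrix.mul_add, Matrix.add_mul]
  map_smul' c X := by rw [Matrix.mul_smul, Matrix.smul_mul]; rfl

omit [Fintype κ] in
theorem conjMap_apply (A : Matrix κ ι ℂ) (X : Matrix ι ι ℂ) : conjMap A X = A * X * Aᴴ := rfl

theorem isCP_conjMap (A : Matrix κ ι ℂ) : IsCP (conjMap A) := by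
  classical
  intro k X hX
  have h : ampl k (conjMap A) X = ((1 : Matrix (Fin k) (Fin k) ℂ) ⊗ₖ A) * X *
      ((1 : Matrix (Fin k) (Fin k) ℂ) ⊗ₖ A)ᴴ := by
    ext ⟨x, i⟩ ⟨y, j⟩
    simp only [ampl, conjMap_apply, Matrix.mul_apply, Matrix.of_apply, Fintype.sum_prod_type,
      Matrix.kroneckerMap_apply, Matrix.conjTranspose_apply, Matrix.one_apply, star_mul',
      Finset.sum_mul]
    simp [Finset.sum_ite_eq, apply_ite, ite_mul]
  rw [h]
  exact hX.mul_mul_conjTranspose_same _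

theorem trace_conjMap [DecidableEq ι] {A : Matrix κ ι ℂ} (hA : Aᴴ * A = 1) (X : Matrix ι ι ℂ) :
    (conjMap A X).trace = X.trace := by
  rw [conjMap_apply, Matrix.trace_mul_comm, ← Matrix.mul_assoc, hA, Matrix.one_mul]

/-- A pair of local isometries is an LOCC map. -/
theorem isLOCC_conjMap_kronecker {a b a' b' : ℕ} {A : Matrix (Q a') (Q a) ℂ}
    {B : Matrix (Q b') (Q b) ℂ} (hA : Aᴴ * A = 1) (hB : Bᴴ * B = 1) :
    IsLOCC (conjMap (A ⊗ₖ B) : Op a b →ₗ[ℂ] Op a' b') := by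
  refine ⟨⟨1, fun _ => conjMap A, fun _ => conjMap B, fun _ => ⟨isCP_conjMap A,
    fun X _ => (congrArg Complex.re (trace_conjMap hA X)).le, isCP_conjMap B,
    fun X _ => (congrArg Complex.re (trace_conjMap hB X)).le⟩, fun X Y => ?_⟩,
    trace_conjMap ?_⟩
  · rw [Fin.sum_univ_one, conjMap_apply, Matrix.conjTranspose_kronecker,
      ← Matrix.mul_kronecker_mul, ← Matrix.mul_kronecker_mul]
    rfl
  · rw [Matrix.conjTranspose_kronecker, ← Matrix.mul_kronecker_mul, hA, hB,
      Matrix.one_kronecker_one]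

end Locc

/-! ### Monotonicity under efficient families -/

theorem epr_posSemidef (n : ℕ) : (epr n).PosSemidef :=
  Matrix.posSemidef_vecMulVec_self_star (eprVec n)

/-- Efficient families are closed under composition: the size of the composite is bounded by a
polynomial in the two sizes. -/
theorem IsEfficient.comp {G : GateSet} (hswap : HasSwap G) {nA nB kA kB mA mB : ℕ+ → ℕ+}
    {Λ : ∀ l : ℕ+, Op (kA l) (kB l) →ₗ[ℂ] Op (mA l) (mB l)}
    {Γ : ∀ l : ℕ+, Op (nA l) (nB l) →ₗ[ℂ] Op (kA l) (kB l)}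
    (hΛ : IsEfficient G Λ) (hΓ : IsEfficient G Γ) : IsEfficient G fun l => Λ l ∘ₗ Γ l := by
  obtain ⟨S, z, hS⟩ := hswap
  obtain ⟨hΛ, c', h'⟩ := hΛ
  obtain ⟨hΓ, c, h⟩ := hΓ
  refine ⟨fun l => (hΛ l).comp (hΓ l),
    (c + c') * (2 * (c + c') + Polynomial.C (5 + S.length : ℝ)), fun l => ?_⟩
  obtain ⟨P, hP, hPs⟩ := h l
  obtain ⟨P', hP', hPs'⟩ := h' l
  obtain ⟨R, hR, hRs⟩ := P.exists_comp hS P'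
  refine ⟨R, fun X => by rw [hR, LinearMap.comp_apply, hP, hP'], ?_⟩
  have hRs' : (R.size : ℝ) ≤ (P.size + P'.size) * (2 * (P.size + P'.size) + 5 + S.length) := by
    exact_mod_cast hRs
  refine hRs'.trans ?_
  simp only [Polynomial.eval_mul, Polynomial.eval_add, Polynomial.eval_ofNat, Polynomial.eval_C]
  rw [add_assoc (2 * _)]
  have h0 : (0 : ℝ) ≤ P.size + P'.size := by positivity
  gcongr
  linarith

theorem costAtMost_of_isEfficient {G : GateSet} (hswap : HasSwap G) {ε : ℕ+ → ℝ}
    {nA nB mA mB n : ℕ+ → ℕ+} {ρ : ∀ l : ℕ+, Op (nA l) (nB l)} (hρ : ∀ l, IsState (ρ l))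
    {Λ : ∀ l : ℕ+, Op (nA l) (nB l) →ₗ[ℂ] Op (mA l) (mB l)} (hΛ : IsEfficient G Λ)
    (h : CostAtMost G ε ρ n) : CostAtMost G ε (fun l => Λ l (ρ l)) n := by
  obtain ⟨Γ, hΓ, hε⟩ := h
  refine ⟨fun l => Λ l ∘ₗ Γ l, hΛ.comp hswap hΓ, fun l => (sub_le_sub_left ?_ 1).trans (hε l)⟩
  obtain ⟨_, h⟩ := hΓ.2
  obtain ⟨_, h'⟩ := hΛ.2
  obtain ⟨P, hP, _⟩ := h l
  obtain ⟨P', hP', _⟩ := h' l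
  have hpos : (Γ l (epr (n l))).PosSemidef := by
    rw [hP]
    exact P.isKraus_run.posSemidef (epr_posSemidef _)
  have hK : IsKraus (Λ l) := by
    rw [show (Λ l : Op (nA l) (nB l) → Op (mA l) (mB l)) = P'.run from funext hP']
    exact P'.isKraus_run
  exact hK.fidelity_le (hΛ.1 l).2 hpos (hρ l).1

/-! ### Almost orthogonal vectors -/

section Bessel

/-- Bessel's inequality for unit vectors that are almost orthogonal. -/
theorem sum_norm_inner_sq_le {E I : Type*} [NormedAddCommGroup E] [InnerProductSpace ℂ E]
    (s : Finset I) (v : I → E) {η : ℝ} (hη : 0 ≤ η) (hv : ∀ i ∈ s, ‖v i‖ = 1)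
    (hvv : ∀ i ∈ s, ∀ j ∈ s, i ≠ j → ‖inner ℂ (v i) (v j)‖ ≤ η) (x : E) :
    ∑ i ∈ s, ‖inner ℂ (v i) x‖ ^ 2 ≤ (1 + s.card * η) * ‖x‖ ^ 2 := by
  classical
  set q := ∑ i ∈ s, ‖inner ℂ (v i) x‖ ^ 2 with hq
  set w := ∑ i ∈ s, inner ℂ (v i) x • v i with hw
  have hq0 : 0 ≤ q := Finset.sum_nonneg fun i _ => by positivity
  have h1 : inner ℂ w x = (q : ℂ) := by
    rw [hw, sum_inner, hq, Complex.ofReal_sum]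
    refine Finset.sum_congr rfl fun i _ => ?_
    rw [inner_smul_left, Complex.conj_mul', Complex.ofReal_pow]
  have h2 : q ≤ ‖w‖ * ‖x‖ := by
    have := norm_inner_le_norm (𝕜 := ℂ) w x
    rwa [h1, Complex.norm_real, Real.norm_of_nonneg hq0] at this
  have h3 : ‖w‖ ^ 2 ≤ q * (1 + s.card * η) := by
    have e1 : ‖w‖ ^ 2 = ‖inner ℂ w w‖ := by
      rw [inner_self_eq_norm_sq_to_K, norm_pow]
      simp
    have e2 : inner ℂ w w = ∑ i ∈ s, ∑ j ∈ s,
        (starRingEnd ℂ) (inner ℂ (v i) x) * (inner ℂ (v j) x * inner ℂ (v i) (v j)) := by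
      rw [hw, sum_inner]
      refine Finset.sum_congr rfl fun i _ => ?_
      rw [inner_smul_left, inner_sum, Finset.mul_sum]
      refine Finset.sum_congr rfl fun j _ => ?_
      rw [inner_smul_right]
    rw [e1, e2]
    calc _ ≤ ∑ i ∈ s, ∑ j ∈ s, ((if i = j then ‖inner ℂ (v i) x‖ ^ 2 else 0) +
          η * (‖inner ℂ (v i) x‖ * ‖inner ℂ (v j) x‖)) := by
          refine (norm_sum_le _ _).trans (Finset.sum_le_sum fun i hi => ?_)
          refine (norm_sum_le _ _).trans (Finset.sum_le_sum fun j hj => ?_)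
          rw [norm_mul, norm_mul, RCLike.norm_conj]
          split_ifs with hij
          · subst hij
            rw [inner_self_eq_norm_sq_to_K, hv i hi]
            have : (0 : ℝ) ≤ η * (‖inner ℂ (v i) x‖ * ‖inner ℂ (v i) x‖) := by positivity
            simp
            nlinarith
          · have := hvv i hi j hj hij
            calc _ ≤ ‖inner ℂ (v i) x‖ * (‖inner ℂ (v j) x‖ * η) := by gcongr
              _ = _ := by ring
      _ = q + η * (∑ i ∈ s, ‖inner ℂ (v i) x‖) ^ 2 := by
          simp only [Finset.sum_add_distrib, ← Finset.mul_sum, ← Finset.sum_mul, sq (∑ i ∈ s, _)]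
          congr 1
          refine Finset.sum_congr rfl fun i hi => ?_
          rw [Finset.sum_ite_eq, if_pos hi]
      _ ≤ q + η * (s.card * q) := by
          gcongr
          exact sq_sum_le_card_mul_sum_sq
      _ = _ := by ring
  rcases hq0.eq_or_lt with h0 | h0
  · rw [← h0]
    positivity
  · have h4 : q ^ 2 ≤ (q * (1 + s.card * η)) * ‖x‖ ^ 2 := by
      calc q ^ 2 ≤ (‖w‖ * ‖x‖) ^ 2 := by gcongr
        _ = ‖w‖ ^ 2 * ‖x‖ ^ 2 := by ring
        _ ≤ _ := by gcongr
    nlinarith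

/-- A state cannot have a large overlap with many almost orthogonal pure states. -/
theorem sum_overlap_le {ι I : Type} [Fintype ι] [DecidableEq ι] (s : Finset I) (v : I → ι → ℂ)
    {η : ℝ} (hη : 0 ≤ η) (hv : ∀ i ∈ s, star (v i) ⬝ᵥ v i = 1)
    (hvv : ∀ i ∈ s, ∀ j ∈ s, i ≠ j → ‖star (v i) ⬝ᵥ v j‖ ≤ η) {σ : Matrix ι ι ℂ}
    (hσ : IsState σ) : ∑ i ∈ s, (star (v i) ⬝ᵥ σ *ᵥ v i).re ≤ 1 + s.card * η := by
  obtain ⟨M, rfl⟩ : ∃ M : Matrix ι ι ℂ, σ = Mᴴ * M :=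
    ⟨msqrt σ, by rw [(msqrt_posSemidef hσ.1).isHermitian.eq, msqrt_mul_self hσ.1]⟩
  let V : I → EuclideanSpace ℂ ι := fun i => WithLp.toLp 2 (v i)
  have hin : ∀ (i : I) (y : ι → ℂ), inner ℂ (V i) (WithLp.toLp 2 y) = star (v i) ⬝ᵥ y := by
    intro i y
    rw [EuclideanSpace.inner_eq_star_dotProduct, dotProduct_comm]
  have hV : ∀ i ∈ s, ‖V i‖ = 1 := by
    intro i hi
    have h : ((‖V i‖ : ℝ) : ℂ) ^ 2 = 1 := by
      rw [← hv i hi, ← hin i (v i)]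
      exact (inner_self_eq_norm_sq_to_K (𝕜 := ℂ) (V i)).symm
    have h' : ‖V i‖ ^ 2 = 1 := by exact_mod_cast h
    exact (pow_eq_one_iff_of_nonneg (norm_nonneg _) two_ne_zero).1 h'
  have hbessel := fun k => sum_norm_inner_sq_le s V hη hV
    (fun i hi j hj hij => by rw [hin]; exact hvv i hi j hj hij) (WithLp.toLp 2 (star (M k)))
  have hterm : ∀ i, (star (v i) ⬝ᵥ (Mᴴ * M) *ᵥ v i).re =
      ∑ k, ‖inner ℂ (V i) (WithLp.toLp 2 (star (M k)))‖ ^ 2 := by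
    intro i
    have h1 : star (v i) ⬝ᵥ (Mᴴ * M) *ᵥ v i = star (M *ᵥ v i) ⬝ᵥ (M *ᵥ v i) := by
      rw [Matrix.star_mulVec, ← Matrix.mulVec_mulVec, Matrix.dotProduct_mulVec]
    rw [h1, dotProduct, Complex.re_sum]
    refine Finset.sum_congr rfl fun k _ => ?_
    have h2 : star (v i) ⬝ᵥ star (M k) = star ((M *ᵥ v i) k) := by
      rw [Matrix.mulVec, Matrix.star_dotProduct_star, dotProduct_comm]
    rw [hin, h2, norm_star, Pi.star_apply, RCLike.star_def, Complex.conj_mul']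
    norm_cast
  have htr : ∑ k, ‖(WithLp.toLp 2 (star (M k)) : EuclideanSpace ℂ ι)‖ ^ 2 = 1 := by
    have h := congrArg Complex.re hσ.2
    rw [Matrix.trace_mul_comm] at h
    rw [← Complex.one_re, ← h, Matrix.trace, Complex.re_sum]
    refine Finset.sum_congr rfl fun k _ => ?_
    rw [EuclideanSpace.norm_sq_eq, Matrix.diag_apply, Matrix.mul_apply, Complex.re_sum]
    refine Finset.sum_congr rfl fun j _ => ?_
    rw [Matrix.conjTranspose_apply, RCLike.star_def, Complex.mul_conj']
    simp only [Pi.star_apply, norm_star]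
    norm_cast
  calc _ = ∑ k, ∑ i ∈ s, ‖inner ℂ (V i) (WithLp.toLp 2 (star (M k)))‖ ^ 2 := by
        rw [Finset.sum_comm]
        exact Finset.sum_congr rfl fun i _ => hterm i
    _ ≤ ∑ k, (1 + s.card * η) * ‖(WithLp.toLp 2 (star (M k)) : EuclideanSpace ℂ ι)‖ ^ 2 :=
        Finset.sum_le_sum fun k _ => hbessel k
    _ = 1 + s.card * η := by rw [← Finset.mul_sum, htr, mul_one]

end Bessel

/-! ### EPR pairs acted on by permutations -/

section Perm

variable {n : ℕ}

/-- The unitary that permutes the computational basis. -/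
def permUnitary {ι : Type} [Fintype ι] [DecidableEq ι] (π : Equiv.Perm ι) :
    Matrix.unitaryGroup ι ℂ :=
  ⟨Matrix.of fun a b => if a = π b then 1 else 0, by
    rw [Matrix.mem_unitaryGroup_iff']
    ext a b
    simp [Matrix.mul_apply, Matrix.one_apply, eq_comm]⟩

/-- The amplitudes of `n` EPR pairs after Alice has permuted her computational basis. -/
def permVec (π : Equiv.Perm (Q n)) (x : Q n × Q n) : ℂ :=
  if x.1 = π x.2 then (((1 / Real.sqrt 2) ^ n : ℝ) : ℂ) else 0

/-- The EPR pairs themselves belong to the identity permutation. -/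
theorem eprVec_eq : eprVec n = permVec 1 := by
  funext x
  rw [eprVec, permVec]
  split_ifs with h
  · have h' : x.1 = x.2 := h
    simp [h']
  · obtain ⟨i, hi⟩ : ∃ i, x.1 i ≠ x.2 i := by
      by_contra hne
      push Not at hne
      exact h (funext hne)
    exact Finset.prod_eq_zero (Finset.mem_univ i) (if_neg hi)

theorem permUnitary_epr (π : Equiv.Perm (Q n)) :
    conjMap ((permUnitary π).1 ⊗ₖ (1 : Matrix (Q n) (Q n) ℂ)) (epr n) =
      Matrix.vecMulVec (permVec π) (star (permVec π)) := by
  have h : ((permUnitary π).1 ⊗ₖ (1 : Matrix (Q n) (Q n) ℂ)) *ᵥ eprVec n = permVec π := by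
    funext x
    rw [eprVec_eq, Matrix.mulVec, dotProduct, Fintype.sum_prod_type]
    simp [permUnitary, permVec, Matrix.one_apply, Matrix.kroneckerMap_apply]
  have he : epr n = Matrix.vecMulVec (eprVec n) (star (eprVec n)) := rfl
  rw [he, conjMap_apply, Matrix.mul_vecMulVec, Matrix.vecMulVec_mul, h, ← Matrix.star_mulVec, h]

/-- The overlap of two permuted EPR states is the fraction of basis labels on which the permutations
agree. -/
theorem permVec_dotProduct (π τ : Equiv.Perm (Q n)) :
    star (permVec π) ⬝ᵥ permVec τ =
      (((Finset.univ.filter fun b => π b = τ b).card : ℝ) / 2 ^ n : ℝ) := by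
  have hc : (((1 / Real.sqrt 2) ^ n : ℝ)) * (1 / Real.sqrt 2) ^ n = 1 / 2 ^ n := by
    rw [← mul_pow]
    simp [← mul_inv]
  rw [dotProduct, Fintype.sum_prod_type_right]
  have h : ∀ b, ∑ a, star (permVec π) (a, b) * permVec τ (a, b) =
      if π b = τ b then ((1 / 2 ^ n : ℝ) : ℂ) else 0 := by
    intro b
    rw [Finset.sum_eq_single (π b)]
    · rw [Pi.star_apply, permVec, permVec, if_pos rfl]
      split_ifs
      · rw [← hc, Complex.ofReal_mul, RCLike.star_def, Complex.conj_ofReal]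
      · simp
    · intro a _ ha
      rw [Pi.star_apply, permVec, if_neg ha, star_zero, zero_mul]
    · simp
  simp only [h]
  rw [← Finset.sum_filter, Finset.sum_const, nsmul_eq_mul]
  push_cast
  ring

theorem permVec_self (π : Equiv.Perm (Q n)) : star (permVec π) ⬝ᵥ permVec π = 1 := by
  rw [permVec_dotProduct]
  simp

theorem norm_permVec_le_one (π : Equiv.Perm (Q n)) (x : Q n × Q n) : ‖permVec π x‖ ≤ 1 := by
  rw [permVec]
  split_ifs
  · rw [Complex.norm_real, Real.norm_of_nonneg (by positivity)]
    refine pow_le_one₀ (by positivity) ?_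
    rw [div_le_one (by positivity)]
    exact Real.one_le_sqrt.2 (by norm_num)
  · simp

/-- There are many permutations of the computational basis of which any two agree rarely: the maps
`(x, y) ↦ (x, y + f x)`, where `f` is a polynomial with `D` coefficients over the field with `2 ^ m`
elements. -/
theorem exists_perm_family {m : ℕ} (hm : m ≠ 0) (D : ℕ) :
    ∃ π : (Fin D → Fin (2 ^ m)) → Equiv.Perm (Q (m + m)), ∀ f g, f ≠ g →
      ‖star (permVec (π f)) ⬝ᵥ permVec (π g)‖ ≤ D / 2 ^ m := by
  classical
  have : Fact (Nat.Prime 2) := ⟨Nat.prime_two⟩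
  let F := GaloisField 2 m
  have : Fintype F := Fintype.ofFinite F
  have hF : Fintype.card F = 2 ^ m := by
    rw [← Nat.card_eq_fintype_card]
    exact GaloisField.card 2 m hm
  let e : Fin (2 ^ m) ≃ F := Fintype.equivOfCardEq (by rw [hF, Fintype.card_fin])
  let E : Q (m + m) ≃ F × F := Fintype.equivOfCardEq (by
    rw [Fintype.card_prod, hF]
    simp [pow_add])
  let pol : (Fin D → Fin (2 ^ m)) → Polynomial F := fun f =>
    ∑ i : Fin D, Polynomial.C (e (f i)) * Polynomial.X ^ (i : ℕ)
  let sh : (F → F) → Equiv.Perm (F × F) := fun h =>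
    { toFun := fun p => (p.1, p.2 + h p.1)
      invFun := fun p => (p.1, p.2 - h p.1)
      left_inv := fun p => by simp
      right_inv := fun p => by simp }
  refine ⟨fun f => (E.trans (sh fun x => (pol f).eval x)).trans E.symm, fun f g hfg => ?_⟩
  rw [permVec_dotProduct, Complex.norm_real, Real.norm_of_nonneg (by positivity)]
  have hcoef : ∀ f (i : Fin D), (pol f).coeff i = e (f i) := by
    intro f i
    simp [pol, Polynomial.coeff_C_mul, Polynomial.coeff_X_pow,
      Fin.val_inj]
  have hne : pol f - pol g ≠ 0 := by
    intro h
    refine hfg (funext fun i => e.injective ?_)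
    rw [← hcoef, ← hcoef, sub_eq_zero.1 h]
  have hdeg : (pol f - pol g).natDegree ≤ D := by
    have hp : ∀ f, (pol f).natDegree ≤ D := fun f =>
      Polynomial.natDegree_sum_le_of_forall_le _ _ fun i _ =>
        (Polynomial.natDegree_C_mul_X_pow_le _ _).trans i.2.le
    exact (Polynomial.natDegree_sub_le _ _).trans (max_le (hp f) (hp g))
  have hcard : (Finset.univ.filter fun b : Q (m + m) =>
      ((E.trans (sh fun x => (pol f).eval x)).trans E.symm) b =
        ((E.trans (sh fun x => (pol g).eval x)).trans E.symm) b).card ≤ D * 2 ^ m := by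
    calc _ ≤ ((pol f - pol g).roots.toFinset ×ˢ (Finset.univ : Finset F)).card := by
          refine Finset.card_le_card_of_injOn E (fun b hb => ?_) E.injective.injOn
          have h1 := (Finset.mem_filter.1 hb).2
          have h2 := congrArg Prod.snd (E.symm.injective h1)
          have h3 : (E b).2 + (pol f).eval (E b).1 = (E b).2 + (pol g).eval (E b).1 := h2
          simp only [Finset.coe_product, Set.mem_prod, Finset.mem_coe, Multiset.mem_toFinset,
            Polynomial.mem_roots hne, Polynomial.IsRoot, Polynomial.eval_sub, Finset.mem_univ,
            and_true]
          exact sub_eq_zero.2 (add_left_cancel h3)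
      _ ≤ D * 2 ^ m := by
          rw [Finset.card_product, Finset.card_univ, hF]
          gcongr
          exact (Multiset.toFinset_card_le _).trans ((Polynomial.card_roots' _).trans hdeg)
  rw [div_le_div_iff₀ (by positivity) (by positivity), pow_add, ← mul_assoc]
  gcongr
  exact_mod_cast hcard

end Perm

/-! ### Stability of protocols under small changes of the gates -/

section Frobenius

open scoped Matrix.Norms.Frobenius

variable {ι κ : Type} [Fintype ι] [Fintype κ]

theorem norm_sq_eq_sum (A : Matrix ι κ ℂ) : ‖A‖ ^ 2 = ∑ i, ∑ j, ‖A i j‖ ^ 2 := by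
  rw [Matrix.frobenius_norm_def, ← Real.sqrt_eq_rpow, Real.sq_sqrt (by positivity)]
  simp only [Real.rpow_two]

theorem norm_le_norm_of_entry {A B : Matrix ι κ ℂ} (h : ∀ i j, ‖A i j‖ ≤ ‖B i j‖) : ‖A‖ ≤ ‖B‖ := by
  refine le_of_sq_le_sq ?_ (norm_nonneg _)
  rw [norm_sq_eq_sum, norm_sq_eq_sum]
  gcongr with i _ j _
  exact h i j

theorem norm_entry_le (A : Matrix ι κ ℂ) (i : ι) (j : κ) : ‖A i j‖ ≤ ‖A‖ := by
  refine le_of_sq_le_sq ?_ (norm_nonneg _)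
  rw [norm_sq_eq_sum]
  exact (Finset.single_le_sum (f := fun j => ‖A i j‖ ^ 2) (fun _ _ => by positivity)
    (Finset.mem_univ j)).trans (Finset.single_le_sum (f := fun i => ∑ j, ‖A i j‖ ^ 2)
      (fun _ _ => by positivity) (Finset.mem_univ i))

theorem norm_le_card_mul {A : Matrix ι ι ℂ} {c : ℝ} (hc : 0 ≤ c) (h : ∀ i j, ‖A i j‖ ≤ c) :
    ‖A‖ ≤ Fintype.card ι * c := by
  refine le_of_sq_le_sq ?_ (by positivity)
  rw [norm_sq_eq_sum]
  calc _ ≤ ∑ _i : ι, ∑ _j : ι, c ^ 2 := by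
        gcongr with i _ j _
        exact h i j
    _ = _ := by
        simp
        ring

/-- The change of `U σ U†` under a change of `U` by `a` and of `σ` by `e`. The crude bound `D` on
the norm of a unitary, in place of `1` for the operator norm, is enough. -/
theorem norm_conj_sub_le {U U' σ σ' : Matrix ι ι ℂ} {D B a e : ℝ} (hD : 0 ≤ D) (hU : ‖U‖ ≤ D)
    (hU' : ‖U'‖ ≤ D) (ha : ‖U - U'‖ ≤ a) (hσ : ‖σ‖ ≤ B) (hσ' : ‖σ'‖ ≤ B) (he : ‖σ - σ'‖ ≤ e) :
    ‖U * σ * Uᴴ - U' * σ' * U'ᴴ‖ ≤ D ^ 2 * e + 2 * D * B * a := by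
  have hB : 0 ≤ B := (norm_nonneg _).trans hσ
  have ha0 : 0 ≤ a := (norm_nonneg _).trans ha
  have he0 : 0 ≤ e := (norm_nonneg _).trans he
  have h : U * σ * Uᴴ - U' * σ' * U'ᴴ =
      (U - U') * σ * Uᴴ + U' * (σ - σ') * Uᴴ + U' * σ' * (U - U')ᴴ := by
    rw [Matrix.conjTranspose_sub]
    noncomm_ring
  rw [h]
  calc _ ≤ ‖U - U'‖ * ‖σ‖ * ‖Uᴴ‖ + ‖U'‖ * ‖σ - σ'‖ * ‖Uᴴ‖ + ‖U'‖ * ‖σ'‖ * ‖(U - U')ᴴ‖ := by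
        refine (norm_add₃_le).trans (add_le_add (add_le_add ?_ ?_) ?_)
        all_goals
          refine (Matrix.frobenius_norm_mul _ _).trans ?_
          gcongr
          exact Matrix.frobenius_norm_mul _ _
    _ ≤ a * B * D + D * e * D + D * B * a := by
        rw [Matrix.frobenius_norm_conjTranspose, Matrix.frobenius_norm_conjTranspose]
        gcongr
    _ = _ := by ring

theorem norm_conj_le {U σ : Matrix ι ι ℂ} {D B : ℝ} (hU : ‖U‖ ≤ D) (hσ : ‖σ‖ ≤ B) :
    ‖U * σ * Uᴴ‖ ≤ D ^ 2 * B := by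
  have hD : 0 ≤ D := (norm_nonneg _).trans hU
  have hB : 0 ≤ B := (norm_nonneg _).trans hσ
  calc _ ≤ ‖U‖ * ‖σ‖ * ‖Uᴴ‖ := by
        refine (Matrix.frobenius_norm_mul _ _).trans ?_
        gcongr
        exact Matrix.frobenius_norm_mul _ _
    _ ≤ D * B * D := by
        rw [Matrix.frobenius_norm_conjTranspose]
        gcongr
    _ = _ := by ring

end Frobenius

section Stability

open scoped Matrix.Norms.Frobenius

variable {G : GateSet} {W V : Type}

/-- Two placed gates are `κ`-close if their operators differ by at most `κ` in every entry. -/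
def CloseGate (κ : ℝ) (g g' : PlacedGate G W) : Prop :=
  ∀ {V : Type} (f : W ↪ V) (x y : Bits V),
    ‖gateOp (g.wires.trans f) (g.gate : Matrix _ _ ℂ) x y -
      gateOp (g'.wires.trans f) (g'.gate : Matrix _ _ ℂ) x y‖ ≤ κ

/-- Two circuits are `κ`-close if they agree gate by gate up to `κ`. -/
abbrev CloseCircuit (κ : ℝ) : Circuit G W → Circuit G W → Prop := List.Forall₂ (CloseGate κ)

variable [Fintype V] [DecidableEq V]

theorem norm_le_of_mem_unitaryGroup {ι : Type} [Fintype ι] [DecidableEq ι] {U : Matrix ι ι ℂ}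
    (hU : U ∈ Matrix.unitaryGroup ι ℂ) : ‖U‖ ≤ Fintype.card ι := by
  simpa using norm_le_card_mul zero_le_one fun i j => entry_norm_bound_of_unitary hU i j

theorem norm_circuitOp_sub_le {κ : ℝ} (hκ : 0 ≤ κ) (f : W ↪ V) {C C' : Circuit G W}
    (h : CloseCircuit κ C C') :
    ‖circuitOp f C - circuitOp f C'‖ ≤
      C.length * (Fintype.card (Bits V) : ℝ) ^ (C.length + 1) * κ := by
  set D : ℝ := (Fintype.card (Bits V) : ℝ) with hD
  have hD1 : 1 ≤ D := by
    rw [hD]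
    exact_mod_cast Fintype.card_pos
  induction h with
  | nil => simp
  | @cons g g' C C' hg _ ih =>
    have h1 : circuitOp f (g :: C) - circuitOp f (g' :: C') =
        (circuitOp f C - circuitOp f C') * gateOp (g.wires.trans f) (g.gate : Matrix _ _ ℂ) +
          circuitOp f C' * (gateOp (g.wires.trans f) (g.gate : Matrix _ _ ℂ) -
            gateOp (g'.wires.trans f) (g'.gate : Matrix _ _ ℂ)) := by
      change circuitOp f C * _ - circuitOp f C' * _ = _
      noncomm_ring
    have h2 : ‖gateOp (g.wires.trans f) (g.gate : Matrix _ _ ℂ)‖ ≤ D := by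
      have := norm_le_of_mem_unitaryGroup (circuitOp_mem_unitaryGroup f [g])
      rwa [← hD, show circuitOp f [g] = 1 * gateOp (g.wires.trans f) (g.gate : Matrix _ _ ℂ)
        from rfl, one_mul] at this
    have h3 := norm_le_card_mul (A := gateOp (g.wires.trans f) (g.gate : Matrix _ _ ℂ) -
            gateOp (g'.wires.trans f) (g'.gate : Matrix _ _ ℂ)) hκ fun x y => hg f x y
    have h4 := norm_le_of_mem_unitaryGroup (circuitOp_mem_unitaryGroup f C')
    rw [← hD] at h3 h4
    rw [h1]
    calc _ ≤ ‖circuitOp f C - circuitOp f C'‖ *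
          ‖gateOp (g.wires.trans f) (g.gate : Matrix _ _ ℂ)‖ + ‖circuitOp f C'‖ *
          ‖gateOp (g.wires.trans f) (g.gate : Matrix _ _ ℂ) -
            gateOp (g'.wires.trans f) (g'.gate : Matrix _ _ ℂ)‖ :=
          (norm_add_le _ _).trans (add_le_add (Matrix.frobenius_norm_mul _ _)
            (Matrix.frobenius_norm_mul _ _))
      _ ≤ C.length * D ^ (C.length + 1) * κ * D + D ^ (C.length + 2) * κ := by
          refine add_le_add (by gcongr) ?_
          calc _ ≤ D * (D * κ) := by gcongr
            _ = D ^ 2 * κ := by ring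
            _ ≤ _ := by
              gcongr
              omega
      _ = _ := by
          rw [List.length_cons]
          push_cast
          ring

variable {A B C : Type} [Fintype A] [DecidableEq A] [Fintype B] [DecidableEq B] [Fintype C]
  [DecidableEq C]

omit [DecidableEq A] [DecidableEq B] [DecidableEq C] [Fintype A] [Fintype B] [Fintype C] in
theorem measure_sub (σ τ : Matrix (Bits (A ⊕ B ⊕ C)) (Bits (A ⊕ B ⊕ C)) ℂ) :
    measure σ - measure τ = measure (σ - τ) := by
  ext x y
  simp only [measure, Matrix.sub_apply, Matrix.of_apply]
  split_ifs <;> simp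

theorem norm_measure_le (σ : Matrix (Bits (A ⊕ B ⊕ C)) (Bits (A ⊕ B ⊕ C)) ℂ) :
    ‖measure σ‖ ≤ ‖σ‖ := by
  refine norm_le_norm_of_entry fun x y => ?_
  simp only [measure, Matrix.of_apply]
  split_ifs <;> simp

/-- Two rounds of circuits with at most `S` gates are `κ`-close. -/
def CloseRound (S : ℕ) (κ : ℝ) (p p' : Round G A B C) : Prop :=
  (CloseCircuit κ p.1 p'.1 ∧ p.1.length ≤ S) ∧ CloseCircuit κ p.2 p'.2 ∧ p.2.length ≤ S

/-- Close rounds have close effects. In each round the bound `M` on the operators and the error `e`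
grow by a factor `D ^ 4`, and the two circuits, each of which changes by at most `a`, add at most
`4 * D ^ 4 * M * a` to the error. -/
theorem norm_exec_sub_le {S : ℕ} {κ : ℝ} (hκ : 0 ≤ κ) {L L' : List (Round G A B C)}
    (h : List.Forall₂ (CloseRound S κ) L L') {D M e a : ℝ}
    (hD : D = Fintype.card (Bits (A ⊕ B ⊕ C))) (ha : a = S * D ^ (S + 1) * κ)
    {σ σ' : Matrix (Bits (A ⊕ B ⊕ C)) (Bits (A ⊕ B ⊕ C)) ℂ} (hσ : ‖σ‖ ≤ M) (hσ' : ‖σ'‖ ≤ M)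
    (he : ‖σ - σ'‖ ≤ e) :
    ‖exec L σ - exec L' σ'‖ ≤ D ^ (4 * L.length) * (e + 4 * L.length * M * a) := by
  have hD1 : 1 ≤ D := by
    rw [hD]
    exact_mod_cast Fintype.card_pos
  have ha0 : 0 ≤ a := by rw [ha]; positivity
  have hM0 : 0 ≤ M := (norm_nonneg _).trans hσ
  induction h generalizing σ σ' M e with
  | nil => simpa [exec] using he
  | @cons p p' L L' hp _ ih =>
    have hclose : ∀ {W : Type} (f : W ↪ A ⊕ B ⊕ C) {E E' : Circuit G W}, CloseCircuit κ E E' →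
        E.length ≤ S → ‖circuitOp f E - circuitOp f E'‖ ≤ a := by
      intro W f E E' hE hl
      refine (norm_circuitOp_sub_le hκ f hE).trans ?_
      rw [ha, ← hD]
      gcongr
    have hu : ∀ {W : Type} (f : W ↪ A ⊕ B ⊕ C) (E : Circuit G W), ‖circuitOp f E‖ ≤ D :=
      fun f E => hD ▸ norm_le_of_mem_unitaryGroup (circuitOp_mem_unitaryGroup f E)
    obtain ⟨⟨hA, hAl⟩, hB, hBl⟩ := hp
    have hD0 : 0 ≤ D := by linarith
    have s1 := norm_conj_sub_le hD0 (hu (aliceEmb A B C) p.1) (hu _ p'.1) (hclose _ hA hAl)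
      hσ hσ' he
    have n1 := (norm_measure_le _).trans (norm_conj_le (hu (aliceEmb A B C) p.1) hσ)
    have n1' := (norm_measure_le _).trans (norm_conj_le (hu (aliceEmb A B C) p'.1) hσ')
    have s2 := (norm_measure_le _).trans s1
    rw [← measure_sub] at s2
    have s3 := norm_conj_sub_le hD0 (hu (bobEmb A B C) p.2) (hu _ p'.2) (hclose _ hB hBl)
      n1 n1' s2
    have s4 := (norm_measure_le _).trans s3
    rw [← measure_sub] at s4
    have n2 := (norm_measure_le _).trans (norm_conj_le (hu (bobEmb A B C) p.2) n1)
    have n2' := (norm_measure_le _).trans (norm_conj_le (hu (bobEmb A B C) p'.2) n1')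
    have := ih n2 n2' s4 (by positivity)
    refine this.trans ?_
    rw [List.length_cons]
    have h34 : D ^ 3 ≤ D ^ 4 := pow_le_pow_right₀ hD1 (by norm_num)
    calc _ = D ^ (4 * L.length) * (D ^ 4 * e + D ^ 3 * (4 * M * a) +
          D ^ 4 * (4 * L.length * M * a)) := by ring
      _ ≤ D ^ (4 * L.length) * (D ^ 4 * e + D ^ 4 * (4 * M * a) +
          D ^ 4 * (4 * L.length * M * a)) := by gcongr
      _ = _ := by
          push_cast
          ring

end Stability

section RunClose

open scoped Matrix.Norms.Frobenius

theorem norm_dotProduct_mulVec_le {ι : Type} [Fintype ι] {v : ι → ℂ} (hv : ∀ i, ‖v i‖ ≤ 1)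
    {A : Matrix ι ι ℂ} {c : ℝ} (hA : ∀ i j, ‖A i j‖ ≤ c) :
    ‖star v ⬝ᵥ A *ᵥ v‖ ≤ (Fintype.card ι : ℝ) ^ 2 * c := by
  have hterm : ∀ i j, ‖A i j * v j‖ ≤ c := fun i j => by
    rw [norm_mul]
    have := mul_le_mul (hA i j) (hv j) (norm_nonneg _) ((norm_nonneg _).trans (hA i j))
    rwa [mul_one] at this
  have hrow : ∀ i, ‖star v i * (A *ᵥ v) i‖ ≤ Fintype.card ι * c := fun i => by
    rw [norm_mul, Pi.star_apply, norm_star]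
    refine (mul_le_of_le_one_left (norm_nonneg _) (hv i)).trans ?_
    refine (norm_sum_le _ _).trans ((Finset.sum_le_sum fun j _ => hterm i j).trans ?_)
    simp
  refine (norm_sum_le _ _).trans ((Finset.sum_le_sum fun i _ => hrow i).trans (le_of_eq ?_))
  simp
  ring

/-- A register is a subregister and the rest, so the size of each divides that of the whole. -/
theorem card_bits_eq {W V : Type} [Fintype W] [DecidableEq W] [Fintype V] [DecidableEq V]
    (f : W ↪ V) :
    Fintype.card (Bits V) = Fintype.card (Bits W) * Fintype.card (Bits (Off f)) := by
  rw [← Fintype.card_prod]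
  exact (Fintype.card_congr (splitEquiv f)).symm

namespace Protocol

variable {G : GateSet} {nA nB mA mB : ℕ}

/-- Protocols with close gates have close outputs. -/
theorem norm_run_sub_le {tA tB q : ℕ} (hq : 0 < q) (hA : mA ≤ nA + tA) (hB : mB ≤ nB + tB)
    {L L' : List (Round G (Fin (nA + tA)) (Fin (nB + tB)) (Fin q))} {S : ℕ} {κ : ℝ} (hκ : 0 ≤ κ)
    (h : List.Forall₂ (CloseRound S κ) L L') (hL : L.length ≤ S) {X : Op nA nB}
    (hX : ∀ i j, ‖X i j‖ ≤ 1) {v : Q mA × Q mB → ℂ} (hv : ∀ i, ‖v i‖ ≤ 1) :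
    ‖star v ⬝ᵥ (ofRounds hq hA hB L).run X *ᵥ v - star v ⬝ᵥ (ofRounds hq hA hB L').run X *ᵥ v‖ ≤
      4 * S ^ 2 * ((2 : ℝ) ^ (nA + tA + (nB + tB) + q)) ^ (5 * S + 5) * κ := by
  set D : ℝ := (2 : ℝ) ^ (nA + tA + (nB + tB) + q) with hD
  have hD1 : 1 ≤ D := one_le_pow₀ (by norm_num)
  have hcard : D = Fintype.card (Bits (Fin (nA + tA) ⊕ Fin (nB + tB) ⊕ Fin q)) := by
    simp [hD, add_assoc]
  set f := outEmb hA hB q with hf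
  have hsplit := card_bits_eq f
  have hcW : (Fintype.card (Q mA × Q mB) : ℝ) ≤ D := by
    have h1 : Fintype.card (Q mA × Q mB) = Fintype.card (Bits (Fin mA ⊕ Fin mB)) := by
      simp [pow_add]
    rw [h1, hcard]
    exact_mod_cast Nat.le_of_dvd Fintype.card_pos ⟨_, hsplit⟩
  have hcO : (Fintype.card (Bits (Off f)) : ℝ) ≤ D := by
    rw [hcard]
    exact_mod_cast Nat.le_of_dvd Fintype.card_pos ⟨_, hsplit.trans (mul_comm _ _)⟩
  set σ := ext (inEmb nA nB tA tB q) (flat X) with hσ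
  have hσ1 : ∀ x y, ‖σ x y‖ ≤ 1 := by
    intro x y
    simp only [hσ, ext, Matrix.of_apply]
    split_ifs
    · exact hX _ _
    · simp
  have hσn : ‖σ‖ ≤ D := by
    have := norm_le_card_mul zero_le_one hσ1
    rwa [← hcard, mul_one] at this
  have hexec := norm_exec_sub_le hκ h hcard rfl hσn hσn (e := 0) (by simp)
  have hexec' : ‖exec L σ - exec L' σ‖ ≤ 4 * S ^ 2 * D ^ (5 * S + 2) * κ := by
    refine hexec.trans ?_
    calc _ ≤ D ^ (4 * S) * (0 + 4 * S * D * (S * D ^ (S + 1) * κ)) := by gcongr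
      _ = _ := by ring
  have hentry : ∀ a b, ‖((ofRounds hq hA hB L).run X - (ofRounds hq hA hB L').run X) a b‖ ≤
      D * (4 * S ^ 2 * D ^ (5 * S + 2) * κ) := by
    intro a b
    rw [Matrix.sub_apply, run_ofRounds, run_ofRounds]
    simp only [unflat, ptrace, Matrix.of_apply]
    rw [← Finset.sum_sub_distrib]
    refine (norm_sum_le _ _).trans ((Finset.sum_le_sum fun z _ =>
      (norm_entry_le (exec L σ - exec L' σ) _ _).trans hexec').trans ?_)
    rw [Finset.sum_const, nsmul_eq_mul, Finset.card_univ]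
    gcongr
  rw [← dotProduct_sub, ← Matrix.sub_mulVec]
  refine (norm_dotProduct_mulVec_le hv hentry).trans ?_
  calc _ ≤ D ^ 2 * (D * (4 * S ^ 2 * D ^ (5 * S + 2) * κ)) := by gcongr
    _ = _ := by ring

end Protocol

end RunClose

/-! ### Encoding protocols up to a rounding of their gates -/

section Codes

/-- A list as a function on `Fin S`, with its entries encoded by `f`; entries beyond the first `S`
are lost, and `none` marks the end of the list. -/
def listCode {α β : Type} (S : ℕ) (f : α → β) (L : List α) : Fin S → Option β :=
  fun j => (L[j.1]?).map f

theorem forall₂_of_listCode_eq {α β : Type} {S : ℕ} {f : α → β} {L L' : List α}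
    (hL : L.length ≤ S) (hL' : L'.length ≤ S) (h : listCode S f L = listCode S f L') :
    List.Forall₂ (fun a b => f a = f b) L L' := by
  have hlen : L.length = L'.length := by
    by_contra hne
    rcases Nat.lt_or_gt_of_ne hne with hlt | hlt
    · have := congrFun h ⟨L.length, by omega⟩
      simp [listCode, hlt] at this
    · have := congrFun h ⟨L'.length, by omega⟩
      simp [listCode, hlt] at this
  refine List.forall₂_iff_get.2 ⟨hlen, fun i h1 h2 => ?_⟩
  have := congrFun h ⟨i, by omega⟩
  simpa [listCode, h1, h2] using this

/-- A number in `[-1, 1]`, rounded down to a multiple of `1 / R` and shifted by `1`. -/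
def roundCode (R : ℕ) (x : ℝ) : Fin (2 * R + 1) := Fin.ofNat _ (⌊x * R⌋ + R).toNat

theorem abs_sub_le_of_roundCode_eq {R : ℕ} (hR : 0 < R) {x y : ℝ} (hx : |x| ≤ 1) (hy : |y| ≤ 1)
    (h : roundCode R x = roundCode R y) : |x - y| ≤ 1 / R := by
  have hR' : (0 : ℝ) < R := by exact_mod_cast hR
  have hbound : ∀ {x : ℝ}, |x| ≤ 1 → 0 ≤ ⌊x * R⌋ + R ∧ ⌊x * R⌋ + R < (2 * R + 1 : ℤ) := by
    intro x hx
    obtain ⟨h1, h2⟩ := abs_le.1 hx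
    have h3 : -(R : ℤ) ≤ ⌊x * R⌋ := Int.le_floor.2 (by push_cast; nlinarith)
    have h4 : ⌊x * R⌋ ≤ (R : ℤ) := by
      have := Int.floor_le (x * R)
      have h5 : (⌊x * R⌋ : ℝ) ≤ R := by nlinarith
      exact_mod_cast h5
    omega
  have hx' := hbound hx
  have hy' := hbound hy
  have hfloor : ⌊x * R⌋ = ⌊y * R⌋ := by
    have h1 := congrArg Fin.val h
    simp only [roundCode, Fin.val_ofNat] at h1
    rw [Nat.mod_eq_of_lt (by omega), Nat.mod_eq_of_lt (by omega)] at h1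
    omega
  have h2 := Int.abs_sub_lt_one_of_floor_eq_floor hfloor
  rw [← sub_mul, abs_mul, abs_of_pos hR'] at h2
  rw [le_div_iff₀ hR']
  exact h2.le

/-- The finite data that determine a placed gate up to a rounding of its matrix entries: the arity
(at most `K`), the numbers of its wires (at most `N`) and the rounded entries. -/
abbrev GateCode (K N R : ℕ) : Type :=
  Fin (K + 1) × (Fin K → Fin (N + 1)) × (Q K × Q K → Fin (2 * R + 1) × Fin (2 * R + 1))

variable {G : GateSet} {K N R : ℕ} {W : Type}

/-- The code of a placed gate; the wires are numbered by `enc`. The wires beyond the arity get the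
number `0`, and a matrix on fewer than `K` qubits is read off on the first qubits. -/
def gateCode (hK : ∀ k, (G k).Nonempty → k ≤ K) (R : ℕ) (enc : W → Fin (N + 1))
    (g : PlacedGate G W) : GateCode K N R :=
  have h : g.arity ≤ K := hK _ ⟨_, g.gate_mem⟩
  (⟨g.arity, Nat.lt_succ_of_le h⟩,
    fun j => if hj : j.1 < g.arity then enc (g.wires ⟨j.1, hj⟩) else 0,
    fun p => (roundCode R (g.gate.1 (p.1 ∘ Fin.castLE h) (p.2 ∘ Fin.castLE h)).re,
      roundCode R (g.gate.1 (p.1 ∘ Fin.castLE h) (p.2 ∘ Fin.castLE h)).im))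

theorem closeGate_of_gateCode_eq (hK : ∀ k, (G k).Nonempty → k ≤ K) (hR : 0 < R)
    {enc : W → Fin (N + 1)} (henc : Function.Injective enc) {g g' : PlacedGate G W}
    (h : gateCode hK R enc g = gateCode hK R enc g') : CloseGate (2 / R) g g' := by
  obtain ⟨k, u, hu, e⟩ := g
  obtain ⟨k', u', hu', e'⟩ := g'
  obtain ⟨h1, h23⟩ := Prod.ext_iff.1 h
  obtain ⟨h2, h3⟩ := Prod.ext_iff.1 h23
  obtain rfl : k = k' := congrArg Fin.val h1
  have hk : k ≤ K := hK _ ⟨_, hu⟩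
  have he : e = e' := by
    ext j
    have := congrFun h2 ⟨j.1, by omega⟩
    simp only [gateCode, j.2, dif_pos] at this
    exact henc this
  subst he
  have hent : ∀ a b : Q k, ‖u.1 a b - u'.1 a b‖ ≤ 2 / R := by
    intro a b
    have hex : ∀ c : Q k, ∃ x : Q K, x ∘ Fin.castLE hk = c := fun c =>
      ⟨fun i => if hi : i.1 < k then c ⟨i.1, hi⟩ else 0, by
        funext i
        simp⟩
    obtain ⟨x, rfl⟩ := hex a
    obtain ⟨y, rfl⟩ := hex b
    have h4 := Prod.ext_iff.1 (congrFun h3 (x, y))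
    have hre : ∀ w : Matrix.unitaryGroup (Q k) ℂ, ∀ i j, |(w.1 i j).re| ≤ 1 := fun w i j =>
      (Complex.abs_re_le_norm _).trans (entry_norm_bound_of_unitary w.2 i j)
    have him : ∀ w : Matrix.unitaryGroup (Q k) ℂ, ∀ i j, |(w.1 i j).im| ≤ 1 := fun w i j =>
      (Complex.abs_im_le_norm _).trans (entry_norm_bound_of_unitary w.2 i j)
    have h5 := abs_sub_le_of_roundCode_eq hR (hre _ _ _) (hre _ _ _) h4.1
    have h6 := abs_sub_le_of_roundCode_eq hR (him _ _ _) (him _ _ _) h4.2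
    refine (Complex.norm_le_abs_re_add_abs_im _).trans ?_
    rw [Complex.sub_re, Complex.sub_im]
    calc _ ≤ 1 / (R : ℝ) + 1 / R := add_le_add h5 h6
      _ = _ := by ring
  intro V f x y
  simp only [gateOp, Matrix.of_apply]
  split_ifs
  · exact hent _ _
  · rw [sub_zero, norm_zero]
    positivity

/-- The number of a qubit among Alice's (or Bob's) `a` qubits and the communication qubits. -/
def wireCode (N : ℕ) {a q : ℕ} : Fin a ⊕ Fin q → Fin (N + 1) :=
  Sum.elim (fun i => Fin.ofNat _ i.1) fun i => Fin.ofNat _ (a + i.1)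

theorem wireCode_injective {N a q : ℕ} (h : a + q ≤ N) :
    Function.Injective (wireCode N : Fin a ⊕ Fin q → Fin (N + 1)) := by
  rintro (i | i) (j | j) hij
  all_goals
    have h1 := congrArg Fin.val hij
    simp only [wireCode, Sum.elim_inl, Sum.elim_inr, Fin.val_ofNat] at h1
    rw [Nat.mod_eq_of_lt (by omega), Nat.mod_eq_of_lt (by omega)] at h1
  · exact congrArg Sum.inl (Fin.ext h1)
  · omega
  · omega
  · exact congrArg Sum.inr (Fin.ext (by omega))

/-- The finite data that determine a protocol of size at most `S` up to a rounding of its gates: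
the sizes of the two ancilla registers and of the communication register, and the codes of the
rounds. -/
abbrev ProtocolCode (K N R S : ℕ) : Type :=
  (Fin (S + 1) × Fin (S + 1) × Fin (S + 1)) ×
    (Fin S → Option ((Fin S → Option (GateCode K N R)) × (Fin S → Option (GateCode K N R))))

variable {nA nB mA mB : ℕ}

/-- The code of a protocol. The reductions modulo `S + 1` and `N + 1` that are part of `Fin.ofNat`
are without effect for protocols of size at most `S` if `N` is large enough. -/
def protocolCode (hK : ∀ k, (G k).Nonempty → k ≤ K) (N R S : ℕ) (P : Protocol G nA nB mA mB) :
    ProtocolCode K N R S :=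
  ((Fin.ofNat _ P.tA, Fin.ofNat _ P.tB, Fin.ofNat _ P.q),
    listCode S (fun p => (listCode S (gateCode hK R (wireCode N)) p.1,
      listCode S (gateCode hK R (wireCode N)) p.2)) P.rounds)

namespace Protocol

theorem ofRounds_rounds (P : Protocol G nA nB mA mB) :
    ∀ X, P.run X = (ofRounds P.q_pos P.outA P.outB P.rounds).run X := by
  intro X
  rw [run_ofRounds, run_eq]
  rfl

theorem length_rounds_le_size (P : Protocol G nA nB mA mB) : P.rounds.length ≤ P.size := by
  have h : P.rounds.length = P.r := by simp [rounds]
  have hq := P.q_pos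
  have : P.r ≤ 2 * P.r * P.q := by nlinarith
  rw [h, size]
  omega

theorem length_le_size_of_mem_rounds (P : Protocol G nA nB mA mB)
    {p : Round G (Fin (nA + P.tA)) (Fin (nB + P.tB)) (Fin P.q)} (hp : p ∈ P.rounds) :
    p.1.length + p.2.length ≤ P.size := by
  have := List.single_le_sum (fun _ _ => Nat.zero_le _) _
    (List.mem_map_of_mem (f := fun p : Round G _ _ _ => p.1.length + p.2.length) hp)
  rw [P.size_eq]
  omega

/-- The estimate of `norm_run_sub_le_of_code_eq` in terms of the sizes of the registers and the list
of rounds; the equations between the sizes are hypotheses here so that they can be substituted. -/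
theorem norm_run_sub_le_of_listCode_eq (hK : ∀ k, (G k).Nonempty → k ≤ K) {S : ℕ} (hR : 0 < R)
    {tA tB q tA' tB' q' : ℕ} (eA : tA = tA') (eB : tB = tB') (eq : q = q')
    (oA : mA ≤ nA + tA) (oB : mB ≤ nB + tB) (oA' : mA ≤ nA + tA') (oB' : mB ≤ nB + tB')
    (hq : 0 < q) (hq' : 0 < q') {L : List (Round G (Fin (nA + tA)) (Fin (nB + tB)) (Fin q))}
    {L' : List (Round G (Fin (nA + tA')) (Fin (nB + tB')) (Fin q'))}
    (hNA : nA + tA + q ≤ N) (hNB : nB + tB + q ≤ N) (hw : tA + tB + q ≤ S)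
    (hl : L.length ≤ S) (hl' : L'.length ≤ S) (hm : ∀ p ∈ L, p.1.length + p.2.length ≤ S)
    (hm' : ∀ p ∈ L', p.1.length + p.2.length ≤ S)
    (h : listCode S (fun p : Round G (Fin (nA + tA)) (Fin (nB + tB)) (Fin q) =>
        (listCode S (gateCode hK R (wireCode N)) p.1,
          listCode S (gateCode hK R (wireCode N)) p.2)) L =
      listCode S (fun p => (listCode S (gateCode hK R (wireCode N)) p.1,
        listCode S (gateCode hK R (wireCode N)) p.2)) L')
    {X : Op nA nB} (hX : ∀ i j, ‖X i j‖ ≤ 1) {v : Q mA × Q mB → ℂ} (hv : ∀ i, ‖v i‖ ≤ 1) :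
    ‖star v ⬝ᵥ (ofRounds hq oA oB L).run X *ᵥ v -
        star v ⬝ᵥ (ofRounds hq' oA' oB' L').run X *ᵥ v‖ ≤
      4 * S ^ 2 * ((2 : ℝ) ^ (nA + nB + S)) ^ (5 * S + 5) * (2 / R) := by
  subst eA eB eq
  have hfor := forall₂_of_listCode_eq hl hl' h
  have hclose : List.Forall₂ (CloseRound S (2 / R)) L L' := by
    refine List.forall₂_iff_get.2 ⟨hfor.length_eq, fun i h1 h2 => ?_⟩
    have hi := (List.forall₂_iff_get.1 hfor).2 i h1 h2
    obtain ⟨hi1, hi2⟩ := Prod.ext_iff.1 hi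
    have b := hm _ (List.get_mem L ⟨i, h1⟩)
    have b' := hm' _ (List.get_mem L' ⟨i, h2⟩)
    have hA : CloseCircuit (2 / R) (L.get ⟨i, h1⟩).1 (L'.get ⟨i, h2⟩).1 :=
      List.Forall₂.imp (S := CloseGate (2 / R)) (fun _ _ h V =>
        closeGate_of_gateCode_eq hK hR (wireCode_injective hNA) h (V := V))
        (forall₂_of_listCode_eq (by omega) (by omega) hi1)
    have hB : CloseCircuit (2 / R) (L.get ⟨i, h1⟩).2 (L'.get ⟨i, h2⟩).2 :=
      List.Forall₂.imp (S := CloseGate (2 / R)) (fun _ _ h V =>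
        closeGate_of_gateCode_eq hK hR (wireCode_injective hNB) h (V := V))
        (forall₂_of_listCode_eq (by omega) (by omega) hi2)
    exact ⟨⟨hA, by omega⟩, hB, by omega⟩
  refine (norm_run_sub_le hq oA oB (by positivity) hclose hl hX hv).trans ?_
  have hD : (2 : ℝ) ^ (nA + tA + (nB + tB) + q) ≤ 2 ^ (nA + nB + S) :=
    pow_le_pow_right₀ (by norm_num) (by omega)
  exact mul_le_mul_of_nonneg_right (mul_le_mul_of_nonneg_left
    (pow_le_pow_left₀ (by positivity) hD _) (by positivity)) (by positivity)

/-- Protocols with the same code have close outputs. -/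
theorem norm_run_sub_le_of_code_eq (hK : ∀ k, (G k).Nonempty → k ≤ K) {S : ℕ} (hR : 0 < R)
    (hNA : nA + 2 * S ≤ N) (hNB : nB + 2 * S ≤ N) {P P' : Protocol G nA nB mA mB}
    (hP : P.size ≤ S) (hP' : P'.size ≤ S)
    (h : protocolCode hK N R S P = protocolCode hK N R S P') {X : Op nA nB}
    (hX : ∀ i j, ‖X i j‖ ≤ 1) {v : Q mA × Q mB → ℂ} (hv : ∀ i, ‖v i‖ ≤ 1) :
    ‖star v ⬝ᵥ P.run X *ᵥ v - star v ⬝ᵥ P'.run X *ᵥ v‖ ≤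
      4 * S ^ 2 * ((2 : ℝ) ^ (nA + nB + S)) ^ (5 * S + 5) * (2 / R) := by
  obtain ⟨h1, h2⟩ := Prod.ext_iff.1 h
  obtain ⟨hA, hBq⟩ := Prod.ext_iff.1 h1
  obtain ⟨hB, hq⟩ := Prod.ext_iff.1 hBq
  have hmod : ∀ {a b : ℕ}, a ≤ S → b ≤ S → Fin.ofNat (S + 1) a = Fin.ofNat (S + 1) b → a = b := by
    intro a b ha hb hab
    have h3 := congrArg Fin.val hab
    simp only [Fin.val_ofNat] at h3
    rwa [Nat.mod_eq_of_lt (by omega), Nat.mod_eq_of_lt (by omega)] at h3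
  have hs := P.size_eq
  have hs' := P'.size_eq
  rw [P.ofRounds_rounds, P'.ofRounds_rounds]
  exact norm_run_sub_le_of_listCode_eq hK hR (hmod (by omega) (by omega) hA)
    (hmod (by omega) (by omega) hB) (hmod (by omega) (by omega) hq) P.outA P.outB P'.outA P'.outB
    P.q_pos P'.q_pos (by omega) (by omega) (by omega) (P.length_rounds_le_size.trans hP)
    (P'.length_rounds_le_size.trans hP')
    (fun p hp => (P.length_le_size_of_mem_rounds hp).trans hP)
    (fun p hp => (P'.length_le_size_of_mem_rounds hp).trans hP') h2 hX hv

end Protocol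

end Codes

/-! ### Counting protocols -/

section Counting

-- The finiteness of `ProtocolCode` is found through a long chain of products and function types.
set_option synthInstance.maxSize 1000

/-- With `2 ^ S ^ 3` rounding steps, which make the rounding errors negligible, the number of codes
is still only exponential in a polynomial in `S`. A gate has fewer than `2 ^ S ^ 5` codes, a round
at most `2 ^ (2 * S ^ 6)`, and there are at most `S` rounds. -/
theorem card_protocolCode_le {K N S : ℕ} (hS : 20 ≤ S) (hK : 2 * 4 ^ K + K ≤ S)
    (hN : N + 1 ≤ 4 * S) :
    Fintype.card (ProtocolCode K N (2 ^ S ^ 3) S) ≤ 2 ^ (2 * S ^ 7 + 4 * S) := by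
  have hS2 : 20 * S ≤ S ^ 2 := by nlinarith
  have hS3 : 20 * S ^ 2 ≤ S ^ 3 := by rw [pow_succ S 2]; nlinarith
  have hS4 : 20 * S ^ 3 ≤ S ^ 4 := by rw [pow_succ S 3]; nlinarith [pow_pos (by omega : 0 < S) 3]
  have hS5 : 20 * S ^ 4 ≤ S ^ 5 := by rw [pow_succ S 4]; nlinarith [pow_pos (by omega : 0 < S) 4]
  have hSlt : S + 1 ≤ 2 ^ S := Nat.lt_two_pow_self
  have h4S : 4 * S ≤ 2 ^ (S + 2) := by
    rw [pow_add]
    omega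
  have hgate : Fintype.card (GateCode K N (2 ^ S ^ 3)) ≤ 2 ^ (S ^ 5 - 1) := by
    have h1 : K + 1 ≤ 2 ^ K := Nat.lt_two_pow_self
    have h2 : (N + 1) ^ K ≤ 2 ^ ((S + 2) * K) := by
      rw [pow_mul]
      exact Nat.pow_le_pow_left (hN.trans h4S) K
    have h3 : 2 * 2 ^ S ^ 3 + 1 ≤ 2 ^ (S ^ 3 + 2) := by
      have := Nat.one_le_two_pow (n := S ^ 3)
      rw [pow_add]
      omega
    have h4 : ((2 * 2 ^ S ^ 3 + 1) * (2 * 2 ^ S ^ 3 + 1)) ^ (2 ^ K * 2 ^ K) ≤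
        2 ^ ((S ^ 3 + 2) * (2 * 4 ^ K)) := by
      have h5 : 2 * 4 ^ K = 2 * (2 ^ K * 2 ^ K) := by
        rw [← mul_pow]
        norm_num
      rw [h5, ← sq, ← pow_mul, pow_mul 2 (S ^ 3 + 2)]
      exact Nat.pow_le_pow_left h3 _
    have hcard : Fintype.card (GateCode K N (2 ^ S ^ 3)) = (K + 1) * ((N + 1) ^ K *
        ((2 * 2 ^ S ^ 3 + 1) * (2 * 2 ^ S ^ 3 + 1)) ^ (2 ^ K * 2 ^ K)) := by
      simp
    rw [hcard]
    calc _ ≤ 2 ^ K * (2 ^ ((S + 2) * K) * 2 ^ ((S ^ 3 + 2) * (2 * 4 ^ K))) :=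
          Nat.mul_le_mul h1 (Nat.mul_le_mul h2 h4)
      _ = 2 ^ (K + ((S + 2) * K + (S ^ 3 + 2) * (2 * 4 ^ K))) := by
          rw [pow_add, pow_add]
      _ ≤ _ := by
          refine Nat.pow_le_pow_right (by norm_num) ?_
          have h6 : (S + 2) * K ≤ (S + 2) * S := Nat.mul_le_mul_left _ (by omega)
          have h7 : (S ^ 3 + 2) * (2 * 4 ^ K) ≤ (S ^ 3 + 2) * S := Nat.mul_le_mul_left _ (by omega)
          have h8 : (S + 2) * S = S ^ 2 + 2 * S := by ring
          have h9 : (S ^ 3 + 2) * S = S ^ 4 + 2 * S := by ring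
          omega
  have hopt : Fintype.card (GateCode K N (2 ^ S ^ 3)) + 1 ≤ 2 ^ S ^ 5 := by
    have h1 : 2 ^ S ^ 5 = 2 ^ (S ^ 5 - 1) * 2 := by
      rw [← pow_succ]
      congr 1
      omega
    have := Nat.one_le_two_pow (n := S ^ 5 - 1)
    omega
  have hcard : Fintype.card (ProtocolCode K N (2 ^ S ^ 3) S) =
      ((S + 1) * ((S + 1) * (S + 1))) *
        ((Fintype.card (GateCode K N (2 ^ S ^ 3)) + 1) ^ S *
          (Fintype.card (GateCode K N (2 ^ S ^ 3)) + 1) ^ S + 1) ^ S := by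
    rw [Fintype.card_prod, Fintype.card_prod, Fintype.card_prod, Fintype.card_fun,
      Fintype.card_option, Fintype.card_prod, Fintype.card_fun, Fintype.card_option,
      Fintype.card_fin, Fintype.card_fin]
  rw [hcard]
  have hin : (Fintype.card (GateCode K N (2 ^ S ^ 3)) + 1) ^ S *
          (Fintype.card (GateCode K N (2 ^ S ^ 3)) + 1) ^ S + 1 ≤ 2 ^ (2 * S ^ 6 + 1) := by
    have h1 : (Fintype.card (GateCode K N (2 ^ S ^ 3)) + 1) ^ S ≤ 2 ^ S ^ 6 := by
      refine (Nat.pow_le_pow_left hopt S).trans (le_of_eq ?_)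
      rw [← pow_mul, ← pow_succ]
    have h2 := Nat.mul_le_mul h1 h1
    have h3 := Nat.one_le_two_pow (n := 2 * S ^ 6)
    have h4 : 2 ^ S ^ 6 * 2 ^ S ^ 6 = 2 ^ (2 * S ^ 6) := by rw [← pow_add, two_mul]
    rw [pow_succ 2 (2 * S ^ 6)]
    omega
  calc _ ≤ (2 ^ S * (2 ^ S * 2 ^ S)) * (2 ^ (2 * S ^ 6 + 1)) ^ S :=
        Nat.mul_le_mul (Nat.mul_le_mul hSlt (Nat.mul_le_mul hSlt hSlt)) (Nat.pow_le_pow_left hin S)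
    _ = 2 ^ (2 * S ^ 7 + 4 * S) := by
        rw [← pow_mul, ← pow_add, ← pow_add, ← pow_add]
        congr 1
        ring

/-- The error bound of `Protocol.norm_run_sub_le_of_code_eq` on `n + n` qubits with `2 ^ S ^ 3`
rounding steps. -/
theorem gate_rounding_error_le {n S : ℕ} (hS : 20 ≤ S) (hn : n ≤ S) :
    4 * (S : ℝ) ^ 2 * ((2 : ℝ) ^ (n + n + S)) ^ (5 * S + 5) * (2 / ((2 ^ S ^ 3 : ℕ) : ℝ)) ≤
      1 / S := by
  have hS2 : 20 * S ≤ S ^ 2 := by nlinarith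
  have hS3 : 20 * S ^ 2 ≤ S ^ 3 := by rw [pow_succ S 2]; nlinarith
  have hSr : (0 : ℝ) < S := by exact_mod_cast (by omega : 0 < S)
  have hlt : (S : ℝ) ≤ 2 ^ S := by exact_mod_cast (Nat.lt_two_pow_self (n := S)).le
  rw [Nat.cast_pow, Nat.cast_ofNat, mul_div_assoc', div_le_div_iff₀ (by positivity) hSr, one_mul]
  calc 4 * (S : ℝ) ^ 2 * ((2 : ℝ) ^ (n + n + S)) ^ (5 * S + 5) * 2 * S
      ≤ 4 * ((2 : ℝ) ^ S) ^ 2 * ((2 : ℝ) ^ (3 * S)) ^ (5 * S + 5) * 2 * 2 ^ S := by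
        gcongr
        · norm_num
        · omega
    _ = 2 ^ (15 * S ^ 2 + 18 * S + 3) := by
        rw [← pow_mul, ← pow_mul]
        have h4 : (4 : ℝ) = 2 ^ 2 := by norm_num
        rw [h4, ← pow_add, ← pow_add, ← pow_succ, ← pow_add]
        congr 1
        ring
    _ ≤ 2 ^ S ^ 3 := pow_le_pow_right₀ (by norm_num) (by omega)

theorem norm_epr_le_one (n : ℕ) (x y : Q n × Q n) : ‖epr n x y‖ ≤ 1 := by
  change ‖eprVec n x * star (eprVec n y)‖ ≤ 1
  rw [norm_mul, norm_star, eprVec_eq]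
  exact mul_le_one₀ (norm_permVec_le_one _ _) (norm_nonneg _) (norm_permVec_le_one _ _)

theorem isState_epr (n : ℕ) : IsState (epr n) := by
  refine ⟨epr_posSemidef n, ?_⟩
  have he : epr n = Matrix.vecMulVec (eprVec n) (star (eprVec n)) := rfl
  rw [he, Matrix.trace_vecMulVec, dotProduct_comm, eprVec_eq, permVec_self]

theorem twenty_mul_le_two_pow {l : ℕ} (hl : 8 ≤ l) : 20 * l ≤ 2 ^ l := by
  induction l, hl using Nat.le_induction with
  | base => norm_num
  | succ l hl ih =>
    rw [pow_succ]
    omega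

/-- For large `l`, some permutation of Alice's computational basis cannot be carried out, even with
fidelity `δ`, by a protocol of size `2 ^ l`. There are more permutations in the family of
`exists_perm_family` than codes of such protocols. If each of them could be carried out, then many
would be carried out by protocols with the same code, hence with nearly the same output; this output
would overlap with many almost orthogonal states. -/
theorem exists_hard_perm {G : GateSet} {K : ℕ} (hK : ∀ k, (G k).Nonempty → k ≤ K) {δ : ℝ}
    (hδ : 0 < δ) : ∃ l₀ : ℕ, ∀ l, l₀ ≤ l → ∃ π : Equiv.Perm (Q (10 * l + 10 * l)),
      ∀ P : Protocol G (10 * l + 10 * l) (10 * l + 10 * l) (10 * l + 10 * l) (10 * l + 10 * l),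
        P.size ≤ 2 ^ l → IsState (P.run (epr (10 * l + 10 * l))) →
          fidelity (P.run (epr (10 * l + 10 * l)))
            (Matrix.vecMulVec (permVec π) (star (permVec π))) < δ := by
  classical
  refine ⟨20 + (2 * 4 ^ K + K) + ⌈4 / δ⌉₊, fun l hl => ?_⟩
  -- The family has `D = S ^ 9` coefficients over the field with `2 ^ (10 * l) = S ^ 10` elements.
  -- So the overlaps are at most `1 / S`, and there are at least `2 ^ S ^ 9` permutations, more than
  -- `⌈4 / δ⌉` times the number of codes of protocols, which is at most `2 ^ (2 * S ^ 7 + 4 * S)`.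
  set S := 2 ^ l with hS
  have hlS : l < S := Nat.lt_two_pow_self
  have hnS : 10 * l + 10 * l ≤ S := by
    have := twenty_mul_le_two_pow (l := l) (by omega)
    omega
  set n := 10 * l + 10 * l with hn
  have hS20 : 20 ≤ S := by omega
  have hSr : (0 : ℝ) < S := by exact_mod_cast (by omega : 0 < S)
  obtain ⟨π, hπ⟩ := exists_perm_family (m := 10 * l) (by omega) (S ^ 9)
  by_contra! hcon
  choose P hPs hPst hPF using fun f => hcon (π f)
  -- A bound for the number of qubits that Alice or Bob can reach with a protocol of size `S`.
  let N := n + 2 * S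
  let code : (Fin (S ^ 9) → Fin (2 ^ (10 * l))) → ProtocolCode K N (2 ^ S ^ 3) S :=
    fun f => protocolCode hK N (2 ^ S ^ 3) S (P f)
  have hcount : Fintype.card (ProtocolCode K N (2 ^ S ^ 3) S) * ⌈4 / δ⌉₊ <
      Fintype.card (Fin (S ^ 9) → Fin (2 ^ (10 * l))) := by
    have h1 := card_protocolCode_le (K := K) (N := N) hS20 (by omega) (by omega)
    have h2 : ⌈4 / δ⌉₊ ≤ 2 ^ S := le_trans (by omega) (Nat.lt_two_pow_self (n := S)).le
    have h7 : S ^ 9 = S ^ 7 * S ^ 2 := by ring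
    have h8 : 20 * S ≤ S ^ 2 := by nlinarith
    have h9 : S ≤ S ^ 7 := Nat.le_self_pow (by norm_num) S
    calc _ ≤ 2 ^ (2 * S ^ 7 + 4 * S) * 2 ^ S := Nat.mul_le_mul h1 h2
      _ = 2 ^ (2 * S ^ 7 + 5 * S) := by
          rw [← pow_add]
          congr 1
          ring
      _ < 2 ^ S ^ 9 := Nat.pow_lt_pow_right (by norm_num) (by nlinarith)
      _ ≤ (2 ^ (10 * l)) ^ S ^ 9 := Nat.pow_le_pow_left (Nat.le_self_pow (by omega) 2) _
      _ = _ := by simp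
  obtain ⟨y, hy⟩ := Fintype.exists_lt_card_fiber_of_mul_lt_card code hcount
  set s := Finset.univ.filter fun f => code f = y with hs
  obtain ⟨f₀, hf₀⟩ := Finset.card_pos.1 (by omega : 0 < s.card)
  have hf₀' : code f₀ = y := (Finset.mem_filter.1 hf₀).2
  have hSδ : 1 / (S : ℝ) ≤ δ / 4 := by
    have h1 : 4 / δ ≤ S := (Nat.le_ceil _).trans (by exact_mod_cast (by omega : ⌈4 / δ⌉₊ ≤ S))
    rw [div_le_iff₀ hδ] at h1
    rw [div_le_div_iff₀ hSr (by norm_num)]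
    linarith
  have hoverlap : ∀ f ∈ s,
      δ / 2 ≤ (star (permVec (π f)) ⬝ᵥ (P f₀).run (epr n) *ᵥ permVec (π f)).re := by
    intro f hf
    have hcode : code f = code f₀ := (Finset.mem_filter.1 hf).2.trans hf₀'.symm
    have h1 := Protocol.norm_run_sub_le_of_code_eq hK (by positivity) (by omega) (by omega)
      (hPs f) (hPs f₀) hcode (norm_epr_le_one n) (norm_permVec_le_one (π f))
    have h2 := hPF f
    rw [fidelity_pure (hPst f).1 (permVec_self _)] at h2
    have h3 := (Complex.abs_re_le_norm _).trans (h1.trans (gate_rounding_error_le hS20 hnS))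
    rw [Complex.sub_re] at h3
    have h4 := (abs_le.1 h3).2
    linarith
  have hη : (0 : ℝ) ≤ 1 / S := by positivity
  have hsum := sum_overlap_le s (fun f => permVec (π f)) hη (fun f _ => permVec_self _)
    (fun f _ g _ hfg => (hπ f g hfg).trans (by
      have hpow : (2 : ℝ) ^ (10 * l) = S ^ 10 := by
        rw [hS, mul_comm, pow_mul]
        push_cast
        rfl
      rw [hpow, Nat.cast_pow, div_le_div_iff₀ (by positivity) hSr]
      apply le_of_eq
      ring)) (hPst f₀)
  -- More than `4 / δ` states with overlap `δ / 2` contradict the bound `1 + s.card / S` on the sum.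
  have hlow : s.card * (δ / 2) ≤
      ∑ f ∈ s, (star (permVec (π f)) ⬝ᵥ (P f₀).run (epr n) *ᵥ permVec (π f)).re := by
    rw [← nsmul_eq_mul]
    exact Finset.card_nsmul_le_sum _ _ _ hoverlap
  have hc : 4 / δ < s.card :=
    (Nat.le_ceil _).trans_lt (by exact_mod_cast hy)
  rw [div_lt_iff₀ hδ] at hc
  have h5 : (s.card : ℝ) * (1 / S) ≤ s.card * (δ / 4) := by gcongr
  linarith

end Counting

/-! ### Failure of monotonicity -/

section Failure

theorem ptrace_ext_self {W V : Type} [Fintype V] (f : W ↪ V)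
    (σ : Matrix (Bits W) (Bits W) ℂ) : ptrace f (ext f σ) = σ := by
  ext a b
  simp [ptrace, ext_merge]

/-- The protocol without gates, from `n + n` qubits to the same qubits. -/
def idProtocol (G : GateSet) (n : ℕ) : Protocol G n n n n :=
  Protocol.ofRounds (tA := 0) (tB := 0) Nat.one_pos le_rfl le_rfl []

theorem run_idProtocol (G : GateSet) (n : ℕ) (X : Op n n) : (idProtocol G n).run X = X := by
  have h : Protocol.outEmb (le_refl (n + 0)) (le_refl (n + 0)) 1 = Protocol.inEmb n n 0 0 1 := by
    ext (i | i) <;> rfl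
  rw [idProtocol, Protocol.run_ofRounds, h]
  exact (congrArg unflat (ptrace_ext_self _ _)).trans (unflat_flat X)

theorem size_idProtocol (G : GateSet) (n : ℕ) : (idProtocol G n).size = 1 := by
  rw [idProtocol, Protocol.size_ofRounds]
  rfl

/-- EPR pairs can be had, without error, from the same number of EPR pairs by doing nothing. The
LOCC channel is written as conjugation with `1 ⊗ 1`. -/
theorem costAtMost_epr (G : GateSet) {ε : ℕ+ → ℝ} (hε : ∀ l, 0 ≤ ε l) (n : ℕ+ → ℕ+) :
    CostAtMost G ε (fun l => epr (n l)) n := by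
  have hid : ∀ (n : ℕ) (X : Op n n),
      conjMap ((1 : Matrix (Q n) (Q n) ℂ) ⊗ₖ (1 : Matrix (Q n) (Q n) ℂ)) X = X := by
    intro n X
    rw [Matrix.one_kronecker_one, conjMap_apply, Matrix.conjTranspose_one, Matrix.one_mul,
      Matrix.mul_one]
  refine ⟨fun l => conjMap ((1 : Matrix (Q (n l)) (Q (n l)) ℂ) ⊗ₖ 1),
    ⟨fun l => isLOCC_conjMap_kronecker (by simp) (by simp), Polynomial.C 1, fun l =>
      ⟨idProtocol G (n l), fun X => ?_, ?_⟩⟩, fun l => ?_⟩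
  · rw [hid, run_idProtocol]
  · simp [size_idProtocol]
  · beta_reduce
    rw [hid, fidelity_self (isState_epr _), sub_self]
    exact hε l

/-- A polynomial is eventually below `2 ^ l`. -/
theorem eventually_eval_le_two_pow (c : Polynomial ℝ) :
    ∃ l₁ : ℕ, ∀ l : ℕ, l₁ ≤ l → c.eval (l : ℝ) ≤ 2 ^ l := by
  have h : (fun l : ℕ => c.eval (l : ℝ)) =o[Filter.atTop] fun l : ℕ => (2 : ℝ) ^ l := by
    induction c using Polynomial.induction_on' with
    | add p q hp hq => simpa using hp.add hq
    | monomial k a =>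
      simpa using (isLittleO_pow_const_const_pow_of_one_lt (R := ℝ) k one_lt_two).const_mul_left a
  obtain ⟨l₁, hl₁⟩ := Filter.eventually_atTop.1 (h.bound one_pos)
  refine ⟨l₁, fun l hl => (le_abs_self _).trans ?_⟩
  simpa using hl₁ l hl

/-- For a suitable choice of permutations, one for each `l`, Alice's permutation of `20 l` EPR pairs
cannot be carried out efficiently with error `ε`. -/
theorem not_monotone {G : GateSet} (harity : BoundedArity G) {ε : ℕ+ → ℝ}
    (hε : ∀ l, ε l ∈ Set.Icc (0 : ℝ) 1) (hlim : ¬ Filter.Tendsto ε Filter.atTop (nhds 1)) :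
    ∃ (n : ℕ+ → ℕ+) (π : ∀ l : ℕ+, Equiv.Perm (Q (n l))), IsPolynomial n ∧
      ¬ CostAtMost G ε (fun l => conjMap ((permUnitary (π l)).1 ⊗ₖ
        (1 : Matrix (Q (n l)) (Q (n l)) ℂ)) (epr (n l))) n := by
  obtain ⟨K, hK⟩ := harity
  obtain ⟨δ, hδ, hfreq⟩ : ∃ δ > 0, ∀ N : ℕ+, ∃ l ≥ N, ε l ≤ 1 - δ := by
    rw [Metric.tendsto_atTop] at hlim
    push Not at hlim
    obtain ⟨δ, hδ, h⟩ := hlim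
    refine ⟨δ, hδ, fun N => ?_⟩
    obtain ⟨l, hl, hd⟩ := h N
    refine ⟨l, hl, ?_⟩
    rw [Real.dist_eq, abs_of_nonpos (by linarith [(hε l).2])] at hd
    linarith
  obtain ⟨l₀, hl₀⟩ := exists_hard_perm hK hδ
  let n : ℕ+ → ℕ+ := fun l => ⟨10 * l + 10 * l, by have := l.pos; omega⟩
  have hhard : ∀ l : ℕ+, ∃ π : Equiv.Perm (Q (n l)), l₀ ≤ l →
      ∀ P : Protocol G (n l) (n l) (n l) (n l), P.size ≤ 2 ^ (l : ℕ) →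
        IsState (P.run (epr (n l))) → fidelity (P.run (epr (n l)))
          (Matrix.vecMulVec (permVec π) (star (permVec π))) < δ := by
    intro l
    by_cases h : l₀ ≤ l
    · obtain ⟨π, hπ⟩ := hl₀ l h
      exact ⟨π, fun _ => hπ⟩
    · exact ⟨1, fun h' => absurd h' h⟩
  choose π hπ using hhard
  refine ⟨n, π, ⟨Polynomial.C 20 * Polynomial.X, fun l => ?_⟩, ?_⟩
  · simp only [n, PNat.mk_coe, Polynomial.eval_mul, Polynomial.eval_C, Polynomial.eval_X]
    push_cast
    ring
  · rintro ⟨Γ, ⟨hΓ, c, hc⟩, hF⟩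
    obtain ⟨l₁, hl₁⟩ := eventually_eval_le_two_pow c
    obtain ⟨l, hl, hεl⟩ := hfreq ⟨l₀ + l₁ + 1, by omega⟩
    have hl' : l₀ + l₁ + 1 ≤ (l : ℕ) := hl
    obtain ⟨P, hP, hPs⟩ := hc l
    have hsize : P.size ≤ 2 ^ (l : ℕ) := by
      have := hPs.trans (hl₁ l (by omega))
      exact_mod_cast this
    have hstate : IsState (P.run (epr (n l))) := by
      refine ⟨P.isKraus_run.posSemidef (epr_posSemidef _), ?_⟩
      rw [← hP, (hΓ l).2, (isState_epr _).2]
    have h1 := hπ l (by omega) P hsize hstate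
    have h2 := hF l
    beta_reduce at h2
    rw [hP, permUnitary_epr] at h2
    linarith

end Failure

end CompEnt

end

theorem mainTheorem7 (G : CompEnt.GateSet) (hswap : CompEnt.HasSwap G)
    (harity : CompEnt.BoundedArity G) :
    -- monotonicity under efficient families of LOCC channels
    (∀ (ε : ℕ+ → ℝ) (_ : ∀ l, ε l ∈ Set.Icc (0 : ℝ) 1) (nA nB mA mB n : ℕ+ → ℕ+)
        (ρ : ∀ l : ℕ+, CompEnt.Op (nA l) (nB l)) (_ : ∀ l, CompEnt.IsState (ρ l))
        (Λ : ∀ l : ℕ+, CompEnt.Op (nA l) (nB l) →ₗ[ℂ] CompEnt.Op (mA l) (mB l))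
        (_ : CompEnt.IsEfficient G Λ),
      CompEnt.CostAtMost G ε ρ n → CompEnt.CostAtMost G ε (fun l => Λ l (ρ l)) n) ∧
    -- failure of monotonicity under general families, already for local unitary channels
    (∀ (ε : ℕ+ → ℝ) (_ : ∀ l, ε l ∈ Set.Icc (0 : ℝ) 1)
        (_ : ¬ Filter.Tendsto ε Filter.atTop (nhds 1)),
      ∃ (nA nB n : ℕ+ → ℕ+) (ρ : ∀ l : ℕ+, CompEnt.Op (nA l) (nB l))
        (Λ : ∀ l : ℕ+, CompEnt.Op (nA l) (nB l) →ₗ[ℂ] CompEnt.Op (nA l) (nB l))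
        (U : ∀ l : ℕ+, Matrix.unitaryGroup (CompEnt.Q (nA l)) ℂ)
        (V : ∀ l : ℕ+, Matrix.unitaryGroup (CompEnt.Q (nB l)) ℂ),
        CompEnt.IsPolynomial nA ∧ CompEnt.IsPolynomial nB ∧
        (∀ l, CompEnt.IsState (ρ l)) ∧
        (∀ l, CompEnt.IsLOCC (Λ l)) ∧
        (∀ l X, Λ l X = Matrix.kroneckerMap (· * ·) (U l).1 (V l).1 * X *
          (Matrix.kroneckerMap (· * ·) (U l).1 (V l).1).conjTranspose) ∧
        CompEnt.CostAtMost G ε ρ n ∧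
        ¬ CompEnt.CostAtMost G ε (fun l => Λ l (ρ l)) n) := by
  refine ⟨fun ε _ nA nB mA mB n ρ hρ Λ hΛ h => CompEnt.costAtMost_of_isEfficient hswap hρ hΛ h,
    fun ε hε hlim => ?_⟩
  obtain ⟨n, π, hn, hnot⟩ := CompEnt.not_monotone harity hε hlim
  refine ⟨n, n, n, fun l => CompEnt.epr (n l),
    fun l => CompEnt.conjMap (Matrix.kroneckerMap (· * ·) (CompEnt.permUnitary (π l)).1 1),
    fun l => CompEnt.permUnitary (π l), fun _ => 1, hn, hn, fun l => CompEnt.isState_epr _,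
    fun l => CompEnt.isLOCC_conjMap_kronecker ?_ (by simp), fun l X => rfl,
    CompEnt.costAtMost_epr G (fun l => (hε l).1) n, hnot⟩
  exact Matrix.mem_unitaryGroup_iff'.1 (CompEnt.permUnitary (π l)).2
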